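/- Let $\mathfrak g$ be a finite-dimensional real nilpotent Lie algebra with dual $\mathfrak g^\sharp$, $\langle X|\xi\rangle:=\xi(X)$, and let $\bullet$ be the Baker–Campbell–Hausdorff product $X\bullet Y=X+Y+\frac12[X,Y]+\dots$ on $\mathfrak g$ (so $(\mathfrak g,\bullet)$ is, through the exponential map, the connected simply connected nilpotent Lie group with Lie algebra $\mathfrak g$). Let $dX$ be a Haar (Lebesgue) measure on $\mathfrak g$, and $d\xi$ the Haar measure on $\mathfrak g^\sharp$ for which $(\mathcal Fu)(\xi)=\int_{\mathfrak g}e^{-i\langle X|\xi\rangle}u(X)\,dX$ has inverse $(\mathcal F^{-1}w)(X)=\int_{\mathfrak g^\sharp}e^{i\langle X|\xi\rangle}w(\xi)\,d\xi$. Put $\Xi:=\mathfrak g\times\mathfrak g^\sharp$ with the measure $dX\,d\xi$, and $\mathcal H:=L^2(\mathfrak g)$. Scalar products, and the dualities $\langle\cdot,\cdot\rangle$ between tempered distributions and Schwartz functions that extend them, are linear in the first and antilinear in the second variable. *Weyl system.* For $(Z,\zeta)\in\Xi$ let $\varepsilon_{(Z,\zeta)}(X,\xi):=e^{i\langle X|\zeta\rangle}e^{-i\langle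 Z|\xi\rangle}$ and $[\mathsf E(Z,\zeta)u](X):=e^{i\langle X|\zeta\rangle}u([-Z]\bullet X)$. This is a unitary operator on $\mathcal H$ whose adjoint $[\mathsf E(Z,\zeta)^*u](X)=e^{-i\langle Z\bullet X|\zeta\rangle}u(Z\bullet X)$ preserves $\mathcal S(\mathfrak g)$; on $\mathcal S'(\mathfrak g)$ one sets $\langle\mathsf E(\mathcal Z)\Phi,v\rangle:=\langle\Phi,\mathsf E(\mathcal Z)^*v\rangle$. For $\mathcal Y,\mathcal Z\in\Xi$ put $\Theta_{\mathcal Y,\mathcal Z}(A):=\mathsf E(\mathcal Y)A\,\mathsf E(\mathcal Z)^*$, both for $A\in\mathbb B(\mathcal H)$ and for continuous linear $A:\mathcal S(\mathfrak g)\to\mathcal S'(\mathfrak g)$. *Quantization.* For $f\in\mathcal S(\Xi)$ and $u\in\mathcal S(\mathfrak g)$ let $[\mathsf{Op}(f)u](X):=\int_{\mathfrak g}\int_{\mathfrak g^\sharp}e^{i\langle X\bullet(-Y)|\xi\rangle}f(X,\xi)u(Y)\,d\xi\,dY$. For $u,v\in\mathcal S(\mathfrak g)$ let $\mathcal W_{u,v}\in\mathcal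 S(\Xi)$ be the function with $\langle\mathsf{Op}(f)u,v\rangle=\langle f,\mathcal W_{u,v}\rangle$ for all $f\in\mathcal S(\Xi)$. For $F\in\mathcal S'(\Xi)$ the continuous operator $\mathsf{Op}(F):\mathcal S(\mathfrak g)\to\mathcal S'(\mathfrak g)$ is given by $\langle\mathsf{Op}(F)u,v\rangle:=\langle F,\mathcal W_{u,v}\rangle$. Let $\mathcal A(\Xi)$ be the set of all $F\in\mathcal S'(\Xi)$ for which $\mathsf{Op}(F)$ extends to a bounded operator on $\mathcal H$ (again denoted $\mathsf{Op}(F)$). *Symbol calculus.* For $f,g\in\mathcal S(\Xi)$ let $$(f\#g)(X,\xi)=\int_{\mathfrak g}\int_{\mathfrak g}\int_{\mathfrak g^\sharp}\int_{\mathfrak g^\sharp}e^{-i\langle Y|\xi\rangle}e^{i\langle X\bullet[-Z]|\eta\rangle}e^{i\langle Z\bullet[-X]\bullet Y|\zeta\rangle}f(X,\eta)g(Z,\zeta)\,d\zeta\,d\eta\,dZ\,dY,$$ $$f^\#(X,\xi)=\int_{\mathfrak g}\int_{\mathfrak g^\sharp}e^{i\langle Y|\eta-\xi\rangle}\,\overline{f([-Y]\bullet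 X,\eta)}\,d\eta\,dY.$$ These belong to $\mathcal S(\Xi)$. For $F\in\mathcal S'(\Xi)$ and $g\in\mathcal S(\Xi)$ define $F\#g,\ g\#F,\ F^\#\in\mathcal S'(\Xi)$ by $\langle F\#g,h\rangle=\langle F,h\#g^\#\rangle$, $\langle g\#F,h\rangle=\langle F,g^\#\#h\rangle$, $\langle F^\#,h\rangle=\overline{\langle F,h^\#\rangle}$ for all $h\in\mathcal S(\Xi)$. Let $\mathcal M(\Xi)$ be the set of $G\in\mathcal S'(\Xi)$ with $G\#\mathcal S(\Xi)\subset\mathcal S(\Xi)$ and $\mathcal S(\Xi)\#G\subset\mathcal S(\Xi)$. All $\varepsilon_{\mathcal Z}$ and $\varepsilon_{\mathcal Z}^\#$ belong to $\mathcal M(\Xi)$, $(\varepsilon_{\mathcal Z}^\#)^\#=\varepsilon_{\mathcal Z}$, and for $G=\varepsilon_{\mathcal Z}$ or $G=\varepsilon_{\mathcal Z}^\#$ and $F\in\mathcal S'(\Xi)$ the formulas $\langle F\#G,h\rangle=\langle F,h\#G^\#\rangle$ and $\langle G\#F,h\rangle=\langle F,G^\#\#h\rangle$ ($h\in\mathcal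 S(\Xi)$) define tempered distributions $F\#G$, $G\#F$. Put $\theta_{\mathcal Y,\mathcal Z}(F):=\varepsilon_{\mathcal Y}\#F\#\varepsilon_{\mathcal Z}^\#$, where both ways of placing the parentheses give the same result. **Proposition.** All these objects are well defined, and for all $\mathcal Y,\mathcal Z\in\Xi$ the following holds. 1. For every $F\in\mathcal S'(\Xi)$, as operators $\mathcal S(\mathfrak g)\to\mathcal S'(\mathfrak g)$, $$\Theta_{\mathcal Y,\mathcal Z}[\mathsf{Op}(F)]=\mathsf E(\mathcal Y)\,\mathsf{Op}(F)\,\mathsf E(\mathcal Z)^*=\mathsf{Op}\big(\varepsilon_{\mathcal Y}\#F\#\varepsilon_{\mathcal Z}^\#\big)=\mathsf{Op}[\theta_{\mathcal Y,\mathcal Z}(F)].$$ 2. If $\mathsf{Op}(F)$ extends to a bounded operator on $\mathcal H$, then so does $\mathsf{Op}[\theta_{\mathcal Y,\mathcal Z}(F)]$, and the same identity holds in $\mathbb B(\mathcal H)$. 3. Consequently $\mathcal A(\Xi)$ is invariant under all the maps $\theta_{\mathcal Y,\mathcal Z}$. -/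

import Mathlib

open MeasureTheory SchwartzMap
open scoped Nat ComplexConjugate ENNReal

/-! ### Nilpotent Lie algebras and the Baker-Campbell-Hausdorff product -/

/-- A Lie ring whose additive group carries a norm. No compatibility between the norm and the
bracket is required. -/
class NormedLieRing (L : Type*) extends NormedAddCommGroup L, LieRing L

/-- A real Lie algebra carrying a vector space norm. In finite dimension the norm is only a way to
speak about the canonical topology, Schwartz functions, and so on. -/
class NormedLieAlgebra (L : Type*) [NormedLieRing L] extends NormedSpace ℝ L, LieAlgebra ℝ L

/-- The iterated bracket `[x₁, [x₂, [… , x_m]]]` of a word. -/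
def nestedBracket {L : Type*} [LieRing L] : List L → L
  | [] => 0
  | [x] => x
  | x :: y :: l => ⁅x, nestedBracket (y :: l)⁆

/-- The Baker-Campbell-Hausdorff series `log (exp X exp Y)` in Dynkin's form
`∑ₙ (-1)ⁿ⁻¹/n ∑_{(rᵢ,sᵢ) ≠ 0} [X^{r₁} Y^{s₁} ⋯ X^{rₙ} Y^{sₙ}] / (∑ᵢ (rᵢ+sᵢ) · ∏ᵢ rᵢ! sᵢ!)`,
with the indices `n`, `rᵢ`, `sᵢ` at most `c`. -/
noncomputable def bchUpTo {L : Type*} [LieRing L] [LieAlgebra ℝ L] (c : ℕ) (X Y : L) : L :=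
  ∑ n ∈ Finset.Icc 1 c, ((-1 : ℝ) ^ (n - 1) / (n : ℝ)) •
    ∑ p ∈ Fintype.piFinset (fun _ : Fin n =>
        (Finset.range (c + 1) ×ˢ Finset.range (c + 1)).filter (fun q : ℕ × ℕ => q ≠ (0, 0))),
      ((∑ i, (((p i).1 : ℝ) + ((p i).2 : ℝ))) *
          ∏ i, ((((p i).1)! : ℝ) * (((p i).2)! : ℝ)))⁻¹ •
        nestedBracket
          (List.ofFn (fun i => List.replicate (p i).1 X ++ List.replicate (p i).2 Y)).flatten

/-- The group law `X • Y = log (exp X exp Y)` on a nilpotent Lie algebra: brackets of more letters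
than the nilpotency length vanish, so that the series stops there. -/
noncomputable def bch {L : Type*} [LieRing L] [LieAlgebra ℝ L] (X Y : L) : L :=
  bchUpTo (LieModule.nilpotencyLength L L) X Y

/-! ### Conventions on Schwartz functions and tempered distributions -/

section Conventions

variable {E : Type*} [NormedAddCommGroup E] [NormedSpace ℝ E]

/-- The complex conjugate of a Schwartz function. -/
noncomputable def conjS (h : 𝓢(E, ℂ)) : 𝓢(E, ℂ) :=
  SchwartzMap.postcompCLM (Complex.conjCLE : ℂ →L[ℝ] ℂ) h

/-- The sesquilinear duality `⟨T, h⟩` between tempered distributions and Schwartz functions,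
extending the scalar product (linear in the first variable) of `L²`. -/
noncomputable def pair (T : 𝓢'(E, ℂ)) (h : 𝓢(E, ℂ)) : ℂ := T (conjS h)

variable [MeasurableSpace E] [BorelSpace E] [SecondCountableTopology E]

/-- The tempered distribution `⟨distS f, h⟩ = ∫ f conj h` attached to a Schwartz function. -/
noncomputable def distS (μ : Measure E) [μ.HasTemperateGrowth] (f : 𝓢(E, ℂ)) : 𝓢'(E, ℂ) :=
  SchwartzMap.toTemperedDistributionCLM E ℂ μ f

/-- The Schwartz function representing a tempered distribution (meaningful if there is one). -/
noncomputable def schwartzOf (μ : Measure E) [μ.HasTemperateGrowth] (T : 𝓢'(E, ℂ)) : 𝓢(E, ℂ) :=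
  Classical.epsilon fun k : 𝓢(E, ℂ) => distS μ k = T

end Conventions

/-! ### Phase space and the Weyl system -/

/-- Phase space `Ξ = 𝔤 × 𝔤♯`. -/
abbrev PhaseSpace (𝔤 : Type*) [NormedLieRing 𝔤] [NormedLieAlgebra 𝔤] : Type _ :=
  𝔤 × (𝔤 →L[ℝ] ℝ)

section Calculus

variable {𝔤 : Type*} [NormedLieRing 𝔤] [NormedLieAlgebra 𝔤]

/-- The imaginary exponential `e^{it}`. -/
noncomputable def eI (t : ℝ) : ℂ := Complex.exp (Complex.I * (t : ℂ))

/-- `ε_{(Z,ζ)}(X,ξ) = e^{i⟨X|ζ⟩} e^{-i⟨Z|ξ⟩}`. -/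
noncomputable def eps (𝒵 𝒳 : PhaseSpace 𝔤) : ℂ := eI (𝒵.2 𝒳.1) * eI (-(𝒳.2 𝒵.1))

/-- `[E(Z,ζ)u](X) = e^{i⟨X|ζ⟩} u([-Z]•X)`, on functions. -/
noncomputable def weylFun (𝒵 : PhaseSpace 𝔤) (u : 𝔤 → ℂ) (X : 𝔤) : ℂ :=
  eI (𝒵.2 X) * u (bch (-𝒵.1) X)

/-- `[E(Z,ζ)*u](X) = e^{-i⟨Z•X|ζ⟩} u(Z•X)`, on functions. -/
noncomputable def weylAdjFun (𝒵 : PhaseSpace 𝔤) (u : 𝔤 → ℂ) (X : 𝔤) : ℂ :=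
  eI (-(𝒵.2 (bch 𝒵.1 X))) * u (bch 𝒵.1 X)

/-- `E(𝒵)*` as a continuous operator on the Schwartz space. -/
noncomputable def weylAdjS (𝒵 : PhaseSpace 𝔤) : 𝓢(𝔤, ℂ) →L[ℂ] 𝓢(𝔤, ℂ) :=
  Classical.epsilon fun S : 𝓢(𝔤, ℂ) →L[ℂ] 𝓢(𝔤, ℂ) =>
    ∀ (u : 𝓢(𝔤, ℂ)) (X : 𝔤), S u X = weylAdjFun 𝒵 u X

/-- `E(𝒵)` as a continuous operator on tempered distributions, `⟨E(𝒵)Φ, v⟩ = ⟨Φ, E(𝒵)*v⟩`. -/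
noncomputable def weylD (𝒵 : PhaseSpace 𝔤) : 𝓢'(𝔤, ℂ) →L[ℂ] 𝓢'(𝔤, ℂ) :=
  Classical.epsilon fun S : 𝓢'(𝔤, ℂ) →L[ℂ] 𝓢'(𝔤, ℂ) =>
    ∀ (Φ : 𝓢'(𝔤, ℂ)) (v : 𝓢(𝔤, ℂ)), pair (S Φ) v = pair Φ (weylAdjS 𝒵 v)

/-- `Θ_{𝒴,𝒵}(A) = E(𝒴) A E(𝒵)*` for continuous operators `A` from `𝓢(𝔤)` to `𝓢'(𝔤)`. -/
noncomputable def ThetaD (𝒴 𝒵 : PhaseSpace 𝔤) (A : 𝓢(𝔤, ℂ) →L[ℂ] 𝓢'(𝔤, ℂ)) :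
    𝓢(𝔤, ℂ) →L[ℂ] 𝓢'(𝔤, ℂ) :=
  (weylD 𝒴).comp (A.comp (weylAdjS 𝒵))

variable [MeasurableSpace 𝔤]

/-- `E(𝒵)` as a bounded operator on the Hilbert space `L²(𝔤)`. -/
noncomputable def weylL2 (μ : Measure 𝔤) (𝒵 : PhaseSpace 𝔤) : Lp ℂ 2 μ →L[ℂ] Lp ℂ 2 μ :=
  Classical.epsilon fun S : Lp ℂ 2 μ →L[ℂ] Lp ℂ 2 μ =>
    ∀ u : Lp ℂ 2 μ, (S u : 𝔤 → ℂ) =ᵐ[μ] weylFun 𝒵 u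

/-- `Θ_{𝒴,𝒵}(A) = E(𝒴) A E(𝒵)*` for bounded operators `A` on `L²(𝔤)`. -/
noncomputable def ThetaB (μ : Measure 𝔤) (𝒴 𝒵 : PhaseSpace 𝔤) (A : Lp ℂ 2 μ →L[ℂ] Lp ℂ 2 μ) :
    Lp ℂ 2 μ →L[ℂ] Lp ℂ 2 μ :=
  (weylL2 μ 𝒴).comp (A.comp (ContinuousLinearMap.adjoint (weylL2 μ 𝒵)))

variable [FiniteDimensional ℝ 𝔤] [BorelSpace 𝔤]

/-- The Haar measure `dξ` on `𝔤♯` dual to the Haar measure `dX = μ` on `𝔤`, i.e. the one for which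
`(F u)(ξ) = ∫ e^{-i⟨X|ξ⟩} u(X) dX` has inverse `(F⁻¹ w)(X) = ∫ e^{i⟨X|ξ⟩} w(ξ) dξ`: if `μ` gives mass
`m` to the parallelepiped of a basis, `dξ` gives mass `(2π)⁻ⁿ m⁻¹` to that of the dual basis. -/
noncomputable def dualHaar (μ : Measure 𝔤) : Measure (𝔤 →L[ℝ] ℝ) :=
  (ENNReal.ofReal ((2 * Real.pi) ^ Module.finrank ℝ 𝔤) *
      μ (parallelepiped (Module.finBasis ℝ 𝔤)))⁻¹ •
    ((Module.finBasis ℝ 𝔤).dualBasis.map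
      (LinearMap.toContinuousLinearMap : (𝔤 →ₗ[ℝ] ℝ) ≃ₗ[ℝ] (𝔤 →L[ℝ] ℝ))).addHaar

instance dualHaar_isAddHaarMeasure (μ : Measure 𝔤) [μ.IsAddHaarMeasure] :
    (dualHaar μ).IsAddHaarMeasure := by
  set b := Module.finBasis ℝ 𝔤
  have h0 : μ (parallelepiped b) ≠ 0 :=
    (Measure.measure_pos_of_nonempty_interior μ b.parallelepiped.interior_nonempty).ne'
  have h1 : μ (parallelepiped b) ≠ ∞ := b.parallelepiped.isCompact.measure_lt_top.ne
  have h2 : ENNReal.ofReal ((2 * Real.pi) ^ Module.finrank ℝ 𝔤) ≠ 0 := by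
    rw [ne_eq, ENNReal.ofReal_eq_zero, not_le]
    positivity
  exact Measure.IsAddHaarMeasure.smul _
    (ENNReal.inv_ne_zero.2 (ENNReal.mul_ne_top ENNReal.ofReal_ne_top h1))
    (ENNReal.inv_ne_top.2 (mul_ne_zero h2 h0))

variable (μ : Measure 𝔤) [μ.IsAddHaarMeasure]

/-- The measure `dX dξ` on phase space. -/
noncomputable abbrev phaseMeasure : Measure (PhaseSpace 𝔤) := μ.prod (dualHaar μ)

/-! ### Quantization -/

/-- `[Op(f)u](X) = ∫∫ e^{i⟨X•(-Y)|ξ⟩} f(X,ξ) u(Y) dY dξ`, on functions. -/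
noncomputable def opFun (f : PhaseSpace 𝔤 → ℂ) (u : 𝔤 → ℂ) (X : 𝔤) : ℂ :=
  ∫ Y, ∫ ξ, eI (ξ (bch X (-Y))) * f (X, ξ) * u Y ∂(dualHaar μ) ∂μ

/-- The Wigner transform `W_{u,v}`, given by `⟨Op(f)u, v⟩ = ⟨f, W_{u,v}⟩` for all Schwartz `f`. -/
noncomputable def wigner (u v : 𝓢(𝔤, ℂ)) : 𝓢(PhaseSpace 𝔤, ℂ) :=
  Classical.epsilon fun w : 𝓢(PhaseSpace 𝔤, ℂ) => ∀ f : 𝓢(PhaseSpace 𝔤, ℂ),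
    ∫ X, opFun μ f u X * conj (v X) ∂μ = ∫ 𝒳, f 𝒳 * conj (w 𝒳) ∂(phaseMeasure μ)

/-- `Op(F) : 𝓢(𝔤) → 𝓢'(𝔤)` for `F ∈ 𝓢'(Ξ)`, given by `⟨Op(F)u, v⟩ = ⟨F, W_{u,v}⟩`. -/
noncomputable def op (F : 𝓢'(PhaseSpace 𝔤, ℂ)) : 𝓢(𝔤, ℂ) →L[ℂ] 𝓢'(𝔤, ℂ) :=
  Classical.epsilon fun A : 𝓢(𝔤, ℂ) →L[ℂ] 𝓢'(𝔤, ℂ) =>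
    ∀ u v : 𝓢(𝔤, ℂ), pair (A u) v = pair F (wigner μ u v)

/-- `Op(F)` extends to the bounded operator `T` of `L²(𝔤)`: `⟨Op(F)u, v⟩ = ⟨Tu, v⟩` for all Schwartz
`u`, `v`. (The inner product of Mathlib is linear in the second variable.) -/
def OpExtendsTo (F : 𝓢'(PhaseSpace 𝔤, ℂ)) (T : Lp ℂ 2 μ →L[ℂ] Lp ℂ 2 μ) : Prop :=
  ∀ u v : 𝓢(𝔤, ℂ), pair (op μ F u) v = inner ℂ (v.toLp 2 μ) (T (u.toLp 2 μ))

/-- The symbol `C*`-algebra `𝒜(Ξ) = {F ∈ 𝓢'(Ξ) | Op(F) ∈ 𝔹(L²(𝔤))}`. -/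
def symbolAlgebra : Set 𝓢'(PhaseSpace 𝔤, ℂ) := {F | ∃ T, OpExtendsTo μ F T}

/-! ### Composition and involution of symbols -/

/-- The integral formula for the product `f # g`. -/
noncomputable def moyalFun (f g : PhaseSpace 𝔤 → ℂ) (𝒳 : PhaseSpace 𝔤) : ℂ :=
  ∫ Y, ∫ Z, ∫ η, ∫ ζ, eI (-(𝒳.2 Y)) * eI (η (bch 𝒳.1 (-Z))) * eI (ζ (bch (bch Z (-𝒳.1)) Y)) *
    f (𝒳.1, η) * g (Z, ζ) ∂(dualHaar μ) ∂(dualHaar μ) ∂μ ∂μ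

/-- The integral formula for the involution `f ↦ f^#`. -/
noncomputable def invFun (f : PhaseSpace 𝔤 → ℂ) (𝒳 : PhaseSpace 𝔤) : ℂ :=
  ∫ Y, ∫ η, eI ((η - 𝒳.2) Y) * conj (f (bch (-Y) 𝒳.1, η)) ∂(dualHaar μ) ∂μ

/-- `f # g` for `f, g ∈ 𝓢(Ξ)`. -/
noncomputable def moyalS (f g : 𝓢(PhaseSpace 𝔤, ℂ)) : 𝓢(PhaseSpace 𝔤, ℂ) :=
  Classical.epsilon fun k : 𝓢(PhaseSpace 𝔤, ℂ) => ∀ 𝒳, k 𝒳 = moyalFun μ f g 𝒳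

/-- `f^#` for `f ∈ 𝓢(Ξ)`. -/
noncomputable def invS (f : 𝓢(PhaseSpace 𝔤, ℂ)) : 𝓢(PhaseSpace 𝔤, ℂ) :=
  Classical.epsilon fun k : 𝓢(PhaseSpace 𝔤, ℂ) => ∀ 𝒳, k 𝒳 = invFun μ f 𝒳

/-- `F # g` for `F ∈ 𝓢'(Ξ)`, `g ∈ 𝓢(Ξ)`: `⟨F # g, h⟩ = ⟨F, h # g^#⟩`. -/
noncomputable def moyalDS (F : 𝓢'(PhaseSpace 𝔤, ℂ)) (g : 𝓢(PhaseSpace 𝔤, ℂ)) :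
    𝓢'(PhaseSpace 𝔤, ℂ) :=
  Classical.epsilon fun T : 𝓢'(PhaseSpace 𝔤, ℂ) =>
    ∀ h, pair T h = pair F (moyalS μ h (invS μ g))

/-- `g # F` for `g ∈ 𝓢(Ξ)`, `F ∈ 𝓢'(Ξ)`: `⟨g # F, h⟩ = ⟨F, g^# # h⟩`. -/
noncomputable def moyalSD (g : 𝓢(PhaseSpace 𝔤, ℂ)) (F : 𝓢'(PhaseSpace 𝔤, ℂ)) :
    𝓢'(PhaseSpace 𝔤, ℂ) :=
  Classical.epsilon fun T : 𝓢'(PhaseSpace 𝔤, ℂ) =>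
    ∀ h, pair T h = pair F (moyalS μ (invS μ g) h)

/-- `F^#` for `F ∈ 𝓢'(Ξ)`: `⟨F^#, h⟩ = ⟨h^#, F⟩`, the complex conjugate of `⟨F, h^#⟩`. -/
noncomputable def invD (F : 𝓢'(PhaseSpace 𝔤, ℂ)) : 𝓢'(PhaseSpace 𝔤, ℂ) :=
  Classical.epsilon fun T : 𝓢'(PhaseSpace 𝔤, ℂ) => ∀ h, pair T h = conj (pair F (invS μ h))

/-- The Moyal algebra: `F ∈ 𝓢'(Ξ)` with `F # 𝓢(Ξ) ⊆ 𝓢(Ξ)` and `𝓢(Ξ) # F ⊆ 𝓢(Ξ)`. -/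
def moyalAlgebra : Set 𝓢'(PhaseSpace 𝔤, ℂ) :=
  {F | (∀ g, moyalDS μ F g ∈ Set.range (distS (phaseMeasure μ))) ∧
    ∀ g, moyalSD μ g F ∈ Set.range (distS (phaseMeasure μ))}

/-- `F # G` for `F ∈ 𝓢'(Ξ)` and `G` in the Moyal algebra: `⟨F # G, h⟩ = ⟨F, h # G^#⟩`, where
`h # G^#` is a Schwartz function. -/
noncomputable def moyalDM (F G : 𝓢'(PhaseSpace 𝔤, ℂ)) : 𝓢'(PhaseSpace 𝔤, ℂ) :=
  Classical.epsilon fun T : 𝓢'(PhaseSpace 𝔤, ℂ) =>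
    ∀ h, pair T h = pair F (schwartzOf (phaseMeasure μ) (moyalSD μ h (invD μ G)))

/-- `G # F` for `G` in the Moyal algebra and `F ∈ 𝓢'(Ξ)`: `⟨G # F, h⟩ = ⟨F, G^# # h⟩`, where
`G^# # h` is a Schwartz function. -/
noncomputable def moyalMD (G F : 𝓢'(PhaseSpace 𝔤, ℂ)) : 𝓢'(PhaseSpace 𝔤, ℂ) :=
  Classical.epsilon fun T : 𝓢'(PhaseSpace 𝔤, ℂ) =>
    ∀ h, pair T h = pair F (schwartzOf (phaseMeasure μ) (moyalDS μ (invD μ G) h))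

/-- The function `ε_𝒵` as a tempered distribution: `⟨ε_𝒵, h⟩ = ∫ ε_𝒵 conj h`. -/
noncomputable def epsD (𝒵 : PhaseSpace 𝔤) : 𝓢'(PhaseSpace 𝔤, ℂ) :=
  Classical.epsilon fun T : 𝓢'(PhaseSpace 𝔤, ℂ) =>
    ∀ h, pair T h = ∫ 𝒳, eps 𝒵 𝒳 * conj (h 𝒳) ∂(phaseMeasure μ)

/-- The phase-space shift `θ_{𝒴,𝒵}(F) = ε_𝒴 # F # ε_𝒵^#` of symbols `F ∈ 𝓢'(Ξ)`. -/
noncomputable def theta (𝒴 𝒵 : PhaseSpace 𝔤) (F : 𝓢'(PhaseSpace 𝔤, ℂ)) : 𝓢'(PhaseSpace 𝔤, ℂ) :=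
  moyalDM μ (moyalMD μ (epsD μ 𝒴) F) (invD μ (epsD μ 𝒵))

/-- All the objects above exist, that is, they have the property through which they were
introduced. The statement is part of what has to be proved, it is never assumed. -/
structure WellDefined : Prop where
  weylAdjS_apply : ∀ (𝒵 : PhaseSpace 𝔤) (u : 𝓢(𝔤, ℂ)) (X : 𝔤),
    weylAdjS 𝒵 u X = weylAdjFun 𝒵 u X
  pair_weylD : ∀ (𝒵 : PhaseSpace 𝔤) (Φ : 𝓢'(𝔤, ℂ)) (v : 𝓢(𝔤, ℂ)),
    pair (weylD 𝒵 Φ) v = pair Φ (weylAdjS 𝒵 v)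
  weylL2_ae : ∀ (𝒵 : PhaseSpace 𝔤) (u : Lp ℂ 2 μ), (weylL2 μ 𝒵 u : 𝔤 → ℂ) =ᵐ[μ] weylFun 𝒵 u
  weylL2_unitary : ∀ 𝒵 : PhaseSpace 𝔤, weylL2 μ 𝒵 ∈ unitary (Lp ℂ 2 μ →L[ℂ] Lp ℂ 2 μ)
  wigner_spec : ∀ (u v : 𝓢(𝔤, ℂ)) (f : 𝓢(PhaseSpace 𝔤, ℂ)),
    ∫ X, opFun μ f u X * conj (v X) ∂μ = ∫ 𝒳, f 𝒳 * conj (wigner μ u v 𝒳) ∂(phaseMeasure μ)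
  pair_op : ∀ (F : 𝓢'(PhaseSpace 𝔤, ℂ)) (u v : 𝓢(𝔤, ℂ)),
    pair (op μ F u) v = pair F (wigner μ u v)
  moyalS_apply : ∀ (f g : 𝓢(PhaseSpace 𝔤, ℂ)) (𝒳 : PhaseSpace 𝔤),
    moyalS μ f g 𝒳 = moyalFun μ f g 𝒳
  invS_apply : ∀ (f : 𝓢(PhaseSpace 𝔤, ℂ)) (𝒳 : PhaseSpace 𝔤), invS μ f 𝒳 = invFun μ f 𝒳
  pair_moyalDS : ∀ (F : 𝓢'(PhaseSpace 𝔤, ℂ)) (g h : 𝓢(PhaseSpace 𝔤, ℂ)),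
    pair (moyalDS μ F g) h = pair F (moyalS μ h (invS μ g))
  pair_moyalSD : ∀ (F : 𝓢'(PhaseSpace 𝔤, ℂ)) (g h : 𝓢(PhaseSpace 𝔤, ℂ)),
    pair (moyalSD μ g F) h = pair F (moyalS μ (invS μ g) h)
  pair_invD : ∀ (F : 𝓢'(PhaseSpace 𝔤, ℂ)) (h : 𝓢(PhaseSpace 𝔤, ℂ)),
    pair (invD μ F) h = conj (pair F (invS μ h))
  pair_epsD : ∀ (𝒵 : PhaseSpace 𝔤) (h : 𝓢(PhaseSpace 𝔤, ℂ)),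
    pair (epsD μ 𝒵) h = ∫ 𝒳, eps 𝒵 𝒳 * conj (h 𝒳) ∂(phaseMeasure μ)
  epsD_mem : ∀ 𝒵 : PhaseSpace 𝔤, epsD μ 𝒵 ∈ moyalAlgebra μ
  invD_epsD_mem : ∀ 𝒵 : PhaseSpace 𝔤, invD μ (epsD μ 𝒵) ∈ moyalAlgebra μ
  invD_invD_epsD : ∀ 𝒵 : PhaseSpace 𝔤, invD μ (invD μ (epsD μ 𝒵)) = epsD μ 𝒵
  pair_moyalMD : ∀ (𝒴 : PhaseSpace 𝔤) (F : 𝓢'(PhaseSpace 𝔤, ℂ)) (h : 𝓢(PhaseSpace 𝔤, ℂ)),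
    pair (moyalMD μ (epsD μ 𝒴) F) h =
      pair F (schwartzOf (phaseMeasure μ) (moyalDS μ (invD μ (epsD μ 𝒴)) h))
  pair_moyalDM : ∀ (𝒵 : PhaseSpace 𝔤) (F : 𝓢'(PhaseSpace 𝔤, ℂ)) (h : 𝓢(PhaseSpace 𝔤, ℂ)),
    pair (moyalDM μ F (invD μ (epsD μ 𝒵))) h =
      pair F (schwartzOf (phaseMeasure μ) (moyalSD μ h (invD μ (invD μ (epsD μ 𝒵)))))
  assoc : ∀ (𝒴 𝒵 : PhaseSpace 𝔤) (F : 𝓢'(PhaseSpace 𝔤, ℂ)),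
    moyalDM μ (moyalMD μ (epsD μ 𝒴) F) (invD μ (epsD μ 𝒵)) =
      moyalMD μ (epsD μ 𝒴) (moyalDM μ F (invD μ (epsD μ 𝒵)))

end Calculus

/-! For a Schwartz symbol f, Op(f) is the integral operator whose kernel K_f(X,Y) is the Fourier
transform of f(X,·) evaluated at X•(-Y). The map f ↦ K_f (`kernelOf`) is an isomorphism of 𝓢(Ξ) onto
𝓢(𝔤×𝔤) that preserves the L² pairing, with inverse `symbolOf`. Under it # becomes composition of
kernels, ^# becomes K(X,Y) ↦ conj K(Y,X), and W_{u,v} is the symbol of the rank-one kernel v(X) conj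
u(Y).

The function ε_𝒵 is the symbol of E(𝒵): the Fourier integral of e^{-i⟨Z|ξ⟩} in the fibre over X
lives on X•(-Y) = Z, that is on Y = (-Z)•X (`isWeightedShift_epsD`). Hence # with ε_𝒵 or ε_𝒵^#
composes a Schwartz kernel with a translation times a phase, which gives a Schwartz kernel again.
Dually, θ(F) paired with W_{u,v} is F paired with the symbol of E(𝒴)*|v⟩⟨u|E(𝒵) = |E(𝒴)*v⟩⟨E(𝒵)*u|,
that is with W_{E(𝒵)*u, E(𝒴)*v}. This is `pair_op_theta`, the heart of the proof. The bounded case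
follows since the Hilbert space adjoint of E restricts to E* on Schwartz functions. The two
placements of parentheses agree because left and right composition act on different variables of a
kernel.

Three foundations carry this. The first is that • is a group law. In an algebra with a nilpotent
filtration, Dynkin's series is compared with log(e^x e^y) by passing to tx, ty over A[t] and
applying t d/dt: the logarithmic derivative of exp (`derivation_exp`) writes t d/dt
log(e^{tx}e^{ty}) through e^{ad x}e^{ad y}, whose expansion is Dynkin's series without the
denominators that count letters (`NilFiltration.exp_bchUpTo`). The group axioms then hold in any
representation by nilpotent operators. The adjoint representation loses the centre, so smooth curves
in 𝔤 are used, with the derivation d/ds adjoined: this representation determines a curve up to its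
value at 0, and the rays sX give the axioms at s = 1.

The second is that translations preserve Lebesgue measure: their derivatives are a scalar plus a
nilpotent map, with determinant 1. The third is that partial Fourier transforms preserve Schwartz
functions, together with Fourier inversion for the dual Haar measure; since • is polynomial, the
changes of variables also preserve the Schwartz space. -/

set_option linter.unusedSectionVars false

/-! ### Evaluation of power series at nilpotent elements -/

section NilEval

open PowerSeries

variable {A : Type*} [Ring A] [Algebra ℝ A]

/-- The value of a power series at an element whose `N`-th power vanishes. -/
noncomputable def nilEval (a : A) (N : ℕ) (f : ℝ⟦X⟧) : A := Polynomial.aeval a (trunc N f)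

theorem nilEval_eq_sum (a : A) (N : ℕ) (f : ℝ⟦X⟧) :
    nilEval a N f = ∑ i ∈ Finset.range N, coeff i f • a ^ i := by
  have h : trunc N f = ∑ i ∈ Finset.range N, Polynomial.monomial i (coeff i f) := by
    ext n
    simp [coeff_trunc, Polynomial.coeff_monomial]
  rw [nilEval, h, map_sum]
  refine Finset.sum_congr rfl fun i _ => ?_
  rw [Polynomial.aeval_monomial, Algebra.smul_def]

theorem nilEval_add (a : A) (N : ℕ) (f g : ℝ⟦X⟧) :
    nilEval a N (f + g) = nilEval a N f + nilEval a N g := by simp [nilEval]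

theorem nilEval_sub (a : A) (N : ℕ) (f g : ℝ⟦X⟧) :
    nilEval a N (f - g) = nilEval a N f - nilEval a N g := by simp [nilEval]

theorem nilEval_smul (a : A) (N : ℕ) (r : ℝ) (f : ℝ⟦X⟧) :
    nilEval a N (r • f) = r • nilEval a N f := by
  simp [nilEval_eq_sum, Finset.smul_sum, mul_smul]

theorem nilEval_mono {a : A} {N M : ℕ} (h : a ^ N = 0) (hNM : N ≤ M) (f : ℝ⟦X⟧) :
    nilEval a N f = nilEval a M f := by
  rw [nilEval_eq_sum, nilEval_eq_sum]
  refine Finset.sum_subset (Finset.range_mono hNM) fun i _ hi => ?_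
  rw [pow_eq_zero_of_le (by simpa using hi) h, smul_zero]

theorem nilEval_polynomial {a : A} {N : ℕ} (h : a ^ N = 0) (p : Polynomial ℝ) :
    nilEval a N (p : ℝ⟦X⟧) = Polynomial.aeval a p := by
  rw [nilEval_mono h (le_max_left N (p.natDegree + 1)), nilEval_eq_sum,
    Polynomial.aeval_eq_sum_range' (lt_of_lt_of_le (Nat.lt_succ_self _) (le_max_right N _))]
  simp

/-- Truncation is not multiplicative, but the terms it loses are multiples of X^N, which vanish at
a. -/
theorem nilEval_mul {a : A} {N : ℕ} (h : a ^ N = 0) (f g : ℝ⟦X⟧) :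
    nilEval a N (f * g) = nilEval a N f * nilEval a N g := by
  rw [nilEval, ← trunc_trunc_mul_trunc]
  change nilEval a N _ = _
  rw [← Polynomial.coe_mul, nilEval_polynomial h, map_mul]
  rfl

theorem nilEval_one {a : A} {N : ℕ} (h : a ^ N = 0) : nilEval a N 1 = 1 := by
  rw [← Polynomial.coe_one, nilEval_polynomial h, map_one]

theorem nilEval_X {a : A} {N : ℕ} (h : a ^ N = 0) : nilEval a N X = a := by
  rw [← Polynomial.coe_X, nilEval_polynomial h, Polynomial.aeval_X]

theorem nilEval_pow {a : A} {N : ℕ} (h : a ^ N = 0) (f : ℝ⟦X⟧) (k : ℕ) :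
    nilEval a N (f ^ k) = nilEval a N f ^ k := by
  induction k with
  | zero => rw [pow_zero, pow_zero, nilEval_one h]
  | succ k ih => rw [pow_succ, pow_succ, nilEval_mul h, ih]

theorem map_nilEval {B : Type*} [Ring B] [Algebra ℝ B] (e : A →ₐ[ℝ] B) (a : A) (N : ℕ)
    (f : ℝ⟦X⟧) : e (nilEval a N f) = nilEval (e a) N f := by
  simp [nilEval_eq_sum]

theorem nilEval_zero_left {N : ℕ} (hN : 0 < N) (f : ℝ⟦X⟧) :
    nilEval (0 : A) N f = constantCoeff f • (1 : A) := by
  rw [nilEval_eq_sum, Finset.sum_eq_single_of_mem 0 (Finset.mem_range.2 hN)]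
  · simp
  · intro i _ hi
    simp [hi]

/-- A power series without constant term is a multiple of the variable. -/
theorem exists_eq_X_mul {f : ℝ⟦X⟧} (hf : constantCoeff f = 0) : ∃ g : ℝ⟦X⟧, f = X * g :=
  X_dvd_iff.2 hf

theorem nilEval_pow_eq_zero {a : A} {N : ℕ} (h : a ^ N = 0) {f : ℝ⟦X⟧}
    (hf : constantCoeff f = 0) : nilEval a N f ^ N = 0 := by
  obtain ⟨g, rfl⟩ := exists_eq_X_mul hf
  rw [← nilEval_pow h, mul_pow, nilEval_mul h, nilEval_pow h X, nilEval_X h, h, zero_mul]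

theorem nilEval_subst {a : A} {N : ℕ} (h : a ^ N = 0) (f : ℝ⟦X⟧) {g : ℝ⟦X⟧}
    (hg : constantCoeff g = 0) : nilEval a N (f.subst g) = nilEval (nilEval a N g) N f := by
  have hs : HasSubst g := HasSubst.of_constantCoeff_zero' hg
  have hpoly : ∀ p : Polynomial ℝ,
      nilEval a N ((p : ℝ⟦X⟧).subst g) = Polynomial.aeval (nilEval a N g) p := by
    intro p
    rw [subst_coe hs, Polynomial.aeval_eq_sum_range, Polynomial.aeval_eq_sum_range]
    have : ∀ s : Finset ℕ, nilEval a N (∑ i ∈ s, p.coeff i • g ^ i) =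
        ∑ i ∈ s, p.coeff i • nilEval a N g ^ i := by
      intro s
      induction s using Finset.induction_on with
      | empty => simp [nilEval]
      | insert i s hi ih =>
        rw [Finset.sum_insert hi, Finset.sum_insert hi, nilEval_add, nilEval_smul, nilEval_pow h,
          ih]
    exact this _
  -- The tail of f is divisible by X^N; after the substitution it is divisible by g^N, whose value
  -- is zero because g has no constant term.
  have hdvd : (X : ℝ⟦X⟧) ^ N ∣ f - (trunc N f : ℝ⟦X⟧) := by
    rw [X_pow_dvd_iff]
    intro m hm
    rw [map_sub, Polynomial.coeff_coe, coeff_trunc, if_pos hm, sub_self]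
  obtain ⟨k, hk⟩ := hdvd
  have hf : f = (trunc N f : ℝ⟦X⟧) + X ^ N * k := by rw [← hk]; ring
  conv_lhs => rw [hf]
  rw [subst_add hs, nilEval_add, hpoly, subst_mul hs, subst_pow hs, subst_X hs, nilEval_mul h,
    nilEval_pow h, nilEval_pow_eq_zero h hg, zero_mul, add_zero]
  rfl

theorem nilEval_exp [Algebra ℚ A] {a : A} {N : ℕ} (h : a ^ N = 0) :
    nilEval a N (PowerSeries.exp ℝ) = IsNilpotent.exp a := by
  rw [nilEval_eq_sum, IsNilpotent.exp_eq_sum h]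
  refine Finset.sum_congr rfl fun i _ => ?_
  -- The exponential uses rational scalars, the series real ones. Both versions of 1/i! are inverse
  -- to the element i! of A, hence equal.
  have e1 : (i ! : A) = (i ! : ℝ) • (1 : A) := by rw [Nat.cast_smul_eq_nsmul, nsmul_one]
  have e2 : (i ! : A) = (i ! : ℚ) • (1 : A) := by rw [Nat.cast_smul_eq_nsmul, nsmul_one]
  have h1 : ((i ! : ℝ)⁻¹ • (1 : A)) * (i ! : A) = 1 := by
    rw [smul_mul_assoc, one_mul, e1, smul_smul, inv_mul_cancel₀ (by positivity), one_smul]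
  have h2 : (i ! : A) * ((i ! : ℚ)⁻¹ • (1 : A)) = 1 := by
    rw [mul_smul_comm, mul_one, e2, smul_smul, inv_mul_cancel₀ (by positivity), one_smul]
  have h3 := left_inv_eq_right_inv h1 h2
  rw [coeff_exp, ← one_mul (a ^ i), ← smul_mul_assoc, ← smul_mul_assoc, ← h3]
  simp

end NilEval

/-! ### Formal identities between the exponential and logarithmic series -/

section ExpLog

open PowerSeries

theorem one_add_X_mul_deriv_log : (1 + X) * d⁄dX ℝ (log ℝ) = 1 := by
  rw [deriv_log]
  ext n
  rw [add_mul, one_mul, map_add, coeff_mk]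
  cases n with
  | zero => simp
  | succ n => rw [coeff_succ_X_mul, coeff_mk, coeff_one]; simp [pow_succ]

/-- By the chain rule both sides have derivative 1, and neither has a constant term. -/
theorem log_subst_exp_sub_one : (log ℝ).subst (exp ℝ - 1) = X := by
  have hs : HasSubst (exp ℝ - 1) := HasSubst.exp_sub_one
  have h1 : (1 : ℝ⟦X⟧).subst (exp ℝ - 1) = 1 := by
    rw [← coe_substAlgHom hs, map_one]
  refine derivative.ext ?_ ?_
  · have h := congrArg (fun f : ℝ⟦X⟧ => f.subst (exp ℝ - 1)) one_add_X_mul_deriv_log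
    rw [subst_mul hs, subst_add hs, subst_X hs, h1, add_sub_cancel] at h
    rw [derivative_subst hs, map_sub, derivative_exp, Derivation.map_one_eq_zero, sub_zero,
      derivative_X, mul_comm, h]
  · rw [constantCoeff_X]
    exact constantCoeff_subst_eq_zero (by
      rw [map_sub, ← constantCoeff_eq, constantCoeff_exp, map_one, sub_self]) _ constantCoeff_log

/-- Put F = exp(log(1+X)) and l = log'. From F' = F l and (1+X) l = 1 one gets (F l)' = F l² + F l'
= 0, so F l is its constant term 1 and F = 1 + X. -/
theorem exp_subst_log : (exp ℝ).subst (log ℝ) = 1 + X := by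
  have hs : HasSubst (log ℝ) := HasSubst.log
  have h1 : (1 : ℝ⟦X⟧).subst (log ℝ) = 1 := by rw [← coe_substAlgHom hs, map_one]
  set F : ℝ⟦X⟧ := (exp ℝ).subst (log ℝ) with hF
  have hF' : d⁄dX ℝ F = F * d⁄dX ℝ (log ℝ) := by rw [hF, derivative_subst hs, derivative_exp]
  have hF0 : constantCoeff F = 1 := by
    have h2 : F = (exp ℝ - 1).subst (log ℝ) + 1 := by
      rw [subst_sub hs, h1, sub_add_cancel]
    have h3 : constantCoeff ((exp ℝ - 1).subst (log ℝ)) = 0 :=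
      constantCoeff_subst_eq_zero (by rw [← constantCoeff_eq, constantCoeff_log]) _
        (by rw [map_sub, constantCoeff_exp, map_one, sub_self])
    rw [h2, map_add, h3, map_one, zero_add]
  set l : ℝ⟦X⟧ := d⁄dX ℝ (log ℝ) with hl
  have h2 := one_add_X_mul_deriv_log
  rw [← hl] at h2
  have hl' : (1 + X) * d⁄dX ℝ l = - l := by
    have h := congrArg (d⁄dX ℝ) h2
    rw [Derivation.leibniz, map_add, derivative_X, Derivation.map_one_eq_zero] at h
    simp only [zero_add, smul_eq_mul, mul_one] at h
    linear_combination h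
  have h3 : F * l = 1 := by
    refine derivative.ext ?_ ?_
    · rw [Derivation.leibniz, hF', Derivation.map_one_eq_zero, smul_eq_mul, smul_eq_mul]
      linear_combination -F * d⁄dX ℝ l * h2 + F * l * hl'
    · have := congrArg constantCoeff h2
      simp only [map_mul, map_add, map_one, constantCoeff_X, add_zero, one_mul] at this
      rw [map_mul, hF0, this, map_one, one_mul]
  linear_combination (1 + X) * h3 - F * h2

/-- The series `log (1 + w) / w`. -/
noncomputable def logDiv : ℝ⟦X⟧ := mk fun n => (-1 : ℝ) ^ n / (n + 1)

/-- The series `(e^u - 1) / u`. -/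
noncomputable def expDiv : ℝ⟦X⟧ := mk fun n => ((n + 1)! : ℝ)⁻¹

theorem X_mul_logDiv : X * logDiv = log ℝ := by
  ext n
  cases n with
  | zero => simp
  | succ n => rw [coeff_succ_X_mul, logDiv, coeff_mk, coeff_log]; simp [pow_succ]

theorem X_mul_expDiv : X * expDiv = exp ℝ - 1 := by
  ext n
  cases n with
  | zero => simp
  | succ n => rw [coeff_succ_X_mul, expDiv, coeff_mk, map_sub, coeff_exp, coeff_one]; simp

/-- This is log(e^u) = u divided by u. It inverts the operator (e^u - 1)/u occurring in the
logarithmic derivative of exp. -/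
theorem logDiv_subst_mul_expDiv : logDiv.subst (exp ℝ - 1) * expDiv = 1 := by
  have hs : HasSubst (exp ℝ - 1) := HasSubst.exp_sub_one
  have h := log_subst_exp_sub_one
  rw [← X_mul_logDiv, subst_mul hs, subst_X hs, ← X_mul_expDiv] at h
  have h2 : X * (logDiv.subst (X * expDiv) * expDiv) = X * (1 : ℝ⟦X⟧) := by
    rw [mul_one]; conv_rhs => rw [← h]
    ring
  rw [← X_mul_expDiv]
  exact mul_left_cancel₀ X_ne_zero h2

end ExpLog

section NilpotentGroupLaw

attribute [local instance] LieRing.ofAssociativeRing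

/-! ### Exponentials of nilpotent elements and derivations -/

section ExpAd

variable {A : Type*} [Ring A] [Algebra ℝ A] [Algebra ℚ A]

theorem exp_lmul {a : A} (ha : IsNilpotent a) :
    IsNilpotent.exp (LinearMap.mulLeft ℝ a) = LinearMap.mulLeft ℝ (IsNilpotent.exp a) :=
  (IsNilpotent.map_exp ha (Algebra.lmul ℝ A)).symm

theorem exp_rmul {a : A} (ha : IsNilpotent a) :
    IsNilpotent.exp (LinearMap.mulRight ℝ a) = LinearMap.mulRight ℝ (IsNilpotent.exp a) := by
  obtain ⟨N, hN⟩ := ha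
  have h : (LinearMap.mulRight ℝ a) ^ N = 0 := by
    rw [LinearMap.pow_mulRight, hN, LinearMap.mulRight_zero_eq_zero]
  rw [IsNilpotent.exp_eq_sum h, IsNilpotent.exp_eq_sum hN]
  ext b
  simp [LinearMap.pow_mulRight, LinearMap.sum_apply, Finset.mul_sum]

/-- Left and right multiplication by a commute and are nilpotent, so the exponential of their
difference factors. -/
theorem exp_ad_eq {a : A} (ha : IsNilpotent a) :
    IsNilpotent.exp (LieAlgebra.ad ℝ A a) =
      LinearMap.mulLeft ℝ (IsNilpotent.exp a) * LinearMap.mulRight ℝ (IsNilpotent.exp (-a)) := by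
  have h1 : IsNilpotent (LinearMap.mulLeft ℝ a) := ha.map (Algebra.lmul ℝ A)
  have h2 : LinearMap.mulRight ℝ (-a) = -LinearMap.mulRight ℝ a := by ext; simp
  have h3 : IsNilpotent (LinearMap.mulRight ℝ (-a)) := by
    obtain ⟨N, hN⟩ := ha.neg
    exact ⟨N, by rw [LinearMap.pow_mulRight, hN, LinearMap.mulRight_zero_eq_zero]⟩
  rw [LieAlgebra.ad_eq_lmul_left_sub_lmul_right, Pi.sub_apply, sub_eq_add_neg, ← h2,
    IsNilpotent.exp_add_of_commute (LinearMap.commute_mulLeft_right _ _) h1 h3, exp_lmul ha,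
    exp_rmul ha.neg]

theorem exp_ad_apply {a : A} (ha : IsNilpotent a) (b : A) :
    IsNilpotent.exp (LieAlgebra.ad ℝ A a) b = IsNilpotent.exp a * b * IsNilpotent.exp (-a) := by
  rw [exp_ad_eq ha]
  simp [mul_assoc]

open PowerSeries in
theorem exp_sub_one_eq_mul_expDiv {a : A} {N : ℕ} (h : a ^ N = 0) :
    IsNilpotent.exp a - 1 = nilEval a N expDiv * a := by
  rw [← nilEval_exp h, ← nilEval_one h, ← nilEval_sub, ← X_mul_expDiv, mul_comm, nilEval_mul h,
    nilEval_X h]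

/-- The logarithmic derivative of the exponential: `δ (e^a) = ((e^{ad a} - 1) / ad a) (δ a) e^a`. -/
theorem derivation_exp (δ : A →ₗ[ℝ] A) (hδ : ∀ a b, δ (a * b) = δ a * b + a * δ b) {a : A}
    (ha : IsNilpotent a) {M : ℕ} (hM : LieAlgebra.ad ℝ A a ^ M = 0) :
    δ (IsNilpotent.exp a) = nilEval (LieAlgebra.ad ℝ A a) M expDiv (δ a) * IsNilpotent.exp a := by
  -- The derivation is treated as a vector in End A. There [L, δ] is minus left multiplication by δ
  -- a, so e^{ad L} δ - δ is minus left multiplication by ((e^{ad a} - 1)/ad a)(δ a), while it also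
  -- equals e^L δ e^{-L} - δ.
  set L : Module.End ℝ A := LinearMap.mulLeft ℝ a with hL
  have hLn : IsNilpotent L := ha.map (Algebra.lmul ℝ A)
  obtain ⟨K, hK⟩ : IsNilpotent (LieAlgebra.ad ℝ (Module.End ℝ A) L) :=
    LieAlgebra.ad_nilpotent_of_nilpotent hLn
  have hδ1 : δ 1 = 0 := by
    have := hδ 1 1
    simpa using this
  have key : ∀ (b : A) (i : ℕ), (LieAlgebra.ad ℝ (Module.End ℝ A) L ^ i) (LinearMap.mulLeft ℝ b) =
      LinearMap.mulLeft ℝ ((LieAlgebra.ad ℝ A a ^ i) b) := by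
    intro b i
    induction i with
    | zero => simp
    | succ i ih =>
      rw [pow_succ', Module.End.mul_apply, ih, pow_succ', Module.End.mul_apply,
        LieAlgebra.ad_apply, LieAlgebra.ad_apply]
      ext c
      simp [hL, Ring.lie_def, sub_mul, mul_assoc]
  have h1 : LieAlgebra.ad ℝ (Module.End ℝ A) L δ = - LinearMap.mulLeft ℝ (δ a) := by
    rw [LieAlgebra.ad_apply]
    ext c
    simp [hL, Ring.lie_def, hδ]
  have h2 : nilEval (LieAlgebra.ad ℝ (Module.End ℝ A) L) K expDiv (LinearMap.mulLeft ℝ (δ a)) =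
      LinearMap.mulLeft ℝ (nilEval (LieAlgebra.ad ℝ A a) M expDiv (δ a)) := by
    rw [nilEval_mono hK (le_max_left K M), nilEval_mono hM (le_max_right K M), nilEval_eq_sum,
      nilEval_eq_sum, LinearMap.sum_apply, LinearMap.sum_apply]
    simp only [LinearMap.smul_apply, key]
    ext c
    simp [LinearMap.sum_apply, Finset.sum_mul]
  have h3 := exp_ad_apply hLn δ
  have h4 := LinearMap.congr_fun (exp_sub_one_eq_mul_expDiv hK) δ
  rw [LinearMap.sub_apply, Module.End.mul_apply, h1, map_neg, h2, h3, Module.End.one_apply] at h4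
  -- At the vector e^a the conjugated term disappears, since e^{-a} e^a = 1 and δ 1 = 0.
  have h5 := LinearMap.congr_fun h4 (IsNilpotent.exp a)
  have h6 : IsNilpotent.exp (-L) = LinearMap.mulLeft ℝ (IsNilpotent.exp (-a)) := by
    rw [← exp_lmul ha.neg]
    congr 1
    ext
    simp [hL]
  rw [h6, exp_lmul ha] at h5
  simp only [LinearMap.sub_apply, Module.End.mul_apply, LinearMap.mulLeft_apply,
    LinearMap.neg_apply, IsNilpotent.exp_neg_mul_exp_self ha, hδ1, mul_zero, zero_sub,
    neg_inj] at h5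
  exact h5

theorem nilEval_apply_of_map_eq_zero {M : Type*} [AddCommGroup M] [Module ℝ M]
    {T : Module.End ℝ M} {N : ℕ} (hN : 0 < N) {v : M} (hv : T v = 0) (f : PowerSeries ℝ) :
    nilEval T N f v = PowerSeries.constantCoeff f • v := by
  rw [nilEval_eq_sum, LinearMap.sum_apply,
    Finset.sum_eq_single_of_mem 0 (Finset.mem_range.2 hN)]
  · simp
  · intro i _ hi
    obtain ⟨j, rfl⟩ := Nat.exists_eq_succ_of_ne_zero hi
    simp [pow_succ, hv]

theorem derivation_exp_of_map_eq_self (δ : A →ₗ[ℝ] A)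
    (hδ : ∀ a b, δ (a * b) = δ a * b + a * δ b) {a : A} (ha : IsNilpotent a) (h : δ a = a) :
    δ (IsNilpotent.exp a) = a * IsNilpotent.exp a := by
  obtain ⟨M, hM⟩ := LieAlgebra.ad_nilpotent_of_nilpotent (R := ℝ) ha
  -- The order is raised to M + 1 so that the constant term of the series, the only one acting
  -- nontrivially on a, survives truncation.
  have hM' : LieAlgebra.ad ℝ A a ^ (M + 1) = 0 := by rw [pow_succ, hM, zero_mul]
  rw [derivation_exp δ hδ ha hM', h, nilEval_apply_of_map_eq_zero M.succ_pos (by simp)]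
  simp [expDiv]

end ExpAd

/-! ### Nilpotent filtrations -/

/-- A decreasing multiplicative filtration of an algebra that vanishes from the index `N` on. -/
structure NilFiltration (A : Type*) [Ring A] [Algebra ℝ A] (N : ℕ) where
  /-- The terms of the filtration. -/
  F : ℕ → Submodule ℝ A
  anti : Antitone F
  one_mem : (1 : A) ∈ F 0
  mul_mem : ∀ {i j a b}, a ∈ F i → b ∈ F j → a * b ∈ F (i + j)
  eq_bot : F N = ⊥

namespace NilFiltration

variable {A : Type*} [Ring A] [Algebra ℝ A] {N : ℕ} (𝓕 : NilFiltration A N)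

theorem pow_mem {a : A} (ha : a ∈ 𝓕.F 1) (k : ℕ) : a ^ k ∈ 𝓕.F k := by
  induction k with
  | zero => simpa using 𝓕.one_mem
  | succ k ih => exact pow_succ a k ▸ 𝓕.mul_mem ih ha

theorem pow_eq_zero {a : A} (ha : a ∈ 𝓕.F 1) : a ^ N = 0 := by
  have := 𝓕.pow_mem ha N
  rwa [𝓕.eq_bot, Submodule.mem_bot] at this

theorem isNilpotent {a : A} (ha : a ∈ 𝓕.F 1) : IsNilpotent a := ⟨N, 𝓕.pow_eq_zero ha⟩

theorem nilEval_mem {a : A} (ha : a ∈ 𝓕.F 1) {f : PowerSeries ℝ}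
    (hf : PowerSeries.constantCoeff f = 0) : nilEval a N f ∈ 𝓕.F 1 := by
  rw [nilEval_eq_sum]
  refine Submodule.sum_mem _ fun i _ => ?_
  cases i with
  | zero => simp [hf]
  | succ i => exact Submodule.smul_mem _ _ (𝓕.anti (by omega) (𝓕.pow_mem ha (i + 1)))

theorem exp_sub_one_mem [Algebra ℚ A] {a : A} (ha : a ∈ 𝓕.F 1) :
    IsNilpotent.exp a - 1 ∈ 𝓕.F 1 := by
  rw [← nilEval_exp (𝓕.pow_eq_zero ha), ← nilEval_one (𝓕.pow_eq_zero ha), ← nilEval_sub]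
  exact 𝓕.nilEval_mem ha (by simp)

theorem exp_mul_exp_sub_one_mem [Algebra ℚ A] {a b : A} (ha : a ∈ 𝓕.F 1) (hb : b ∈ 𝓕.F 1) :
    IsNilpotent.exp a * IsNilpotent.exp b - 1 ∈ 𝓕.F 1 := by
  have h1 := 𝓕.exp_sub_one_mem ha
  have h2 := 𝓕.exp_sub_one_mem hb
  have h3 : IsNilpotent.exp a * IsNilpotent.exp b - 1 =
      (IsNilpotent.exp a - 1) * (IsNilpotent.exp b - 1) + (IsNilpotent.exp a - 1) +
        (IsNilpotent.exp b - 1) := by noncomm_ring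
  rw [h3]
  exact add_mem (add_mem (𝓕.anti (by omega) (𝓕.mul_mem h1 h2)) h1) h2

theorem log_exp [Algebra ℚ A] {a : A} (ha : a ∈ 𝓕.F 1) :
    nilEval (IsNilpotent.exp a - 1) N (PowerSeries.log ℝ) = a := by
  have h := 𝓕.pow_eq_zero ha
  rw [← nilEval_exp h, ← nilEval_one h, ← nilEval_sub, ← nilEval_subst h _ (by simp),
    log_subst_exp_sub_one, nilEval_X h]

theorem exp_log [Algebra ℚ A] {w : A} (hw : w ∈ 𝓕.F 1) :
    IsNilpotent.exp (nilEval w N (PowerSeries.log ℝ)) = 1 + w := by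
  have h := 𝓕.pow_eq_zero hw
  rw [← nilEval_exp (nilEval_pow_eq_zero h PowerSeries.constantCoeff_log),
    ← nilEval_subst h _ PowerSeries.constantCoeff_log, exp_subst_log, nilEval_add, nilEval_one h,
    nilEval_X h]

theorem exp_injOn [Algebra ℚ A] {a b : A} (ha : a ∈ 𝓕.F 1) (hb : b ∈ 𝓕.F 1)
    (h : IsNilpotent.exp a = IsNilpotent.exp b) : a = b := by
  rw [← 𝓕.log_exp ha, h, 𝓕.log_exp hb]

/-- The logarithm of `e^x e^y`. -/
noncomputable def logExpExp [Algebra ℚ A] (_ : NilFiltration A N) (x y : A) : A :=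
  nilEval (IsNilpotent.exp x * IsNilpotent.exp y - 1) N (PowerSeries.log ℝ)

variable [Algebra ℚ A] {x y : A} (hx : x ∈ 𝓕.F 1) (hy : y ∈ 𝓕.F 1)
include hx hy

theorem logExpExp_mem : 𝓕.logExpExp x y ∈ 𝓕.F 1 :=
  𝓕.nilEval_mem (𝓕.exp_mul_exp_sub_one_mem hx hy) PowerSeries.constantCoeff_log

theorem exp_logExpExp :
    IsNilpotent.exp (𝓕.logExpExp x y) = IsNilpotent.exp x * IsNilpotent.exp y := by
  rw [logExpExp, 𝓕.exp_log (𝓕.exp_mul_exp_sub_one_mem hx hy), add_sub_cancel]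

/-- The Euler derivative of `log (e^x e^y)`. -/
theorem derivation_logExpExp (δ : A →ₗ[ℝ] A) (hδ : ∀ a b, δ (a * b) = δ a * b + a * δ b)
    (hδx : δ x = x) (hδy : δ y = y) : ∃ M₀ : ℕ, ∀ M ≥ M₀,
      δ (𝓕.logExpExp x y) = ∑ k ∈ Finset.range M, ((-1 : ℝ) ^ k / (k + 1)) •
        ((IsNilpotent.exp (LieAlgebra.ad ℝ A x) * IsNilpotent.exp (LieAlgebra.ad ℝ A y) - 1) ^ k)
          (x + IsNilpotent.exp (LieAlgebra.ad ℝ A x) y) := by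
  set c := 𝓕.logExpExp x y with hc
  have hxn := 𝓕.isNilpotent hx
  have hyn := 𝓕.isNilpotent hy
  have hcn : IsNilpotent c := 𝓕.isNilpotent (𝓕.logExpExp_mem hx hy)
  have hexp : IsNilpotent.exp c = IsNilpotent.exp x * IsNilpotent.exp y := 𝓕.exp_logExpExp hx hy
  have hexpneg : IsNilpotent.exp (-c) = IsNilpotent.exp (-y) * IsNilpotent.exp (-x) := by
    refine left_inv_eq_right_inv (IsNilpotent.exp_neg_mul_exp_self hcn) ?_
    rw [hexp, mul_assoc, ← mul_assoc (IsNilpotent.exp y), IsNilpotent.exp_mul_exp_neg_self hyn,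
      one_mul, IsNilpotent.exp_mul_exp_neg_self hxn]
  have had : IsNilpotent.exp (LieAlgebra.ad ℝ A c) =
      IsNilpotent.exp (LieAlgebra.ad ℝ A x) * IsNilpotent.exp (LieAlgebra.ad ℝ A y) := by
    ext b
    rw [Module.End.mul_apply, exp_ad_apply hcn, exp_ad_apply hxn, exp_ad_apply hyn, hexp, hexpneg]
    noncomm_ring
  obtain ⟨M₀, hM₀⟩ := LieAlgebra.ad_nilpotent_of_nilpotent (R := ℝ) hcn
  refine ⟨M₀, fun M hM => ?_⟩
  have hP : LieAlgebra.ad ℝ A c ^ M = 0 := pow_eq_zero_of_le hM hM₀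
  have h1 := derivation_exp δ hδ hcn hP
  rw [hexp, hδ, derivation_exp_of_map_eq_self δ hδ hxn hδx,
    derivation_exp_of_map_eq_self δ hδ hyn hδy] at h1
  -- Computing δ(e^x e^y) by the product rule gives x e^c + e^x y e^y; multiplication by e^{-c} on
  -- the right leaves x + e^{ad x} y.
  have h2 : x + IsNilpotent.exp (LieAlgebra.ad ℝ A x) y =
      nilEval (LieAlgebra.ad ℝ A c) M expDiv (δ c) := by
    have h3 := congrArg (· * (IsNilpotent.exp (-y) * IsNilpotent.exp (-x))) h1
    beta_reduce at h3
    rw [mul_assoc _ (IsNilpotent.exp x * _), ← hexp, ← hexpneg,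
      IsNilpotent.exp_mul_exp_neg_self hcn, mul_one] at h3
    rw [← h3, hexpneg, exp_ad_apply hxn, add_mul]
    have e1 := IsNilpotent.exp_mul_exp_neg_self hxn
    have e2 := IsNilpotent.exp_mul_exp_neg_self hyn
    congr 1
    · calc x = x * (IsNilpotent.exp x * IsNilpotent.exp (-x)) := by rw [e1, mul_one]
        _ = x * (IsNilpotent.exp x * (IsNilpotent.exp y * IsNilpotent.exp (-y)) *
              IsNilpotent.exp (-x)) := by rw [e2, mul_one]
        _ = _ := by simp only [mul_assoc]
    · calc _ = IsNilpotent.exp x * y * (IsNilpotent.exp y * IsNilpotent.exp (-y)) *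
              IsNilpotent.exp (-x) := by rw [e2, mul_one]
        _ = _ := by simp only [mul_assoc]
  -- Since e^{ad x} e^{ad y} = e^{ad c}, the sum is `logDiv` at e^{ad c} - 1, the inverse of
  -- `expDiv` at ad c.
  rw [h2, ← had, ← nilEval_exp hP, ← nilEval_one hP, ← nilEval_sub]
  have h4 : ∀ v : A, ∑ k ∈ Finset.range M, ((-1 : ℝ) ^ k / (k + 1)) •
      ((nilEval (LieAlgebra.ad ℝ A c) M (PowerSeries.exp ℝ - 1) ^ k) v) =
        nilEval (nilEval (LieAlgebra.ad ℝ A c) M (PowerSeries.exp ℝ - 1)) M logDiv v := by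
    intro v
    rw [nilEval_eq_sum _ M logDiv, LinearMap.sum_apply]
    simp [logDiv]
  rw [h4, ← nilEval_subst hP _ (by simp), ← Module.End.mul_apply, ← nilEval_mul hP,
    logDiv_subst_mul_expDiv, nilEval_one hP, Module.End.one_apply]

end NilFiltration

/-! ### Nested brackets and the Baker-Campbell-Hausdorff series -/

section Words

variable {L : Type*} [LieRing L]

theorem nestedBracket_cons (x : L) {l : List L} (hl : l ≠ []) :
    nestedBracket (x :: l) = ⁅x, nestedBracket l⁆ := by
  cases l with
  | nil => exact absurd rfl hl
  | cons y l => rfl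

/-- The word `X^{r₁} Y^{s₁} ⋯ X^{rₙ} Y^{sₙ}`. -/
def bchWord (X Y : L) {n : ℕ} (p : Fin n → ℕ × ℕ) : List L :=
  (List.ofFn (fun i => List.replicate (p i).1 X ++ List.replicate (p i).2 Y)).flatten

theorem bchWord_cons (X Y : L) {n : ℕ} (q : ℕ × ℕ) (p : Fin n → ℕ × ℕ) :
    bchWord X Y (Fin.cons q p : Fin (n + 1) → ℕ × ℕ) =
      List.replicate q.1 X ++ (List.replicate q.2 Y ++ bchWord X Y p) := by
  simp [bchWord, List.ofFn_succ, List.append_assoc]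

theorem mem_bchWord {X Y : L} {n : ℕ} {p : Fin n → ℕ × ℕ} {z : L} (hz : z ∈ bchWord X Y p) :
    z = X ∨ z = Y := by
  simp only [bchWord, List.mem_flatten, List.mem_ofFn] at hz
  obtain ⟨l, ⟨i, rfl⟩, hz⟩ := hz
  rw [List.mem_append] at hz
  exact hz.imp List.eq_of_mem_replicate List.eq_of_mem_replicate

theorem length_bchWord (X Y : L) {n : ℕ} (p : Fin n → ℕ × ℕ) :
    (bchWord X Y p).length = ∑ i, ((p i).1 + (p i).2) := by
  induction n with
  | zero => simp [bchWord]
  | succ n ih =>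
    rw [← Fin.cons_self_tail p, bchWord_cons, List.length_append, List.length_append,
      List.length_replicate, List.length_replicate, ih, Fin.sum_univ_succ]
    simp [add_assoc]

/-- The set of exponents occurring in the Baker-Campbell-Hausdorff series. -/
def bchExponents (c : ℕ) : Finset (ℕ × ℕ) :=
  (Finset.range (c + 1) ×ˢ Finset.range (c + 1)).filter (fun q : ℕ × ℕ => q ≠ (0, 0))

/-- Every pair of exponents is nonzero and so contributes at least one letter. Words are therefore
nonempty, and they exceed any given length when n is large. -/
theorem le_length_bchWord (X Y : L) {n c : ℕ} {p : Fin n → ℕ × ℕ}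
    (hp : p ∈ Fintype.piFinset (fun _ : Fin n => bchExponents c)) :
    n ≤ (bchWord X Y p).length := by
  rw [length_bchWord]
  calc n = ∑ _i : Fin n, 1 := by simp
    _ ≤ _ := by
      refine Finset.sum_le_sum fun i _ => ?_
      have h := (Finset.mem_filter.1 (Fintype.mem_piFinset.1 hp i)).2
      by_contra h'
      exact h (Prod.ext (by simp; omega) (by simp; omega))

/-- Splitting off the first pair of exponents mirrors one further application of e^{ad x} e^{ad y} -
1 from the left. -/
theorem sum_piFinset_cons {M : Type*} [AddCommMonoid M] {n : ℕ} (S : Finset (ℕ × ℕ))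
    (f : (Fin (n + 1) → ℕ × ℕ) → M) :
    ∑ p ∈ Fintype.piFinset (fun _ : Fin (n + 1) => S), f p =
      ∑ p ∈ Fintype.piFinset (fun _ : Fin n => S), ∑ q ∈ S, f (Fin.cons q p) := by
  rw [← Finset.sum_product']
  symm
  refine Finset.sum_nbij' (fun a => Fin.cons a.2 a.1) (fun p => (Fin.tail p, p 0)) ?_ ?_ ?_ ?_ ?_
  · intro a ha
    rw [Finset.mem_product, Fintype.mem_piFinset] at ha
    rw [Fintype.mem_piFinset]
    exact fun i => Fin.cases ha.2 ha.1 i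
  · intro p hp
    rw [Fintype.mem_piFinset] at hp
    rw [Finset.mem_product, Fintype.mem_piFinset]
    exact ⟨fun i => hp i.succ, hp 0⟩
  · intro a _
    simp
  · intro p _
    simp
  · intro a _
    rfl

variable [LieAlgebra ℝ L]

/-- The coefficient `∏ᵢ 1 / (rᵢ! sᵢ!)`. -/
noncomputable def bchCoeff {n : ℕ} (p : Fin n → ℕ × ℕ) : ℝ :=
  (∏ i, ((((p i).1)! : ℝ) * (((p i).2)! : ℝ)))⁻¹

theorem bchUpTo_eq (c : ℕ) (X Y : L) : bchUpTo c X Y =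
    ∑ k ∈ Finset.range c, ((-1 : ℝ) ^ k / (k + 1)) •
      ∑ p ∈ Fintype.piFinset (fun _ : Fin (k + 1) => bchExponents c),
        (((bchWord X Y p).length : ℝ)⁻¹ * bchCoeff p) • nestedBracket (bchWord X Y p) := by
  refine Finset.sum_nbij' (fun n => n - 1) (fun k => k + 1) ?_ ?_ ?_ ?_ ?_
  · intro n hn
    rw [Finset.mem_Icc] at hn
    rw [Finset.mem_range]
    omega
  · intro k hk
    rw [Finset.mem_range] at hk
    rw [Finset.mem_Icc]
    omega
  · intro n hn
    rw [Finset.mem_Icc] at hn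
    omega
  · intro k _
    omega
  · intro n hn
    rw [Finset.mem_Icc] at hn
    obtain ⟨k, rfl⟩ := Nat.exists_eq_succ_of_ne_zero (by omega : n ≠ 0)
    simp only [Nat.succ_eq_add_one, Nat.add_sub_cancel, Nat.cast_add, Nat.cast_one]
    congr 1
    refine Finset.sum_congr rfl fun p _ => ?_
    rw [length_bchWord, bchCoeff, ← mul_inv]
    push_cast
    rfl

end Words

/-! ### Dynkin's expansion of the Euler derivative of log(e^x e^y) -/

section Expansion

variable {A : Type*} [Ring A] [Algebra ℝ A] [Algebra ℚ A] {N : ℕ}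

theorem ad_pow_nestedBracket (x : A) (r : ℕ) {l : List A} (hl : l ≠ []) :
    (LieAlgebra.ad ℝ A x ^ r) (nestedBracket l) = nestedBracket (List.replicate r x ++ l) := by
  induction r with
  | zero => simp
  | succ r ih =>
    rw [pow_succ', Module.End.mul_apply, ih, LieAlgebra.ad_apply, List.replicate_succ,
      List.cons_append, nestedBracket_cons _ (by simp [hl])]

theorem exp_ad_nestedBracket {x : A} (hx : IsNilpotent x) {c : ℕ} {l : List A} (hl : l ≠ [])
    (hc : nestedBracket (List.replicate (c + 1) x ++ l) = 0) :
    IsNilpotent.exp (LieAlgebra.ad ℝ A x) (nestedBracket l) =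
      ∑ r ∈ Finset.range (c + 1), (r ! : ℝ)⁻¹ • nestedBracket (List.replicate r x ++ l) := by
  have h := IsNilpotent.exp_smul_eq_sum (a := LieAlgebra.ad ℝ A x) (m := nestedBracket l)
    (k := c + 1) (by rw [Module.End.smul_def, ad_pow_nestedBracket x _ hl, hc])
    (LieAlgebra.ad_nilpotent_of_nilpotent hx)
  rw [Module.End.smul_def] at h
  rw [h]
  refine Finset.sum_congr rfl fun r _ => ?_
  rw [Module.End.smul_def, ad_pow_nestedBracket x _ hl, ← Rat.cast_smul_eq_qsmul ℝ]
  simp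

/-- Dynkin's expansion of `e^{ad x} e^{ad y} - 1` on a nested bracket. -/
theorem exp_ad_mul_exp_ad_sub_one_nestedBracket {x y : A} (hx : IsNilpotent x)
    (hy : IsNilpotent y) {c : ℕ} (hc : ∀ l : List A, (∀ z ∈ l, z = x ∨ z = y) → c < l.length →
      nestedBracket l = 0) {l : List A} (hl : l ≠ []) (hl' : ∀ z ∈ l, z = x ∨ z = y) :
    (IsNilpotent.exp (LieAlgebra.ad ℝ A x) * IsNilpotent.exp (LieAlgebra.ad ℝ A y) - 1)
        (nestedBracket l) =
      ∑ q ∈ bchExponents c, ((q.1 ! : ℝ) * (q.2 ! : ℝ))⁻¹ •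
        nestedBracket (List.replicate q.1 x ++ (List.replicate q.2 y ++ l)) := by
  have hmem : ∀ (r s : ℕ), ∀ z ∈ List.replicate r x ++ (List.replicate s y ++ l), z = x ∨ z = y := by
    intro r s z hz
    simp only [List.mem_append, List.mem_replicate] at hz
    rcases hz with h | h | h
    exacts [Or.inl h.2, Or.inr h.2, hl' z h]
  have h1 : ∀ s, IsNilpotent.exp (LieAlgebra.ad ℝ A x) (nestedBracket (List.replicate s y ++ l)) =
      ∑ r ∈ Finset.range (c + 1), (r ! : ℝ)⁻¹ •
        nestedBracket (List.replicate r x ++ (List.replicate s y ++ l)) := fun s =>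
    exp_ad_nestedBracket hx (by simp [hl]) (hc _ (hmem _ _) (by simp; omega))
  have h0 : ((0 : ℕ), (0 : ℕ)) ∈ Finset.range (c + 1) ×ˢ Finset.range (c + 1) := by simp
  have h2 : (IsNilpotent.exp (LieAlgebra.ad ℝ A x) * IsNilpotent.exp (LieAlgebra.ad ℝ A y))
        (nestedBracket l) = ∑ q ∈ Finset.range (c + 1) ×ˢ Finset.range (c + 1),
        ((q.1 ! : ℝ) * (q.2 ! : ℝ))⁻¹ •
        nestedBracket (List.replicate q.1 x ++ (List.replicate q.2 y ++ l)) := by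
    rw [Module.End.mul_apply, exp_ad_nestedBracket (c := c) hy hl (hc _ (by simpa using hmem 0 (c + 1))
      (by rw [List.length_append, List.length_replicate]; omega)), map_sum, Finset.sum_product_right]
    refine Finset.sum_congr rfl fun s _ => ?_
    rw [map_smul, h1, Finset.smul_sum]
    refine Finset.sum_congr rfl fun r _ => ?_
    rw [smul_smul, mul_inv, mul_comm]
  -- The exponents (0, 0) reproduce the bracket itself, which the subtracted identity cancels.
  rw [LinearMap.sub_apply, h2, Module.End.one_apply, bchExponents, Finset.filter_ne',
    ← Finset.add_sum_erase _ _ h0]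
  simp

theorem nestedBracket_replicate (y : A) (s : ℕ) :
    nestedBracket (List.replicate (s + 2) y) = 0 := by
  induction s with
  | zero => simp [List.replicate, nestedBracket]
  | succ s ih => rw [List.replicate_succ, nestedBracket_cons _ (by simp), ih, lie_zero]

theorem nestedBracket_replicate_append_replicate (x y : A) (r s : ℕ) :
    nestedBracket (List.replicate r x ++ List.replicate (s + 2) y) = 0 := by
  rw [← ad_pow_nestedBracket x r (by simp), nestedBracket_replicate, map_zero]

/-- A word x^r y^s has zero bracket if s ≥ 2, because [y, y] = 0. The words with s = 1 sum to e^{ad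
x} y, and among those with s = 0 only the single letter x remains. -/
theorem add_exp_ad_eq_sum {x y : A} (hx : IsNilpotent x) {c : ℕ}
    (hc : ∀ l : List A, (∀ z ∈ l, z = x ∨ z = y) → c < l.length → nestedBracket l = 0) :
    x + IsNilpotent.exp (LieAlgebra.ad ℝ A x) y =
      ∑ q ∈ bchExponents c, ((q.1 ! : ℝ) * (q.2 ! : ℝ))⁻¹ •
        nestedBracket (List.replicate q.1 x ++ List.replicate q.2 y) := by
  cases c with
  -- With c = 0 already one-letter brackets vanish, so x = y = 0, and no exponents are available.
  | zero =>
    have h1 : x = 0 := hc [x] (by simp) (by simp)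
    have h2 : y = 0 := hc [y] (by simp) (by simp)
    subst h1 h2
    have h3 : bchExponents 0 = ∅ := by decide
    simp [h3]
  | succ c =>
    have h1 := exp_ad_nestedBracket hx (l := [y]) (c := c + 1) (by simp) (hc _ (by
      intro z hz
      simp only [List.mem_append, List.mem_replicate, List.mem_singleton] at hz
      tauto) (by simp))
    have h0 : ((0 : ℕ), (0 : ℕ)) ∈ Finset.range (c + 1 + 1) ×ˢ Finset.range (c + 1 + 1) := by simp
    rw [bchExponents, Finset.filter_ne', Finset.sum_erase _ (by simp [nestedBracket]),
      Finset.sum_product_right, Finset.sum_range_succ', Finset.sum_range_succ']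
    rw [Finset.sum_eq_zero fun s _ => Finset.sum_eq_zero fun r _ => by
      rw [nestedBracket_replicate_append_replicate, smul_zero], zero_add, add_comm x]
    congr 1
    · refine h1.trans (Finset.sum_congr rfl fun r _ => ?_)
      simp
    · rw [Finset.sum_range_succ', Finset.sum_range_succ', Finset.sum_eq_zero fun r _ => by
        rw [List.replicate_zero, List.append_nil, nestedBracket_replicate, smul_zero]]
      simp [nestedBracket]

/-- The vector x + e^{ad x} y supplies the innermost pair of exponents, and each factor of the power
prepends another pair. -/
theorem pow_apply_eq_sum_bchWord {x y : A} (hx : IsNilpotent x)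
    (hy : IsNilpotent y) {c : ℕ} (hc : ∀ l : List A, (∀ z ∈ l, z = x ∨ z = y) → c < l.length →
      nestedBracket l = 0) (k : ℕ) :
    ((IsNilpotent.exp (LieAlgebra.ad ℝ A x) * IsNilpotent.exp (LieAlgebra.ad ℝ A y) - 1) ^ k)
        (x + IsNilpotent.exp (LieAlgebra.ad ℝ A x) y) =
      ∑ p ∈ Fintype.piFinset (fun _ : Fin (k + 1) => bchExponents c),
        bchCoeff p • nestedBracket (bchWord x y p) := by
  induction k with
  | zero =>
    rw [pow_zero, Module.End.one_apply, add_exp_ad_eq_sum hx hc, sum_piFinset_cons]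
    simp [bchCoeff, bchWord]
  | succ k ih =>
    rw [pow_succ', Module.End.mul_apply, ih, map_sum, sum_piFinset_cons _ (n := k + 1)]
    refine Finset.sum_congr rfl fun p hp => ?_
    have hne : bchWord x y p ≠ [] := by
      rw [← List.length_pos_iff]
      exact lt_of_lt_of_le k.succ_pos (le_length_bchWord x y hp)
    rw [map_smul, exp_ad_mul_exp_ad_sub_one_nestedBracket hx hy hc hne fun z hz => mem_bchWord hz,
      Finset.smul_sum]
    refine Finset.sum_congr rfl fun q _ => ?_
    rw [bchWord_cons, smul_smul]
    congr 1
    simp only [bchCoeff, Fin.prod_univ_succ, Fin.cons_zero, Fin.cons_succ, mul_inv]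
    ring

/-- Brackets are homogeneous, of degree the number of letters. This eigenvalue cancels the first
denominator in Dynkin's series. -/
theorem derivation_nestedBracket (δ : A →ₗ[ℝ] A) (hδ : ∀ a b, δ (a * b) = δ a * b + a * δ b)
    {l : List A} (hl : ∀ z ∈ l, δ z = z) :
    δ (nestedBracket l) = (l.length : ℝ) • nestedBracket l := by
  induction l with
  | nil => simp [nestedBracket]
  | cons x l ih =>
    rcases eq_or_ne l [] with rfl | hne
    · simpa [nestedBracket] using hl x (by simp)
    · rw [nestedBracket_cons x hne, Ring.lie_def, map_sub, hδ, hδ, hl x (by simp),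
        ih fun z hz => hl z (by simp [hz])]
      simp only [List.length_cons, Nat.cast_add, Nat.cast_one, add_smul, one_smul, smul_sub,
        mul_smul_comm, smul_mul_assoc]
      abel

/-- The Euler derivatives of the Baker-Campbell-Hausdorff series and of `log (e^x e^y)` agree. -/
theorem NilFiltration.derivation_bchUpTo (𝓕 : NilFiltration A N) {x y : A} (hx : x ∈ 𝓕.F 1)
    (hy : y ∈ 𝓕.F 1) (δ : A →ₗ[ℝ] A) (hδ : ∀ a b, δ (a * b) = δ a * b + a * δ b)
    (hδx : δ x = x) (hδy : δ y = y) {c : ℕ}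
    (hc : ∀ l : List A, (∀ z ∈ l, z = x ∨ z = y) → c < l.length → nestedBracket l = 0) :
    δ (bchUpTo c x y) = δ (𝓕.logExpExp x y) := by
  obtain ⟨M₀, hM₀⟩ := 𝓕.derivation_logExpExp hx hy δ hδ hδx hδy
  rw [hM₀ (max M₀ c) (le_max_left _ _), bchUpTo_eq, map_sum]
  have hz : ∀ p : List A, (∀ z ∈ p, z = x ∨ z = y) → ∀ z ∈ p, δ z = z := by
    intro p hp z hz'
    rcases hp z hz' with rfl | rfl
    exacts [hδx, hδy]
  -- The terms with k ≥ c drop out: their words have at least k + 1 > c letters.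
  rw [← Finset.sum_subset (Finset.range_mono (le_max_right M₀ c))]
  · refine Finset.sum_congr rfl fun k _ => ?_
    rw [pow_apply_eq_sum_bchWord (𝓕.isNilpotent hx) (𝓕.isNilpotent hy) hc, map_smul, map_sum]
    congr 1
    refine Finset.sum_congr rfl fun p hp => ?_
    rw [map_smul, derivation_nestedBracket δ hδ (hz _ fun z hz => mem_bchWord hz), smul_smul]
    congr 1
    have : ((bchWord x y p).length : ℝ) ≠ 0 := by
      have := le_length_bchWord x y hp
      exact_mod_cast (by omega : (bchWord x y p).length ≠ 0)
    field_simp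
  · intro k _ hk
    rw [pow_apply_eq_sum_bchWord (𝓕.isNilpotent hx) (𝓕.isNilpotent hy) hc,
      Finset.sum_eq_zero, smul_zero]
    intro p hp
    have := le_length_bchWord x y hp
    rw [hc _ (fun z hz => mem_bchWord hz) (by simp at hk; omega), smul_zero]

end Expansion

section MapBch

theorem map_bchWord {α β : Type*} (e : α → β) (X Y : α) {n : ℕ} (p : Fin n → ℕ × ℕ) :
    (bchWord X Y p).map e = bchWord (e X) (e Y) p := by
  simp [bchWord, List.map_flatten, List.map_ofFn, Function.comp_def]

variable {L L' : Type*} [LieRing L] [LieAlgebra ℝ L] [LieRing L'] [LieAlgebra ℝ L']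

theorem map_nestedBracket (e : L →ₗ⁅ℝ⁆ L') (l : List L) :
    e (nestedBracket l) = nestedBracket (l.map e) := by
  induction l with
  | nil => simp [nestedBracket]
  | cons x l ih =>
    rcases eq_or_ne l [] with rfl | hne
    · simp [nestedBracket]
    · rw [nestedBracket_cons x hne, LieHom.map_lie, ih, List.map_cons,
        nestedBracket_cons _ (by simpa using hne)]

theorem map_bchUpTo (e : L →ₗ⁅ℝ⁆ L') (c : ℕ) (X Y : L) :
    e (bchUpTo c X Y) = bchUpTo c (e X) (e Y) := by
  simp only [bchUpTo_eq, ← LieHom.coe_toLinearMap, map_sum, map_smul]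
  simp only [LieHom.coe_toLinearMap, map_nestedBracket, map_bchWord, length_bchWord]

theorem bchUpTo_mem_of_nestedBracket_mem {c : ℕ} {X Y : L} (S : Submodule ℝ L)
    (h : ∀ l : List L, l ≠ [] → (∀ z ∈ l, z = X ∨ z = Y) → nestedBracket l ∈ S) :
    bchUpTo c X Y ∈ S := by
  rw [bchUpTo_eq]
  refine Submodule.sum_mem _ fun k _ => Submodule.smul_mem _ _ (Submodule.sum_mem _ fun p hp =>
    Submodule.smul_mem _ _ (h _ ?_ fun z hz => mem_bchWord hz))
  rw [← List.length_pos_iff]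
  exact lt_of_lt_of_le k.succ_pos (le_length_bchWord X Y hp)

end MapBch

/-! ### The Baker-Campbell-Hausdorff formula by dilation -/

section ExpBch

open Polynomial

variable {A : Type*} [Ring A] [Algebra ℝ A] {N : ℕ}

namespace NilFiltration

/-- The coefficientwise filtration of the polynomial ring. -/
noncomputable def polynomial (𝓕 : NilFiltration A N) : NilFiltration A[X] N where
  F i :=
    { carrier := {p | ∀ k, p.coeff k ∈ 𝓕.F i}
      add_mem' := fun hp hq k => by rw [coeff_add]; exact add_mem (hp k) (hq k)
      zero_mem' := fun k => by simp
      smul_mem' := fun r p hp k => by rw [coeff_smul]; exact Submodule.smul_mem _ _ (hp k) }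
  anti i j hij p hp k := 𝓕.anti hij (hp k)
  one_mem k := by
    rw [coeff_one]
    split_ifs
    exacts [𝓕.one_mem, zero_mem _]
  mul_mem hp hq k := by
    rw [coeff_mul]
    exact Submodule.sum_mem _ fun x _ => 𝓕.mul_mem (hp _) (hq _)
  eq_bot := by
    rw [eq_bot_iff]
    intro p hp
    rw [Submodule.mem_bot]
    ext k
    simpa [𝓕.eq_bot] using hp k

theorem nestedBracket_mem (𝓕 : NilFiltration A N) {l : List A} (hl : l ≠ [])
    (h : ∀ z ∈ l, z ∈ 𝓕.F 1) : nestedBracket l ∈ 𝓕.F 1 := by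
  induction l with
  | nil => exact absurd rfl hl
  | cons x l ih =>
    rcases eq_or_ne l [] with rfl | hne
    · exact h x (by simp)
    · have h1 := ih hne fun z hz => h z (by simp [hz])
      have h2 := h x (by simp)
      rw [nestedBracket_cons x hne, Ring.lie_def]
      exact 𝓕.anti (by omega) (sub_mem (𝓕.mul_mem h2 h1) (𝓕.mul_mem h1 h2))

theorem bchUpTo_mem (𝓕 : NilFiltration A N) {x y : A} (hx : x ∈ 𝓕.F 1) (hy : y ∈ 𝓕.F 1)
    (c : ℕ) : bchUpTo c x y ∈ 𝓕.F 1 :=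
  bchUpTo_mem_of_nestedBracket_mem _ fun l hl h => 𝓕.nestedBracket_mem hl fun z hz => by
    rcases h z hz with rfl | rfl
    exacts [hx, hy]

end NilFiltration

/-- The Euler operator `t d/dt` on polynomials. -/
noncomputable def eulerOp (A : Type*) [Ring A] [Algebra ℝ A] : A[X] →ₗ[ℝ] A[X] :=
  LinearMap.mulLeft ℝ (X : A[X]) ∘ₗ (derivative : A[X] →ₗ[A] A[X]).restrictScalars ℝ

theorem eulerOp_apply (p : A[X]) : eulerOp A p = X * derivative p := rfl

theorem eulerOp_mul (p q : A[X]) : eulerOp A (p * q) = eulerOp A p * q + p * eulerOp A q := by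
  rw [eulerOp_apply, eulerOp_apply, eulerOp_apply, derivative_mul, mul_add, ← mul_assoc,
    ← mul_assoc, ← mul_assoc, (X_mul : X * p = p * X)]

/-- The Euler operator multiplies the n-th coefficient by n, so it forgets only the constant term.
-/
theorem eq_of_eulerOp_eq {p q : A[X]} (h : eulerOp A p = eulerOp A q)
    (h0 : p.coeff 0 = q.coeff 0) : p = q := by
  ext n
  cases n with
  | zero => exact h0
  | succ n =>
    have h1 := congrArg (fun r => coeff r (n + 1)) h
    simp only [eulerOp_apply, coeff_X_mul, coeff_derivative] at h1
    have h2 : ∀ a : A, a * (n + 1) = (n + 1 : ℝ) • a := by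
      intro a
      rw [add_smul, one_smul, Nat.cast_smul_eq_nsmul, nsmul_eq_mul, mul_add, mul_one,
        Nat.cast_comm]
    rw [h2, h2] at h1
    exact smul_right_injective A (by positivity : (n + 1 : ℝ) ≠ 0) h1

theorem nestedBracket_map_monomial (l : List A) :
    nestedBracket (l.map (monomial 1)) = monomial l.length (nestedBracket l) := by
  induction l with
  | nil => simp [nestedBracket]
  | cons x l ih =>
    rcases eq_or_ne l [] with rfl | hne
    · simp [nestedBracket]
    · rw [List.map_cons, nestedBracket_cons _ (by simpa using hne), ih,
        nestedBracket_cons x hne, Ring.lie_def, Ring.lie_def, monomial_mul_monomial,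
        monomial_mul_monomial, List.length_cons, map_sub, add_comm 1]

theorem exists_map_eq_of_forall_mem {α β : Type*} (g : α → β) {x y : α} {l : List β}
    (h : ∀ z ∈ l, z = g x ∨ z = g y) : ∃ l' : List α, l'.map g = l ∧ ∀ z ∈ l', z = x ∨ z = y := by
  induction l with
  | nil => exact ⟨[], rfl, by simp⟩
  | cons a l ih =>
    obtain ⟨l', rfl, hl'⟩ := ih fun z hz => h z (by simp [hz])
    rcases h a (by simp) with rfl | rfl
    · exact ⟨x :: l', rfl, by simpa using hl'⟩
    · exact ⟨y :: l', rfl, by simpa using hl'⟩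

/-- Evaluation of polynomials over a noncommutative algebra at a scalar. -/
noncomputable def evalScalar (A : Type*) [Ring A] [Algebra ℝ A] (t : ℝ) : A[X] →ₐ[ℝ] A :=
  { eval₂RingHom' (RingHom.id A) (algebraMap ℝ A t) fun a => (Algebra.commutes t a).symm with
    commutes' := fun r => by
      rw [Polynomial.algebraMap_apply]
      exact (eval₂_C _ _).trans rfl }

theorem evalScalar_apply (t : ℝ) (p : A[X]) :
    evalScalar A t p = p.eval (algebraMap ℝ A t) := by
  rw [eval]
  rfl

theorem evalScalar_monomial (t : ℝ) (a : A) : evalScalar A t (monomial 1 a) = t • a := by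
  rw [evalScalar_apply, eval_monomial, pow_one, Algebra.smul_def, Algebra.commutes]

theorem evalScalar_zero (p : A[X]) : evalScalar A 0 p = p.coeff 0 := by
  rw [evalScalar_apply, map_zero, coeff_zero_eq_eval_zero]

/-- The Baker-Campbell-Hausdorff formula in a nilpotent setting, with Dynkin's series. -/
theorem NilFiltration.exp_bchUpTo [Algebra ℚ A] (𝓕 : NilFiltration A N) {x y : A}
    (hx : x ∈ 𝓕.F 1) (hy : y ∈ 𝓕.F 1) {c : ℕ}
    (hc : ∀ l : List A, (∀ z ∈ l, z = x ∨ z = y) → c < l.length → nestedBracket l = 0) :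
    IsNilpotent.exp (bchUpTo c x y) = IsNilpotent.exp x * IsNilpotent.exp y := by
  have hmono : ∀ {a : A}, a ∈ 𝓕.F 1 → monomial 1 a ∈ 𝓕.polynomial.F 1 := by
    intro a ha k
    rw [coeff_monomial]
    split_ifs
    exacts [ha, zero_mem _]
  -- For N = 0 the filtration forces A = 0. Otherwise truncation at N keeps the constant term, which
  -- is needed at t = 0.
  have hN : 0 < N ∨ (1 : A) = 0 := by
    rcases Nat.eq_zero_or_pos N with rfl | h
    · right
      have := 𝓕.one_mem
      rwa [𝓕.eq_bot, Submodule.mem_bot] at this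
    · exact Or.inl h
  rcases hN with hN | h1
  swap
  · exact eq_of_zero_eq_one h1.symm _ _
  have hδ : ∀ a : A, eulerOp A (monomial 1 a) = monomial 1 a := by
    intro a
    rw [eulerOp_apply, derivative_monomial]
    simp [X_mul_C, C_mul_X_eq_monomial]
  -- Over A[t] the elements tx and ty are fixed by t d/dt, so this derivation plays the role of δ.
  have h := 𝓕.polynomial.derivation_bchUpTo (hmono hx) (hmono hy) (eulerOp A) eulerOp_mul
    (hδ x) (hδ y) (c := c) (by
      intro l hl hlen
      obtain ⟨l', rfl, hl'⟩ := exists_map_eq_of_forall_mem _ hl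
      rw [nestedBracket_map_monomial, hc l' hl' (by simpa using hlen), map_zero])
  -- The constant terms are the values at t = 0, where both expressions reduce to their values at
  -- (0, 0), namely 0.
  have h0 : (bchUpTo c (monomial 1 x) (monomial 1 y) : A[X]).coeff 0 =
      (𝓕.polynomial.logExpExp (monomial 1 x) (monomial 1 y)).coeff 0 := by
    rw [← evalScalar_zero, ← evalScalar_zero]
    have e1 := map_bchUpTo (evalScalar A 0 : A[X] →ₗ⁅ℝ⁆ A) c (monomial 1 x) (monomial 1 y)
    rw [AlgHom.coe_toLieHom] at e1
    have e2 : (bchUpTo c 0 0 : A) = 0 := by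
      have := bchUpTo_mem_of_nestedBracket_mem (c := c) (X := (0 : A)) (Y := 0) ⊥ (by
        intro l hl h
        rw [Submodule.mem_bot]
        cases l with
        | nil => exact absurd rfl hl
        | cons z l =>
          have hz : z = 0 := by simpa using h z (by simp)
          rcases eq_or_ne l [] with rfl | hne
          · simpa [nestedBracket] using hz
          · rw [nestedBracket_cons _ hne, hz, zero_lie])
      simpa using this
    rw [e1, NilFiltration.logExpExp, map_nilEval, map_sub, map_mul, map_one,
      IsNilpotent.map_exp (𝓕.polynomial.isNilpotent (hmono hx)),
      IsNilpotent.map_exp (𝓕.polynomial.isNilpotent (hmono hy)), evalScalar_monomial,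
      evalScalar_monomial, zero_smul, zero_smul, IsNilpotent.exp_zero, mul_one, sub_self,
      nilEval_zero_left hN, e2]
    simp
  have h2 := eq_of_eulerOp_eq h h0
  -- Specializing the polynomial identity to t = 1 returns to A.
  have h3 := congrArg (evalScalar A 1)
    (𝓕.polynomial.exp_logExpExp (hmono hx) (hmono hy))
  have e1 := map_bchUpTo (evalScalar A 1 : A[X] →ₗ⁅ℝ⁆ A) c (monomial 1 x) (monomial 1 y)
  rw [AlgHom.coe_toLieHom] at e1
  rw [← h2, IsNilpotent.map_exp
      (𝓕.polynomial.isNilpotent (𝓕.polynomial.bchUpTo_mem (hmono hx) (hmono hy) c)), map_mul,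
    IsNilpotent.map_exp (𝓕.polynomial.isNilpotent (hmono hx)),
    IsNilpotent.map_exp (𝓕.polynomial.isNilpotent (hmono hy)), e1, evalScalar_monomial,
    evalScalar_monomial, one_smul, one_smul] at h3
  exact h3

end ExpBch

/-! ### Representations of nilpotent Lie algebras by nilpotent operators -/

section Representation

/-- The operators that shift a given finite filtration of a vector space. -/
def NilFiltration.ofFiltration {V : Type*} [AddCommGroup V] [Module ℝ V] (N : ℕ)
    (M : ℕ → Submodule ℝ V) (hM : Antitone M) (h0 : M 0 = ⊤) (hN : M N = ⊥) :
    NilFiltration (Module.End ℝ V) N where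
  F i :=
    { carrier := {T | ∀ k, ∀ v ∈ M k, T v ∈ M (k + i)}
      add_mem' := fun hS hT k v hv => add_mem (hS k v hv) (hT k v hv)
      zero_mem' := fun k v _ => zero_mem _
      smul_mem' := fun r T hT k v hv => Submodule.smul_mem _ r (hT k v hv) }
  anti i j hij T hT k v hv := hM (by omega) (hT k v hv)
  one_mem k v hv := hv
  mul_mem {i j S T} hS hT k v hv := by
    have := hS _ _ (hT k v hv)
    rwa [add_assoc, add_comm j i] at this
  eq_bot := by
    rw [eq_bot_iff]
    intro T hT
    rw [Submodule.mem_bot]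
    ext v
    have h := hT 0 v (h0 ▸ Submodule.mem_top)
    rwa [zero_add, hN, Submodule.mem_bot] at h

variable {L : Type*} [LieRing L] [LieAlgebra ℝ L] {A : Type*} [Ring A] [Algebra ℝ A] {N : ℕ}
  (𝓕 : NilFiltration A N) (ρ : L →ₗ⁅ℝ⁆ A) (hρ : ∀ x, ρ x ∈ 𝓕.F 1) {c : ℕ}
  (hc : ∀ l : List L, c < l.length → nestedBracket l = 0)
include hρ hc

theorem exp_map_bchUpTo [Algebra ℚ A] (x y : L) :
    IsNilpotent.exp (ρ (bchUpTo c x y)) = IsNilpotent.exp (ρ x) * IsNilpotent.exp (ρ y) := by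
  rw [map_bchUpTo, 𝓕.exp_bchUpTo (hρ x) (hρ y)]
  intro l hl hlen
  obtain ⟨l', rfl, -⟩ := exists_map_eq_of_forall_mem ρ hl
  rw [← map_nestedBracket, hc l' (by simpa using hlen), map_zero]

/-- Exponentiation turns the product into multiplication in A and is injective on the first
filtration step, so the group axioms hold after applying ρ. -/
theorem map_bchUpTo_assoc (x y z : L) :
    ρ (bchUpTo c (bchUpTo c x y) z) = ρ (bchUpTo c x (bchUpTo c y z)) := by
  let _ : Algebra ℚ A := Algebra.compHom A (algebraMap ℚ ℝ)
  refine 𝓕.exp_injOn (hρ _) (hρ _) ?_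
  simp only [exp_map_bchUpTo 𝓕 ρ hρ hc, mul_assoc]

theorem map_bchUpTo_zero (x : L) : ρ (bchUpTo c x 0) = ρ x := by
  let _ : Algebra ℚ A := Algebra.compHom A (algebraMap ℚ ℝ)
  refine 𝓕.exp_injOn (hρ _) (hρ _) ?_
  simp only [exp_map_bchUpTo 𝓕 ρ hρ hc, map_zero, IsNilpotent.exp_zero, mul_one]

theorem map_zero_bchUpTo (x : L) : ρ (bchUpTo c 0 x) = ρ x := by
  let _ : Algebra ℚ A := Algebra.compHom A (algebraMap ℚ ℝ)
  refine 𝓕.exp_injOn (hρ _) (hρ _) ?_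
  simp only [exp_map_bchUpTo 𝓕 ρ hρ hc, map_zero, IsNilpotent.exp_zero, one_mul]

theorem map_bchUpTo_neg (x : L) : ρ (bchUpTo c x (-x)) = ρ 0 := by
  let _ : Algebra ℚ A := Algebra.compHom A (algebraMap ℚ ℝ)
  refine 𝓕.exp_injOn (hρ _) (hρ _) ?_
  rw [exp_map_bchUpTo 𝓕 ρ hρ hc, map_neg, map_zero, IsNilpotent.exp_zero,
    IsNilpotent.exp_mul_exp_neg_self (𝓕.isNilpotent (hρ x))]

end Representation

/-! ### Smooth curves in a Lie algebra -/

section Curves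

open scoped ContDiff

variable (𝔤 : Type*) [NormedLieRing 𝔤] [NormedLieAlgebra 𝔤] [FiniteDimensional ℝ 𝔤]

/-- The bracket as a continuous bilinear map. -/
noncomputable def lieCLM : 𝔤 →L[ℝ] 𝔤 →L[ℝ] 𝔤 :=
  LinearMap.toContinuousBilinearMap (LieModule.toEnd ℝ 𝔤 𝔤 : 𝔤 →ₗ[ℝ] 𝔤 →ₗ[ℝ] 𝔤)

variable {𝔤} in
theorem lieCLM_apply (X Y : 𝔤) : lieCLM 𝔤 X Y = ⁅X, Y⁆ := rfl

/-- The smooth curves in `𝔤`. -/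
def smoothCurves : Submodule ℝ (ℝ → 𝔤) where
  carrier := {f | ContDiff ℝ ∞ f}
  add_mem' {f g} hf hg := (show ContDiff ℝ ∞ f from hf).add (show ContDiff ℝ ∞ g from hg)
  zero_mem' := show ContDiff ℝ ∞ (fun _ : ℝ => (0 : 𝔤)) from contDiff_const
  smul_mem' r f hf := (show ContDiff ℝ ∞ f from hf).const_smul r

namespace smoothCurves

variable {𝔤}

theorem contDiff (f : smoothCurves 𝔤) : ContDiff ℝ ∞ f.1 := f.2

theorem differentiable (f : smoothCurves 𝔤) : Differentiable ℝ f.1 :=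
  (contDiff f).differentiable (by simp)

@[ext]
theorem ext {f g : smoothCurves 𝔤} (h : ∀ s, f.1 s = g.1 s) : f = g := Subtype.ext (funext h)

instance : Bracket (smoothCurves 𝔤) (smoothCurves 𝔤) where
  bracket f g := ⟨fun s => ⁅f.1 s, g.1 s⁆,
    ((lieCLM 𝔤).isBoundedBilinearMap.contDiff.comp ((contDiff f).prodMk (contDiff g)))⟩

theorem lie_apply (f g : smoothCurves 𝔤) (s : ℝ) : ⁅f, g⁆.1 s = ⁅f.1 s, g.1 s⁆ := rfl

instance : LieRing (smoothCurves 𝔤) where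
  add_lie _ _ _ := ext fun _ => add_lie _ _ _
  lie_add _ _ _ := ext fun _ => lie_add _ _ _
  lie_self _ := ext fun _ => lie_self _
  leibniz_lie _ _ _ := ext fun _ => leibniz_lie _ _ _

instance : LieAlgebra ℝ (smoothCurves 𝔤) where
  lie_smul _ _ _ := ext fun _ => lie_smul _ _ _

/-- Evaluation of curves. -/
def eval (s : ℝ) : smoothCurves 𝔤 →ₗ⁅ℝ⁆ 𝔤 where
  toFun f := f.1 s
  map_add' _ _ := rfl
  map_smul' _ _ := rfl
  map_lie' := rfl

/-- The derivative of curves. -/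
noncomputable def derivative : smoothCurves 𝔤 →ₗ[ℝ] smoothCurves 𝔤 where
  toFun f := ⟨deriv f.1, (contDiff_infty_iff_deriv.1 (contDiff f)).2⟩
  map_add' f g := ext fun s => deriv_add (differentiable f s) (differentiable g s)
  map_smul' r f := ext fun s => deriv_const_smul r (differentiable f s)

theorem derivative_lie (f g : smoothCurves 𝔤) :
    derivative ⁅f, g⁆ = ⁅derivative f, g⁆ + ⁅f, derivative g⁆ := by
  refine ext fun s => ?_
  have hf := (differentiable f s).hasDerivAt
  have hg := (differentiable g s).hasDerivAt
  have h := ((lieCLM 𝔤).hasFDerivAt_of_bilinear hf.hasFDerivAt hg.hasFDerivAt).hasDerivAt.deriv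
  refine h.trans ?_
  simp [lieCLM_apply, derivative, lie_apply, add_comm]

/-- The adjoint action of the smooth curves on the semidirect product with the derivative. -/
noncomputable def rep : smoothCurves 𝔤 →ₗ⁅ℝ⁆ Module.End ℝ (smoothCurves 𝔤 × ℝ) where
  toFun f :=
    { toFun := fun v => (⁅f, v.1⁆ - v.2 • derivative f, 0)
      map_add' := fun v w => by
        ext1
        · simp only [Prod.fst_add, Prod.snd_add, lie_add, add_smul]; abel
        · simp
      map_smul' := fun r v => by
        ext1
        · simp [smul_sub, mul_smul]
        · simp }
  map_add' f g := by
    refine LinearMap.ext fun v => Prod.ext ?_ ?_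
    · simp only [LinearMap.coe_mk, AddHom.coe_mk, LinearMap.add_apply, Prod.fst_add, add_lie,
        map_add, smul_add]
      abel
    · simp
  map_smul' r f := by
    refine LinearMap.ext fun v => Prod.ext ?_ ?_
    · simp [smul_sub, smul_comm r]
    · simp
  map_lie' {f g} := by
    refine LinearMap.ext fun v => Prod.ext ?_ ?_
    · simp only [Ring.lie_def, LinearMap.coe_mk, AddHom.coe_mk, LinearMap.sub_apply,
        Module.End.mul_apply, Prod.fst_sub, zero_smul, sub_zero, derivative_lie, lie_sub, lie_smul,
        smul_add, lie_lie, ← lie_skew (derivative f) g, smul_neg]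
      abel
    · simp [Ring.lie_def]

theorem rep_apply (f : smoothCurves 𝔤) (v : smoothCurves 𝔤 × ℝ) :
    rep f v = (⁅f, v.1⁆ - v.2 • derivative f, 0) := rfl

/-- The bracket alone would lose central curves. Applied to (0, 1), however, the representation
returns minus the derivative of the curve, so only a constant is undetermined, and the value at 0
fixes it. -/
theorem eq_of_rep_eq {f g : smoothCurves 𝔤} (h : rep f = rep g) (h0 : f.1 0 = g.1 0) : f = g := by
  have h1 := congrArg Prod.fst (LinearMap.congr_fun h (0, 1))
  simp only [rep_apply, lie_zero, one_smul, zero_sub, neg_inj] at h1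
  refine ext fun s => ?_
  have h2 := is_const_of_deriv_eq_zero (f := f.1 - g.1)
    ((differentiable f).sub (differentiable g)) (fun t => by
      rw [deriv_sub (differentiable f t) (differentiable g t), sub_eq_zero]
      exact congrFun (congrArg Subtype.val h1) t) s 0
  rw [Pi.sub_apply, Pi.sub_apply, h0, sub_self, sub_eq_zero] at h2
  exact h2

/-- The ray `s ↦ sX`. -/
def ray (X : 𝔤) : smoothCurves 𝔤 :=
  ⟨fun s => s • X, show ContDiff ℝ ∞ (fun s : ℝ => s • X) from contDiff_id.smul contDiff_const⟩

theorem ray_apply (X : 𝔤) (s : ℝ) : (ray X).1 s = s • X := rfl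

end smoothCurves

end Curves

/-! ### The group law -/

section GroupLaw

variable {𝔤 : Type*} [NormedLieRing 𝔤] [NormedLieAlgebra 𝔤]

theorem nestedBracket_mem_lowerCentralSeries (l : List 𝔤) :
    nestedBracket l ∈ LieModule.lowerCentralSeries ℝ 𝔤 𝔤 (l.length - 1) := by
  induction l with
  | nil => simp [nestedBracket]
  | cons x l ih =>
    rcases eq_or_ne l [] with rfl | hne
    · simp
    · have := List.length_pos_iff.2 hne
      rw [nestedBracket_cons x hne, List.length_cons, Nat.add_sub_cancel,
        (by omega : l.length = (l.length - 1) + 1), LieModule.lowerCentralSeries_succ]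
      exact LieSubmodule.lie_mem_lie (LieSubmodule.mem_top x) ih

variable [LieRing.IsNilpotent 𝔤]

theorem lowerCentralSeries_nilpotencyLength :
    LieModule.lowerCentralSeries ℝ 𝔤 𝔤 (LieModule.nilpotencyLength 𝔤 𝔤) = ⊥ := by
  -- The nilpotency length refers to the series over ℤ, whose terms have the same underlying sets as
  -- those over ℝ.
  have h : LieModule.lowerCentralSeries ℤ 𝔤 𝔤 (LieModule.nilpotencyLength 𝔤 𝔤) = ⊥ :=
    Nat.sInf_mem ((LieModule.isNilpotent_iff_int 𝔤 𝔤).1 ‹LieRing.IsNilpotent 𝔤›)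
  rw [SetLike.ext'_iff] at h ⊢
  rw [LieModule.coe_lowerCentralSeries_eq_int, h]
  rfl

theorem nestedBracket_eq_zero {l : List 𝔤} (hl : LieModule.nilpotencyLength 𝔤 𝔤 < l.length) :
    nestedBracket l = 0 := by
  have h := LieModule.antitone_lowerCentralSeries ℝ 𝔤 𝔤 (by omega :
    LieModule.nilpotencyLength 𝔤 𝔤 ≤ l.length - 1) (nestedBracket_mem_lowerCentralSeries l)
  rwa [lowerCentralSeries_nilpotencyLength, LieSubmodule.mem_bot] at h

variable [FiniteDimensional ℝ 𝔤]

namespace smoothCurves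

theorem nestedBracket_eq_zero {l : List (smoothCurves 𝔤)}
    (hl : LieModule.nilpotencyLength 𝔤 𝔤 < l.length) : nestedBracket l = 0 := by
  refine ext fun s => ?_
  change eval s (nestedBracket l) = 0
  rw [map_nestedBracket]
  exact _root_.nestedBracket_eq_zero (by simpa using hl)

theorem eval_bchUpTo (f g : smoothCurves 𝔤) (s : ℝ) :
    (bchUpTo (LieModule.nilpotencyLength 𝔤 𝔤) f g).1 s = bch (f.1 s) (g.1 s) :=
  map_bchUpTo (eval s) _ f g

/-- The filtration of the representation space by the lower central series. -/
def repFiltration (𝔤 : Type*) [NormedLieRing 𝔤] [NormedLieAlgebra 𝔤] [FiniteDimensional ℝ 𝔤] :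
    ℕ → Submodule ℝ (smoothCurves 𝔤 × ℝ)
  | 0 => ⊤
  | k + 1 =>
    { carrier := {v | v.2 = 0 ∧ ∀ s, v.1.1 s ∈ LieModule.lowerCentralSeries ℝ 𝔤 𝔤 k}
      add_mem' := fun hv hw => ⟨by simp [hv.1, hw.1], fun s => add_mem (hv.2 s) (hw.2 s)⟩
      zero_mem' := ⟨rfl, fun s => zero_mem _⟩
      smul_mem' := fun r v hv => ⟨by simp [hv.1], fun s =>
        SMulMemClass.smul_mem (S := LieSubmodule ℝ 𝔤 𝔤) r (hv.2 s)⟩ }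

/-- The filtration of the operators on the representation space. -/
noncomputable def repNilFiltration (𝔤 : Type*) [NormedLieRing 𝔤] [NormedLieAlgebra 𝔤]
    [LieRing.IsNilpotent 𝔤] [FiniteDimensional ℝ 𝔤] :
    NilFiltration (Module.End ℝ (smoothCurves 𝔤 × ℝ)) (LieModule.nilpotencyLength 𝔤 𝔤 + 1) :=
  NilFiltration.ofFiltration _ (repFiltration 𝔤)
    (antitone_nat_of_succ_le fun k v hv => by
      cases k with
      | zero => exact Submodule.mem_top
      | succ k =>
        exact ⟨hv.1, fun s => LieModule.antitone_lowerCentralSeries ℝ 𝔤 𝔤 k.le_succ (hv.2 s)⟩)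
    rfl (by
      rw [eq_bot_iff]
      rintro ⟨f, r⟩ ⟨h1, h2⟩
      rw [Submodule.mem_bot, Prod.mk_eq_zero]
      refine ⟨ext fun s => ?_, h1⟩
      have := h2 s
      rwa [lowerCentralSeries_nilpotencyLength, LieSubmodule.mem_bot] at this)

/-- The first step of the filtration removes the scalar coordinate and absorbs the derivative term.
On every later step the operator is a bracket, which descends the lower central series. -/
theorem rep_mem (f : smoothCurves 𝔤) : rep f ∈ (repNilFiltration 𝔤).F 1 := by
  intro k v hv
  rw [rep_apply]
  refine ⟨rfl, fun s => ?_⟩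
  cases k with
  | zero => simp
  | succ k =>
    simp only [hv.1, zero_smul, sub_zero, lie_apply, LieModule.lowerCentralSeries_succ]
    exact LieSubmodule.lie_mem_lie (LieSubmodule.mem_top _) (hv.2 s)

end smoothCurves

open smoothCurves

theorem bch_zero_zero : bch (0 : 𝔤) 0 = 0 := by
  have := bchUpTo_mem_of_nestedBracket_mem (c := LieModule.nilpotencyLength 𝔤 𝔤) (X := (0 : 𝔤))
    (Y := 0) ⊥ (by
      intro l hl h
      rw [Submodule.mem_bot]
      cases l with
      | nil => exact absurd rfl hl
      | cons z l =>
        have hz : z = 0 := by simpa using h z (by simp)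
        rcases eq_or_ne l [] with rfl | hne
        · simpa [nestedBracket] using hz
        · rw [nestedBracket_cons _ hne, hz, zero_lie])
  exact (Submodule.mem_bot ℝ).1 this

/-- Both products of the rays sX, sY, sZ have the same image under the representation and vanish at
s = 0. They are therefore equal as curves, and s = 1 gives the claim. The other axioms follow in the
same way. -/
theorem bch_assoc (X Y Z : 𝔤) : bch (bch X Y) Z = bch X (bch Y Z) := by
  have h := map_bchUpTo_assoc (repNilFiltration 𝔤) rep rep_mem
    (fun l hl => smoothCurves.nestedBracket_eq_zero hl) (ray X) (ray Y) (ray Z)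
  have h2 := congrArg (fun f => f.1 1) (eq_of_rep_eq h (by
    simp [eval_bchUpTo, ray_apply, bch_zero_zero]))
  simpa [eval_bchUpTo, ray_apply] using h2

theorem bch_zero (X : 𝔤) : bch X 0 = X := by
  have h := map_bchUpTo_zero (repNilFiltration 𝔤) rep rep_mem
    (fun l hl => smoothCurves.nestedBracket_eq_zero hl) (ray X)
  have h2 := congrArg (fun f => f.1 1) (eq_of_rep_eq h (by
    simp [eval_bchUpTo, ray_apply, bch_zero_zero]))
  simpa [eval_bchUpTo, ray_apply] using h2

theorem zero_bch (X : 𝔤) : bch 0 X = X := by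
  have h := map_zero_bchUpTo (repNilFiltration 𝔤) rep rep_mem
    (fun l hl => smoothCurves.nestedBracket_eq_zero hl) (ray X)
  have h2 := congrArg (fun f => f.1 1) (eq_of_rep_eq h (by
    simp [eval_bchUpTo, ray_apply, bch_zero_zero]))
  simpa [eval_bchUpTo, ray_apply] using h2

theorem bch_neg (X : 𝔤) : bch X (-X) = 0 := by
  have h := map_bchUpTo_neg (repNilFiltration 𝔤) rep rep_mem
    (fun l hl => smoothCurves.nestedBracket_eq_zero hl) (ray X)
  have h2 := congrArg (fun f => f.1 1) (eq_of_rep_eq h (by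
    simp [eval_bchUpTo, ray_apply, bch_zero_zero]))
  simpa [eval_bchUpTo, ray_apply] using h2

theorem neg_bch (X : 𝔤) : bch (-X) X = 0 := by simpa using bch_neg (-X)

theorem neg_bch_cancel (X Y : 𝔤) : bch (-X) (bch X Y) = Y := by
  rw [← bch_assoc, neg_bch, zero_bch]

theorem bch_neg_cancel (X Y : 𝔤) : bch X (bch (-X) Y) = Y := by
  rw [← bch_assoc, bch_neg, zero_bch]

theorem bch_cancel_right (X Y : 𝔤) : bch (bch X Y) (-Y) = X := by
  rw [bch_assoc, bch_neg, bch_zero]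

theorem bch_neg_cancel_right (X Y : 𝔤) : bch (bch X (-Y)) Y = X := by
  rw [bch_assoc, neg_bch, bch_zero]

theorem neg_bch_eq (X Y : 𝔤) : -bch X Y = bch (-Y) (-X) := by
  have h : bch (bch (-Y) (-X)) (bch X Y) = 0 := by
    rw [bch_assoc, neg_bch_cancel, neg_bch]
  calc -bch X Y = bch (bch (bch (-Y) (-X)) (bch X Y)) (-bch X Y) := by rw [h, zero_bch]
    _ = _ := bch_cancel_right _ _

end GroupLaw

end NilpotentGroupLaw

/-! ### Analytic properties of the group law -/

section TemperateGrowth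

/-- The pattern of a word does not depend on its letters. With the pattern fixed, brackets can be
studied as functions of X and Y by induction on a list of booleans. -/
theorem bchWord_eq_map_cond {α : Type*} (X Y : α) {n : ℕ} (p : Fin n → ℕ × ℕ) :
    bchWord X Y p = (bchWord true false p).map fun b => cond b X Y := by
  rw [map_bchWord]
  rfl

theorem Function.HasTemperateGrowth.const_real_smul {D F : Type*} [NormedAddCommGroup D]
    [NormedSpace ℝ D] [NormedAddCommGroup F] [NormedSpace ℝ F] {f : D → F}
    (hf : f.HasTemperateGrowth) (r : ℝ) : (fun d => r • f d).HasTemperateGrowth :=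
  (Function.HasTemperateGrowth.const r).smul hf

variable {𝔤 : Type*} [NormedLieRing 𝔤] [NormedLieAlgebra 𝔤] [FiniteDimensional ℝ 𝔤]
  {D : Type*} [NormedAddCommGroup D] [NormedSpace ℝ D]

theorem nestedBracket_hasTemperateGrowth {f g : D → 𝔤} (hf : f.HasTemperateGrowth)
    (hg : g.HasTemperateGrowth) (w : List Bool) :
    (fun d => nestedBracket (w.map fun b => cond b (f d) (g d))).HasTemperateGrowth := by
  have hb : ∀ b : Bool, (fun d => cond b (f d) (g d)).HasTemperateGrowth := by
    rintro (_ | _)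
    exacts [hg, hf]
  induction w with
  | nil => exact .const 0
  | cons b w ih =>
    rcases eq_or_ne w [] with rfl | hne
    · exact hb b
    · have h : (fun d => nestedBracket ((b :: w).map fun b => cond b (f d) (g d))) = fun d =>
          lieCLM 𝔤 (cond b (f d) (g d)) (nestedBracket (w.map fun b => cond b (f d) (g d))) := by
        funext d
        rw [List.map_cons, nestedBracket_cons _ (by simpa using hne)]
        rfl
      rw [h]
      exact (lieCLM 𝔤).bilinear_hasTemperateGrowth (hb b) ih

theorem bchUpTo_hasTemperateGrowth (c : ℕ) {f g : D → 𝔤} (hf : f.HasTemperateGrowth)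
    (hg : g.HasTemperateGrowth) : (fun d => bchUpTo c (f d) (g d)).HasTemperateGrowth := by
  simp only [bchUpTo_eq, length_bchWord]
  refine .sum fun k _ => .const_real_smul (.sum fun p _ => .const_real_smul ?_ _) _
  simp only [bchWord_eq_map_cond (f _)]
  exact nestedBracket_hasTemperateGrowth hf hg _

theorem bch_hasTemperateGrowth {f g : D → 𝔤} (hf : f.HasTemperateGrowth)
    (hg : g.HasTemperateGrowth) : (fun d => bch (f d) (g d)).HasTemperateGrowth :=
  bchUpTo_hasTemperateGrowth _ hf hg

end TemperateGrowth

/-! ### Invariance of Lebesgue measure under translations -/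

section Unimodular

variable {𝔤 : Type*} [NormedLieRing 𝔤] [NormedLieAlgebra 𝔤]

/-- The derivatives of `g` differ from `a • id` by maps that shift the lower central series. -/
def ShiftsLCS (g : 𝔤 → 𝔤) (a : ℝ) : Prop :=
  ∀ X, ∃ D : 𝔤 →L[ℝ] 𝔤, HasFDerivAt g D X ∧
    ∀ k, ∀ H ∈ LieModule.lowerCentralSeries ℝ 𝔤 𝔤 k,
      D H - a • H ∈ LieModule.lowerCentralSeries ℝ 𝔤 𝔤 (k + 1)

theorem lie_mem_lowerCentralSeries_succ (X : 𝔤) {Y : 𝔤} {k : ℕ}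
    (hY : Y ∈ LieModule.lowerCentralSeries ℝ 𝔤 𝔤 k) :
    ⁅X, Y⁆ ∈ LieModule.lowerCentralSeries ℝ 𝔤 𝔤 (k + 1) := by
  rw [LieModule.lowerCentralSeries_succ]
  exact LieSubmodule.lie_mem_lie (LieSubmodule.mem_top _) hY

theorem ShiftsLCS.const (Z : 𝔤) : ShiftsLCS (fun _ => Z) 0 := fun X =>
  ⟨0, hasFDerivAt_const Z X, fun k H _ => by simp⟩

theorem ShiftsLCS.id : ShiftsLCS (fun X : 𝔤 => X) 1 := fun X =>
  ⟨ContinuousLinearMap.id ℝ 𝔤, hasFDerivAt_id X, fun k H _ => by simp⟩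

theorem ShiftsLCS.smul {g : 𝔤 → 𝔤} {a : ℝ} (hg : ShiftsLCS g a) (r : ℝ) :
    ShiftsLCS (fun X => r • g X) (r * a) := fun X => by
  obtain ⟨D, hD, h⟩ := hg X
  refine ⟨r • D, hD.const_smul r, fun k H hH => ?_⟩
  have := (LieModule.lowerCentralSeries ℝ 𝔤 𝔤 (k + 1)).smul_mem r (h k H hH)
  rwa [smul_sub, ← mul_smul] at this

theorem ShiftsLCS.add {g₁ g₂ : 𝔤 → 𝔤} {a₁ a₂ : ℝ} (h₁ : ShiftsLCS g₁ a₁) (h₂ : ShiftsLCS g₂ a₂) :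
    ShiftsLCS (fun X => g₁ X + g₂ X) (a₁ + a₂) := fun X => by
  obtain ⟨D₁, hD₁, h₁⟩ := h₁ X
  obtain ⟨D₂, hD₂, h₂⟩ := h₂ X
  refine ⟨D₁ + D₂, hD₁.add hD₂, fun k H hH => ?_⟩
  have := add_mem (h₁ k H hH) (h₂ k H hH)
  rwa [sub_add_sub_comm, ← add_smul] at this

theorem ShiftsLCS.sum {ι : Type*} {g : ι → 𝔤 → 𝔤} {a : ι → ℝ} {s : Finset ι}
    (h : ∀ i ∈ s, ShiftsLCS (g i) (a i)) : ShiftsLCS (fun X => ∑ i ∈ s, g i X) (∑ i ∈ s, a i) := by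
  classical
  induction s using Finset.induction_on with
  | empty => simpa using ShiftsLCS.const (0 : 𝔤)
  | insert i s hi ih =>
    simp only [Finset.sum_insert hi]
    exact (h i (by simp)).add (ih fun j hj => h j (by simp [hj]))

variable [FiniteDimensional ℝ 𝔤]

/-- By the product rule the derivative is a sum of brackets with one differentiated entry. Each
bracket moves one step down the series, so no multiple of the identity remains. -/
theorem ShiftsLCS.lie {g₁ g₂ : 𝔤 → 𝔤} {a₁ a₂ : ℝ} (h₁ : ShiftsLCS g₁ a₁) (h₂ : ShiftsLCS g₂ a₂) :
    ShiftsLCS (fun X => ⁅g₁ X, g₂ X⁆) 0 := fun X => by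
  have key : ∀ {D : 𝔤 →L[ℝ] 𝔤} {a : ℝ}, (∀ k, ∀ H ∈ LieModule.lowerCentralSeries ℝ 𝔤 𝔤 k,
      D H - a • H ∈ LieModule.lowerCentralSeries ℝ 𝔤 𝔤 (k + 1)) →
      ∀ k, ∀ H ∈ LieModule.lowerCentralSeries ℝ 𝔤 𝔤 k,
        D H ∈ LieModule.lowerCentralSeries ℝ 𝔤 𝔤 k := fun {D a} h k H hH => by
    have h1 := LieModule.antitone_lowerCentralSeries ℝ 𝔤 𝔤 k.le_succ (h k H hH)
    have := add_mem h1 ((LieModule.lowerCentralSeries ℝ 𝔤 𝔤 k).smul_mem a hH)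
    rwa [sub_add_cancel] at this
  obtain ⟨D₁, hD₁, h₁⟩ := h₁ X
  obtain ⟨D₂, hD₂, h₂⟩ := h₂ X
  refine ⟨_, (lieCLM 𝔤).hasFDerivAt_of_bilinear hD₁ hD₂, fun k H hH => ?_⟩
  simp only [zero_smul, sub_zero, add_apply,
    ContinuousLinearMap.precompR_apply, ContinuousLinearMap.precompL_apply, lieCLM_apply]
  refine add_mem (lie_mem_lowerCentralSeries_succ _ (key h₂ k H hH)) ?_
  rw [← lie_skew]
  exact neg_mem (lie_mem_lowerCentralSeries_succ _ (key h₁ k H hH))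

theorem exists_shiftsLCS_nestedBracket (w : List Bool) :
    ∃ a : ℝ, ∀ Z : 𝔤, ShiftsLCS (fun X => nestedBracket (w.map fun b => cond b Z X)) a := by
  have hb : ∀ b : Bool, ∃ a : ℝ, ∀ Z : 𝔤, ShiftsLCS (fun X => cond b Z X) a := by
    rintro (_ | _)
    exacts [⟨1, fun Z => .id⟩, ⟨0, fun Z => .const Z⟩]
  induction w with
  | nil => exact ⟨0, fun Z => .const 0⟩
  | cons b w ih =>
    rcases eq_or_ne w [] with rfl | hne
    · exact hb b
    · obtain ⟨a, ha⟩ := hb b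
      obtain ⟨a', ha'⟩ := ih
      refine ⟨0, fun Z => ?_⟩
      simp only [List.map_cons]
      simp only [nestedBracket_cons _ (show (w.map fun b => cond b Z _) ≠ [] by simpa using hne)]
      exact (ha Z).lie (ha' Z)

/-- The order of quantifiers is the point: the scalar depends on the coefficients of Dynkin's series
and not on Z, so it can be tested at Z = 0. -/
theorem exists_shiftsLCS_bch : ∃ a : ℝ, ∀ Z : 𝔤, ShiftsLCS (fun X => bch Z X) a := by
  choose a ha using exists_shiftsLCS_nestedBracket (𝔤 := 𝔤)
  refine ⟨∑ k ∈ Finset.range (LieModule.nilpotencyLength 𝔤 𝔤), ((-1 : ℝ) ^ k / ((k : ℝ) + 1)) *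
    ∑ p ∈ Fintype.piFinset (fun _ : Fin (k + 1) => bchExponents (LieModule.nilpotencyLength 𝔤 𝔤)),
      ((((∑ i, ((p i).1 + (p i).2) : ℕ) : ℝ)⁻¹ * bchCoeff p) * a (bchWord true false p)),
    fun Z => ?_⟩
  · simp only [bch, bchUpTo_eq, length_bchWord]
    refine .sum fun k _ => .smul (.sum fun p _ => .smul (a := a (bchWord true false p)) ?_ _) _
    simp only [bchWord_eq_map_cond Z]
    exact ha _ Z

variable [LieRing.IsNilpotent 𝔤]

/-- The map a - D is nilpotent, so its characteristic polynomial is X^n; evaluated at a it gives det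
D. -/
theorem det_of_shifts_lowerCentralSeries (D : 𝔤 →ₗ[ℝ] 𝔤) (a : ℝ)
    (h : ∀ k, ∀ H ∈ LieModule.lowerCentralSeries ℝ 𝔤 𝔤 k,
      D H - a • H ∈ LieModule.lowerCentralSeries ℝ 𝔤 𝔤 (k + 1)) :
    LinearMap.det D = a ^ Module.finrank ℝ 𝔤 := by
  set n : Module.End ℝ 𝔤 := algebraMap ℝ _ a - D with hn
  have hnil : IsNilpotent n := by
    refine ⟨LieModule.nilpotencyLength 𝔤 𝔤, ?_⟩
    have : ∀ k H, (n ^ k) H ∈ LieModule.lowerCentralSeries ℝ 𝔤 𝔤 k := by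
      intro k
      induction k with
      | zero => simp
      | succ k ih =>
        intro H
        rw [pow_succ', Module.End.mul_apply]
        have := neg_mem (h k _ (ih H))
        rwa [neg_sub] at this
    ext H
    have h2 := this (LieModule.nilpotencyLength 𝔤 𝔤) H
    rw [lowerCentralSeries_nilpotencyLength] at h2
    simpa using h2
  have h1 := (LinearMap.charpoly_eq_X_pow_iff n).2 fun m => by
    obtain ⟨k, hk⟩ := hnil
    exact ⟨k, by rw [hk]; rfl⟩
  have h2 := LinearMap.eval_charpoly n a
  rw [h1] at h2
  simpa [hn] using h2.symm

theorem exists_hasFDerivAt_bch_abs_det_eq_one (Z X : 𝔤) : ∃ D : 𝔤 →L[ℝ] 𝔤,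
    HasFDerivAt (fun X => bch Z X) D X ∧ |D.det| = 1 := by
  obtain ⟨a, ha⟩ := exists_shiftsLCS_bch (𝔤 := 𝔤)
  obtain ⟨D, hD, h⟩ := ha Z X
  -- Translation by 0 is the identity, so its determinant 1 must be a^n, and the same power is the
  -- determinant for every Z.
  obtain ⟨D₀, hD₀, h₀⟩ := ha 0 X
  have h1 := det_of_shifts_lowerCentralSeries (D : 𝔤 →ₗ[ℝ] 𝔤) a h
  have h2 := det_of_shifts_lowerCentralSeries (D₀ : 𝔤 →ₗ[ℝ] 𝔤) a h₀
  simp only [zero_bch] at hD₀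
  rw [← (hasFDerivAt_id X).unique hD₀] at h2
  have h3 : (1 : ℝ) = a ^ Module.finrank ℝ 𝔤 := by simpa using h2
  refine ⟨D, hD, ?_⟩
  change |LinearMap.det (D : 𝔤 →ₗ[ℝ] 𝔤)| = 1
  rw [h1, ← h3, abs_one]

theorem continuous_uncurry_bch : Continuous fun d : 𝔤 × 𝔤 => bch d.1 d.2 :=
  (bch_hasTemperateGrowth (D := 𝔤 × 𝔤) (f := Prod.fst) (g := Prod.snd)
    (ContinuousLinearMap.fst ℝ 𝔤 𝔤).hasTemperateGrowth
    (ContinuousLinearMap.snd ℝ 𝔤 𝔤).hasTemperateGrowth).1.continuous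

theorem continuous_bch {D : Type*} [TopologicalSpace D] {f g : D → 𝔤} (hf : Continuous f)
    (hg : Continuous g) : Continuous fun d => bch (f d) (g d) := by
  have h := continuous_uncurry_bch.comp (hf.prodMk hg)
  simp only [Function.comp_def] at h
  exact h

/-- Left translation. -/
noncomputable def leftTranslation (Z : 𝔤) : 𝔤 ≃ₜ 𝔤 where
  toFun X := bch Z X
  invFun X := bch (-Z) X
  left_inv X := neg_bch_cancel Z X
  right_inv X := bch_neg_cancel Z X
  continuous_toFun := continuous_bch continuous_const continuous_id
  continuous_invFun := continuous_bch continuous_const continuous_id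

/-- Right translation. -/
noncomputable def rightTranslation (Z : 𝔤) : 𝔤 ≃ₜ 𝔤 where
  toFun X := bch X Z
  invFun X := bch X (-Z)
  left_inv X := bch_cancel_right X Z
  right_inv X := bch_neg_cancel_right X Z
  continuous_toFun := continuous_bch continuous_id continuous_const
  continuous_invFun := continuous_bch continuous_id continuous_const

variable [MeasurableSpace 𝔤] [BorelSpace 𝔤] (μ : Measure 𝔤) [μ.IsAddHaarMeasure]

theorem measurePreserving_leftTranslation (Z : 𝔤) : MeasurePreserving (leftTranslation Z) μ μ := by
  refine ⟨(leftTranslation Z).measurable, ?_⟩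
  choose D hD hdet using exists_hasFDerivAt_bch_abs_det_eq_one Z
  have h := map_withDensity_abs_det_fderiv_eq_addHaar (f := leftTranslation Z) μ
    MeasurableSet.univ.nullMeasurableSet (fun X _ => (hD X).hasFDerivWithinAt)
    (leftTranslation Z).injective.injOn
  simp only [hdet, ENNReal.ofReal_one] at h
  have h1 : (μ.restrict Set.univ).withDensity (fun _ => (1 : ℝ≥0∞)) = μ := by
    rw [Measure.restrict_univ]
    exact withDensity_one
  rw [h1, Set.image_univ_of_surjective (leftTranslation Z).surjective, Measure.restrict_univ] at h
  exact h

/-- The inversion X ↦ -X preserves the measure and conjugates right translations into left ones. -/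
theorem measurePreserving_rightTranslation (Z : 𝔤) :
    MeasurePreserving (rightTranslation Z) μ μ := by
  have h := (Measure.measurePreserving_neg μ).comp
    ((measurePreserving_leftTranslation μ (-Z)).comp (Measure.measurePreserving_neg μ))
  convert h using 1
  funext X
  change bch X Z = -bch (-Z) (-X)
  rw [neg_bch_eq, neg_neg, neg_neg]

variable {E : Type*} [NormedAddCommGroup E] [NormedSpace ℝ E]

theorem integral_bch_left (Z : 𝔤) (f : 𝔤 → E) : ∫ X, f (bch Z X) ∂μ = ∫ X, f X ∂μ :=
  (measurePreserving_leftTranslation μ Z).integral_comp (leftTranslation Z).measurableEmbedding f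

theorem integral_bch_right (Z : 𝔤) (f : 𝔤 → E) : ∫ X, f (bch X Z) ∂μ = ∫ X, f X ∂μ :=
  (measurePreserving_rightTranslation μ Z).integral_comp (rightTranslation Z).measurableEmbedding f

end Unimodular

/-! ### Partial Fourier transforms of Schwartz functions -/

section Exponential

theorem norm_eI (t : ℝ) : ‖eI t‖ = 1 := by
  rw [eI, mul_comm, Complex.norm_exp_ofReal_mul_I]

theorem eI_zero : eI 0 = 1 := by simp [eI]

theorem eI_add (s t : ℝ) : eI (s + t) = eI s * eI t := by
  simp [eI, mul_add, Complex.exp_add]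

theorem conj_eI (t : ℝ) : conj (eI t) = eI (-t) := by
  simp [eI, ← Complex.exp_conj]

theorem eI_mul_eI_neg (t : ℝ) : eI t * eI (-t) = 1 := by
  rw [← eI_add, add_neg_cancel, eI_zero]

theorem hasDerivAt_eI (t : ℝ) : HasDerivAt eI (Complex.I * eI t) t := by
  have h := ((hasDerivAt_id (t : ℂ)).const_mul Complex.I).cexp.comp_ofReal
  exact h.congr_deriv (by simp [eI, mul_comm])

theorem continuous_eI : Continuous eI :=
  Complex.continuous_exp.comp (continuous_const.mul Complex.continuous_ofReal)

end Exponential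

section PartialFourier

open ContinuousLinearMap

variable {E F F' V : Type*} [NormedAddCommGroup E] [NormedSpace ℝ E]
  [NormedAddCommGroup F] [NormedSpace ℝ F] [NormedAddCommGroup F'] [NormedSpace ℝ F']
  [NormedAddCommGroup V] [NormedSpace ℂ V]

theorem SchwartzMap.exists_fibre_bound (m : ℕ) : ∃ q : Seminorm ℝ 𝓢(E × F', V), Continuous q ∧
    ∀ f X ξ, ‖f (X, ξ)‖ ≤ q f * (1 + ‖ξ‖) ^ (-(m : ℝ)) := by
  refine ⟨(2 ^ m : NNReal) • (Finset.Iic (m, 0)).sup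
    (fun m => SchwartzMap.seminorm ℝ m.1 m.2), ?_, fun f X ξ => ?_⟩
  · exact continuous_const.smul (Seminorm.continuous_finsetSup fun m _ =>
      (schwartz_withSeminorms ℝ (E × F') V).continuous_seminorm m)
  · have h := one_add_le_sup_seminorm_apply (𝕜 := ℝ) (m := (m, 0)) le_rfl le_rfl f (X, ξ)
    rw [norm_iteratedFDeriv_zero] at h
    have h0 : 0 < 1 + ‖ξ‖ := by positivity
    rw [Real.rpow_neg h0.le, Real.rpow_natCast, ← div_eq_mul_inv, le_div_iff₀ (by positivity),
      mul_comm]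
    refine le_trans ?_ h
    gcongr
    exact norm_snd_le (X, ξ)

variable [MeasurableSpace F'] [BorelSpace F'] [SecondCountableTopology F']
  (ν : Measure F') [ν.HasTemperateGrowth] (B : F' →L[ℝ] F →L[ℝ] ℝ)

/-- The function `(X, Z) ↦ ∫ e^{i B(ξ, Z)} f(X, ξ) dξ`. -/
noncomputable def partialFourierFun (f : 𝓢(E × F', V)) (p : E × F) : V :=
  ∫ ξ, eI (B ξ p.2) • f (p.1, ξ) ∂ν

theorem continuous_partialFourier_integrand (f : 𝓢(E × F', V)) (p : E × F) :
    Continuous fun ξ => eI (B ξ p.2) • f (p.1, ξ) :=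
  (continuous_eI.comp (B.flip p.2).continuous).smul (f.continuous.comp (by fun_prop))

theorem norm_partialFourier_integrand (f : 𝓢(E × F', V)) (p : E × F) (ξ : F') :
    ‖eI (B ξ p.2) • f (p.1, ξ)‖ = ‖f (p.1, ξ)‖ := by
  rw [norm_smul, norm_eI, one_mul]

theorem integrable_fibre (f : 𝓢(E × F', V)) (X : E) : Integrable (fun ξ => f (X, ξ)) ν := by
  obtain ⟨q, -, h⟩ := exists_fibre_bound (E := E) (F' := F') (V := V) ν.integrablePower
  refine ((Measure.integrable_pow_neg_integrablePower ν).const_mul (q f)).mono'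
    (f.continuous.comp (by fun_prop)).aestronglyMeasurable (.of_forall fun ξ => h f X ξ)

theorem integrable_partialFourier_integrand (f : 𝓢(E × F', V)) (p : E × F) :
    Integrable (fun ξ => eI (B ξ p.2) • f (p.1, ξ)) ν :=
  (integrable_fibre ν f p.1).norm.mono'
    (continuous_partialFourier_integrand B f p).aestronglyMeasurable
    (.of_forall fun ξ => (norm_partialFourier_integrand B f p ξ).le)

theorem exists_partialFourierFun_bound : ∃ q : Seminorm ℝ 𝓢(E × F', V), Continuous q ∧
    ∀ f p, ‖partialFourierFun ν B f p‖ ≤ q f := by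
  obtain ⟨q, hq, h⟩ := exists_fibre_bound (E := E) (F' := F') (V := V) ν.integrablePower
  set C : ℝ := ∫ ξ, (1 + ‖ξ‖) ^ (-(ν.integrablePower : ℝ)) ∂ν
  have hC : 0 ≤ C := integral_nonneg fun ξ => by positivity
  refine ⟨C.toNNReal • q, continuous_const.smul hq, fun f p => ?_⟩
  refine (norm_integral_le_of_norm_le
    ((Measure.integrable_pow_neg_integrablePower ν).const_mul (q f))
    (.of_forall fun ξ => (norm_partialFourier_integrand B f p ξ).le.trans (h f p.1 ξ))).trans_eq ?_
  rw [integral_const_mul, mul_comm, smul_apply, NNReal.smul_def, Real.coe_toNNReal C hC,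
    smul_eq_mul]

theorem partialFourierFun_add (f g : 𝓢(E × F', V)) (p : E × F) :
    partialFourierFun ν B (f + g) p = partialFourierFun ν B f p + partialFourierFun ν B g p := by
  simp only [partialFourierFun, add_apply, smul_add]
  exact integral_add (integrable_partialFourier_integrand ν B f p)
    (integrable_partialFourier_integrand ν B g p)

theorem partialFourierFun_smul (c : ℂ) (f : 𝓢(E × F', V)) (p : E × F) :
    partialFourierFun ν B (c • f) p = c • partialFourierFun ν B f p := by
  simp only [partialFourierFun, smul_apply, smul_comm _ c, integral_smul]

/-- The operator corresponding to the derivative under the partial Fourier transform. -/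
noncomputable def partialFourierDeriv :
    𝓢(E × F', V) →L[ℝ] 𝓢(E × F', (E × F) →L[ℝ] V) :=
  (postcompCLM ((compL ℝ (E × F) (E × F') V).flip ((inl ℝ E F').comp (fst ℝ E F)))).comp
      (fderivCLM ℝ (E × F') V) +
    (smulRightCLM ℝ V (((compL ℝ (E × F) F ℝ).flip (snd ℝ E F)).comp (B.comp (snd ℝ E F')))).comp
      (postcompCLM (Complex.I • ContinuousLinearMap.id ℝ V))

theorem partialFourierDeriv_apply (f : 𝓢(E × F', V)) (x : E × F') (H : E × F) :
    partialFourierDeriv B f x H = fderiv ℝ f x (H.1, 0) + B x.2 H.2 • Complex.I • f x := rfl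

/-- The derivative is again a partial Fourier transform, of a Schwartz function with values in
linear maps. For this reason arbitrary target spaces are admitted throughout. -/
theorem hasFDerivAt_partialFourierFun (f : 𝓢(E × F', V)) (p : E × F) :
    HasFDerivAt (partialFourierFun ν B f)
      (partialFourierFun ν B (partialFourierDeriv B f) p) p := by
  obtain ⟨q, hq, h⟩ := exists_fibre_bound (E := E) (F' := F') (V := (E × F) →L[ℝ] V)
    ν.integrablePower
  refine hasFDerivAt_integral_of_dominated_of_fderiv_le (𝕜 := ℝ) (s := Set.univ)
    (bound := fun ξ => q (partialFourierDeriv B f) * (1 + ‖ξ‖) ^ (-(ν.integrablePower : ℝ)))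
    Filter.univ_mem
    (.of_forall fun p => (continuous_partialFourier_integrand B f p).aestronglyMeasurable)
    (integrable_partialFourier_integrand ν B f p)
    (F' := fun p ξ => eI (B ξ p.2) • partialFourierDeriv B f (p.1, ξ))
    (continuous_partialFourier_integrand B (partialFourierDeriv B f) p).aestronglyMeasurable
    (.of_forall fun ξ p _ => ?_)
    ((Measure.integrable_pow_neg_integrablePower ν).const_mul _) (.of_forall fun ξ p _ => ?_)
  · exact (norm_partialFourier_integrand B (partialFourierDeriv B f) p ξ).le.trans (h _ p.1 ξ)
  · have h1 : HasFDerivAt (fun p : E × F => eI (B ξ p.2))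
        ((toSpanSingleton ℝ (Complex.I * eI (B ξ p.2))).comp ((B ξ).comp (snd ℝ E F))) p :=
      HasFDerivAt.comp (g := eI) (f := (B ξ).comp (snd ℝ E F)) p (hasDerivAt_eI (B ξ p.2)).hasFDerivAt
        ((B ξ).comp (snd ℝ E F)).hasFDerivAt
    have h2 : HasFDerivAt (fun p : E × F => f (p.1, ξ))
        ((fderiv ℝ f (p.1, ξ)).comp ((inl ℝ E F').comp (fst ℝ E F))) p := by
      have h3 : HasFDerivAt (fun p : E × F => (p.1, ξ)) ((inl ℝ E F').comp (fst ℝ E F)) p := by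
        refine ((hasFDerivAt_fst (𝕜 := ℝ) (p := p)).prodMk (hasFDerivAt_const ξ p)).congr_fderiv ?_
        refine ContinuousLinearMap.ext fun H => ?_
        simp
      exact (f.hasFDerivAt (p.1, ξ)).comp p h3
    refine (h1.smul h2).congr_fderiv (ContinuousLinearMap.ext fun H => ?_)
    simp [partialFourierDeriv_apply, mul_smul, smul_comm _ (eI _)]

end PartialFourier

/-! ### Partial Fourier transforms are Schwartz -/

section PartialFourierDecay

open ContinuousLinearMap

theorem exists_norm_le_sum_of_separating {F : Type*} [NormedAddCommGroup F] [NormedSpace ℝ F]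
    [FiniteDimensional ℝ F] {ι : Type*} [Fintype ι] (m : ι → F →L[ℝ] ℝ)
    (h : ∀ Z, (∀ j, m j Z = 0) → Z = 0) :
    ∃ K : ℝ, 0 ≤ K ∧ ∀ Z, ‖Z‖ ≤ K * ∑ j, ‖m j Z‖ := by
  obtain ⟨K, -, hK⟩ := LinearMap.exists_antilipschitzWith
    (LinearMap.pi fun j => (m j : F →ₗ[ℝ] ℝ)) (LinearMap.ker_eq_bot'.2 fun Z hZ =>
      h Z fun j => congrFun hZ j)
  refine ⟨K, K.2, fun Z => ?_⟩
  have h1 : ‖Z‖ ≤ K * ‖LinearMap.pi (fun j => (m j : F →ₗ[ℝ] ℝ)) Z‖ := by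
    simpa using hK.le_mul_norm_sub Z 0
  refine h1.trans (mul_le_mul_of_nonneg_left ?_ K.2)
  refine (pi_norm_le_iff_of_nonneg (Finset.sum_nonneg fun j _ => norm_nonneg _)).2 fun j => ?_
  exact Finset.single_le_sum (f := fun j => ‖m j Z‖) (fun j _ => norm_nonneg _) (Finset.mem_univ j)

section

variable {E F F' V : Type*} [NormedAddCommGroup E] [NormedSpace ℝ E]
  [NormedAddCommGroup F] [NormedSpace ℝ F] [FiniteDimensional ℝ F]
  [NormedAddCommGroup F'] [NormedSpace ℝ F'] [FiniteDimensional ℝ F']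
  [NormedAddCommGroup V] [NormedSpace ℂ V] [MeasurableSpace F'] [BorelSpace F']
  (ν : Measure F') [ν.IsAddHaarMeasure] (B : F' →L[ℝ] F →L[ℝ] ℝ)

theorem smul_partialFourierFun_left (ℓ : E →L[ℝ] ℝ) (f : 𝓢(E × F', V)) (p : E × F) :
    ℓ p.1 • partialFourierFun ν B f p =
      partialFourierFun ν B (smulLeftCLM V (fun x : E × F' => ℓ x.1) f) p := by
  have h : (fun x : E × F' => ℓ x.1).HasTemperateGrowth :=
    (ℓ.comp (fst ℝ E F')).hasTemperateGrowth
  simp only [partialFourierFun, smulLeftCLM_apply_apply h, smul_comm _ (ℓ p.1)]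
  exact (integral_smul (ℓ p.1) _).symm

/-- The operator corresponding to multiplication by `B w` under the partial Fourier transform. -/
noncomputable def partialFourierMul (w : F') : 𝓢(E × F', V) →L[ℝ] 𝓢(E × F', V) :=
  (postcompCLM (Complex.I • ContinuousLinearMap.id ℝ V)).comp
    ((SchwartzMap.evalCLM ℝ (E × F') V ((0, w) : E × F')).comp (fderivCLM ℝ (E × F') V))

theorem partialFourierMul_apply (w : F') (f : 𝓢(E × F', V)) (x : E × F') :
    partialFourierMul w f x = Complex.I • fderiv ℝ f x (0, w) := rfl

/-- Integration by parts in ξ: the factor B(w, Z) arises by differentiating the exponential in the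
direction w. -/
theorem smul_partialFourierFun_right (w : F') (f : 𝓢(E × F', V)) (p : E × F) :
    B w p.2 • partialFourierFun ν B f p = partialFourierFun ν B (partialFourierMul w f) p := by
  set D : 𝓢(E × F', V) := (SchwartzMap.evalCLM ℝ (E × F') V ((0, w) : E × F'))
    (fderivCLM ℝ (E × F') V f) with hD
  have h1 : ∀ ξ, HasFDerivAt (fun ξ : F' => eI (B ξ p.2))
      ((toSpanSingleton ℝ (Complex.I * eI (B ξ p.2))).comp (B.flip p.2)) ξ := fun ξ =>
    HasFDerivAt.comp (g := eI) (f := B.flip p.2) ξ (hasDerivAt_eI (B ξ p.2)).hasFDerivAt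
      (B.flip p.2).hasFDerivAt
  have h2 : ∀ ξ, HasFDerivAt (fun ξ : F' => f (p.1, ξ)) ((fderiv ℝ f (p.1, ξ)).comp (inr ℝ E F')) ξ :=
    fun ξ => HasFDerivAt.comp (g := f) (f := fun ξ => (p.1, ξ)) ξ (f.hasFDerivAt (p.1, ξ))
      (hasFDerivAt_prodMk_right p.1 ξ)
  have key := integral_bilinear_hasFDerivAt_right_eq_neg_left_of_integrable (μ := ν)
    (B := ContinuousLinearMap.lsmul ℝ ℂ (E := V)) (v := w)
    (f := fun ξ : F' => eI (B ξ p.2)) (g := fun ξ : F' => f (p.1, ξ)) ?_ ?_ ?_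
    (fun ξ _ => h1 ξ) (fun ξ _ => h2 ξ)
  · simp only [partialFourierFun, partialFourierMul_apply]
    simp only [lsmul_apply, coe_comp, Function.comp_apply, inr_apply, flip_apply,
      toSpanSingleton_apply, smul_assoc, integral_smul] at key
    simp only [smul_comm _ Complex.I, integral_smul, key]
    simp only [mul_smul, integral_smul, smul_neg]
    rw [smul_comm Complex.I, ← mul_smul Complex.I, Complex.I_mul_I]
    simp
  · have h := (integrable_partialFourier_integrand ν B f p).smul (B w p.2 • Complex.I)
    refine h.congr (.of_forall fun ξ => ?_)
    simp [mul_smul]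
  · exact integrable_partialFourier_integrand ν B D p
  · exact integrable_partialFourier_integrand ν B f p

variable [FiniteDimensional ℝ E]

/-- The weight ‖p‖ is dominated by finitely many linear forms. Forms in the first variable pass
under the integral, those in the second become derivatives, and nondegeneracy of B makes them
separate points. -/
theorem exists_partialFourier_multipliers (hB : ∀ Z, (∀ ξ, B ξ Z = 0) → Z = 0) :
    ∃ (ι : Type) (_ : Fintype ι) (S : ι → 𝓢(E × F', V) →L[ℝ] 𝓢(E × F', V)) (K : ℝ), 0 ≤ K ∧
      ∀ f (p : E × F), ‖p‖ * ‖partialFourierFun ν B f p‖ ≤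
        K * ∑ j, ‖partialFourierFun ν B (S j f) p‖ := by
  set bE := Module.finBasis ℝ E
  set bF := Module.finBasis ℝ F'
  let m : Fin (Module.finrank ℝ E) ⊕ Fin (Module.finrank ℝ F') → (E × F) →L[ℝ] ℝ :=
    Sum.elim (fun i => (LinearMap.toContinuousLinearMap (bE.coord i)).comp (fst ℝ E F))
      (fun i => (B (bF i)).comp (snd ℝ E F))
  obtain ⟨K, hK, h⟩ := exists_norm_le_sum_of_separating m fun p hp => by
    refine Prod.ext (bE.forall_coord_eq_zero_iff.1 fun i => hp (.inl i)) (hB _ fun ξ => ?_)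
    have h1 : B.flip p.2 = 0 := by
      refine ContinuousLinearMap.coe_injective (bF.ext fun i => ?_)
      simpa [m] using hp (.inr i)
    simpa using congrArg (fun T : F' →L[ℝ] ℝ => T ξ) h1
  refine ⟨_, inferInstance, Sum.elim (fun i => smulLeftCLM V fun x : E × F' =>
    LinearMap.toContinuousLinearMap (bE.coord i) x.1) (fun i => partialFourierMul (bF i)), K, hK,
    fun f p => ?_⟩
  have h2 : ∀ j, ‖m j p‖ * ‖partialFourierFun ν B f p‖ = ‖partialFourierFun ν B
      ((Sum.elim (fun i => smulLeftCLM V fun x : E × F' =>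
        LinearMap.toContinuousLinearMap (bE.coord i) x.1) (fun i => partialFourierMul (bF i)) :
        _ ⊕ _ → 𝓢(E × F', V) →L[ℝ] 𝓢(E × F', V)) j f) p‖ := by
    rintro (i | i)
    · rw [← norm_smul, Sum.elim_inl, ← smul_partialFourierFun_left]
      rfl
    · rw [← norm_smul, Sum.elim_inr, ← smul_partialFourierFun_right]
      rfl
  simp only [← h2, ← Finset.sum_mul, ← mul_assoc]
  exact mul_le_mul_of_nonneg_right (h p) (norm_nonneg _)

theorem exists_pow_mul_partialFourierFun_bound (hB : ∀ Z, (∀ ξ, B ξ Z = 0) → Z = 0) (k : ℕ) :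
    ∃ q : Seminorm ℝ 𝓢(E × F', V), Continuous q ∧
      ∀ f (p : E × F), ‖p‖ ^ k * ‖partialFourierFun ν B f p‖ ≤ q f := by
  induction k with
  | zero => simpa using exists_partialFourierFun_bound ν B
  | succ k ih =>
    obtain ⟨q, hq, h⟩ := ih
    obtain ⟨ι, _, S, K, hK, hS⟩ := exists_partialFourier_multipliers (E := E) (V := V) ν B hB
    refine ⟨K.toNNReal • ∑ j, q.comp (S j : 𝓢(E × F', V) →ₗ[ℝ] 𝓢(E × F', V)),
      continuous_const.smul (Seminorm.continuous_finsetSum fun j _ =>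
        hq.comp (S j).continuous), fun f p => ?_⟩
    have h1 : (K.toNNReal • ∑ j, q.comp (S j : 𝓢(E × F', V) →ₗ[ℝ] 𝓢(E × F', V))) f =
        K * ∑ j, q (S j f) := by
      rw [smul_apply, NNReal.smul_def, Real.coe_toNNReal K hK, smul_eq_mul]
      congr 1
      exact (congrFun (map_sum (FunLike.coeAddMonoidHom (Seminorm ℝ 𝓢(E × F', V)) _ _) _ _) f).trans
        (Finset.sum_apply _ _ _)
    rw [h1, pow_succ, mul_assoc]
    refine (mul_le_mul_of_nonneg_left (hS f p) (by positivity)).trans ?_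
    rw [mul_left_comm, Finset.mul_sum]
    gcongr
    exact h _ _

end

universe u

variable {E F F' : Type u} [NormedAddCommGroup E] [NormedSpace ℝ E] [FiniteDimensional ℝ E]
  [NormedAddCommGroup F] [NormedSpace ℝ F] [FiniteDimensional ℝ F]
  [NormedAddCommGroup F'] [NormedSpace ℝ F'] [FiniteDimensional ℝ F']
  [MeasurableSpace F'] [BorelSpace F']
  (ν : Measure F') [ν.IsAddHaarMeasure] (B : F' →L[ℝ] F →L[ℝ] ℝ)

theorem fderiv_partialFourierFun {V : Type*} [NormedAddCommGroup V] [NormedSpace ℂ V]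
    (f : 𝓢(E × F', V)) : fderiv ℝ (partialFourierFun ν B f) =
      partialFourierFun ν B (partialFourierDeriv B f) :=
  funext fun p => (hasFDerivAt_partialFourierFun ν B f p).fderiv

/-- Each induction step replaces V by the linear maps from E × F to V, so all target spaces of one
universe are treated at once. -/
theorem contDiff_partialFourierFun_nat (n : ℕ) : ∀ (V : Type u) [NormedAddCommGroup V]
    [NormedSpace ℂ V] (f : 𝓢(E × F', V)), ContDiff ℝ n (partialFourierFun ν B f) := by
  induction n with
  | zero => exact fun V _ _ f => contDiff_zero.2 <| continuous_iff_continuousAt.2 fun p =>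
      (hasFDerivAt_partialFourierFun ν B f p).continuousAt
  | succ n ih =>
    intro V _ _ f
    rw [Nat.cast_succ, contDiff_succ_iff_fderiv]
    refine ⟨fun p =>
      (hasFDerivAt_partialFourierFun ν B f p).differentiableAt, fun h => absurd h (by simp), ?_⟩
    rw [fderiv_partialFourierFun]
    exact ih _ _

theorem exists_iteratedFDeriv_partialFourierFun_bound (hB : ∀ Z, (∀ ξ, B ξ Z = 0) → Z = 0)
    (k n : ℕ) : ∀ (V : Type u) [NormedAddCommGroup V] [NormedSpace ℂ V],
    ∃ q : Seminorm ℝ 𝓢(E × F', V), Continuous q ∧ ∀ f (p : E × F),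
      ‖p‖ ^ k * ‖iteratedFDeriv ℝ n (partialFourierFun ν B f) p‖ ≤ q f := by
  induction n with
  | zero =>
    intro V _ _
    simpa using exists_pow_mul_partialFourierFun_bound ν B hB k
  | succ n ih =>
    intro V _ _
    obtain ⟨q, hq, h⟩ := ih ((E × F) →L[ℝ] V)
    refine ⟨q.comp (partialFourierDeriv B : _ →L[ℝ] 𝓢(E × F', (E × F) →L[ℝ] V)).toLinearMap,
      hq.comp (partialFourierDeriv B).continuous, fun f p => ?_⟩
    rw [← norm_iteratedFDeriv_fderiv, fderiv_partialFourierFun]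
    exact h _ p

/-- The partial Fourier transform of vector valued Schwartz functions. -/
noncomputable def partialFourierV (hB : ∀ Z, (∀ ξ, B ξ Z = 0) → Z = 0) (V : Type u)
    [NormedAddCommGroup V] [NormedSpace ℂ V] : 𝓢(E × F', V) →L[ℂ] 𝓢(E × F, V) :=
  let T : 𝓢(E × F', V) →L[ℝ] 𝓢(E × F, V) :=
    mkCLM (partialFourierFun ν B) (partialFourierFun_add ν B)
      (fun r f p => by
        simpa using partialFourierFun_smul ν B (r : ℂ) f p)
      (fun f => contDiff_infty.2 fun n => contDiff_partialFourierFun_nat ν B n V f)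
      (fun n => by
        obtain ⟨q, hq, h⟩ := exists_iteratedFDeriv_partialFourierFun_bound (E := E) ν B hB n.1 n.2 V
        obtain ⟨s, C, -, hC⟩ := Seminorm.bound_of_continuous (schwartz_withSeminorms ℝ _ V) q hq
        exact ⟨s, C, C.2, fun f p => (h f p).trans (hC f)⟩)
  { toFun := T
    map_add' := T.map_add
    map_smul' := fun c f => SchwartzMap.ext fun p => partialFourierFun_smul ν B c f p
    cont := T.continuous }

/-- The partial Fourier transform of Schwartz functions. -/
noncomputable def partialFourier (hB : ∀ Z, (∀ ξ, B ξ Z = 0) → Z = 0) :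
    𝓢(E × F', ℂ) →L[ℂ] 𝓢(E × F, ℂ) :=
  -- The scalars are moved into the universe in which the induction over target spaces runs, and
  -- back.
  (postcompCLM (ContinuousLinearEquiv.ulift : ULift.{u} ℂ ≃L[ℂ] ℂ).toContinuousLinearMap).comp
    ((partialFourierV ν B hB (ULift.{u} ℂ)).comp
      (postcompCLM (ContinuousLinearEquiv.ulift : ULift.{u} ℂ ≃L[ℂ] ℂ).symm.toContinuousLinearMap))

theorem partialFourier_apply (hB : ∀ Z, (∀ ξ, B ξ Z = 0) → Z = 0) (f : 𝓢(E × F', ℂ)) (X : E)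
    (Z : F) : partialFourier ν B hB f (X, Z) = ∫ ξ, eI (B ξ Z) * f (X, ξ) ∂ν :=
  ((ContinuousLinearEquiv.ulift : ULift.{u} ℂ ≃L[ℂ] ℂ).integral_comp_comm _).symm

/-- Integration over the second variable. -/
noncomputable def fibreIntegral : 𝓢(E × F', ℂ) →L[ℂ] 𝓢(E, ℂ) :=
  -- The integral over a fibre is the partial Fourier transform at frequency zero.
  (compCLM ℂ (g := fun X : E => (X, (0 : F' →L[ℝ] ℝ)))
      (ContinuousLinearMap.inl ℝ E (F' →L[ℝ] ℝ)).hasTemperateGrowth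
      ⟨1, 1, fun X => by simp [Prod.norm_def]⟩).comp
    (partialFourier ν (ContinuousLinearMap.apply ℝ ℝ : F' →L[ℝ] (F' →L[ℝ] ℝ) →L[ℝ] ℝ)
      fun _ h => ContinuousLinearMap.ext h)

theorem fibreIntegral_apply (f : 𝓢(E × F', ℂ)) (X : E) :
    fibreIntegral ν f X = ∫ Y, f (X, Y) ∂ν := by
  refine (partialFourier_apply ν _ _ f X 0).trans ?_
  simp [eI_zero]

end PartialFourierDecay

/-! ### Tensor products of Schwartz functions -/

section Tensor

variable {E F : Type*} [NormedAddCommGroup E] [NormedSpace ℝ E]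
  [NormedAddCommGroup F] [NormedSpace ℝ F]

theorem iteratedFDeriv_comp_clm_le {D : Type*} [NormedAddCommGroup D] [NormedSpace ℝ D]
    (L : D →L[ℝ] E) (hL : ‖L‖ ≤ 1) (f : 𝓢(E, ℂ)) (n : ℕ) (x : D) :
    ‖iteratedFDeriv ℝ n (fun x => f (L x)) x‖ ≤ ‖iteratedFDeriv ℝ n f (L x)‖ := by
  have h := L.iteratedFDeriv_comp_right (f.smooth ⊤) x (i := n) (mod_cast le_top)
  have h2 : (fun x => f (L x)) = f ∘ L := rfl
  rw [h2, h]
  refine (ContinuousMultilinearMap.norm_compContinuousLinearMap_le _ _).trans ?_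
  refine mul_le_of_le_one_right (norm_nonneg _) ?_
  exact Finset.prod_le_one (fun _ _ => norm_nonneg _) fun _ _ => hL

/-- The tensor product `(X, Y) ↦ f X * g Y` with a fixed Schwartz function `g`. -/
noncomputable def tensorRight (g : 𝓢(F, ℂ)) : 𝓢(E, ℂ) →L[ℂ] 𝓢(E × F, ℂ) :=
  mkCLM (fun f p => f p.1 * g p.2) (fun f₁ f₂ p => by simp [add_mul])
    (fun c f p => by simp [mul_assoc])
    (fun f => ((f.smooth ⊤).comp contDiff_fst).mul ((g.smooth ⊤).comp contDiff_snd)) (by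
      rintro ⟨k, n⟩
      set s : Finset (ℕ × ℕ) := Finset.range (k + 1) ×ˢ Finset.range (n + 1) with hs
      have hle : ∀ a ≤ k, ∀ b ≤ n, ∀ (f : 𝓢(E, ℂ)) x, ‖x‖ ^ a * ‖iteratedFDeriv ℝ b f x‖ ≤
          s.sup (schwartzSeminormFamily ℂ E ℂ) f := fun a ha b hb f x => by
        refine (SchwartzMap.le_seminorm ℂ a b f x).trans ?_
        have h1 : (a, b) ∈ s := by simp [hs]; omega
        exact Seminorm.le_def.1 (Finset.le_sup (f := schwartzSeminormFamily ℂ E ℂ) h1) f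
      set C : ℝ := ∑ i ∈ Finset.range (n + 1), (n.choose i : ℝ) *
        (SchwartzMap.seminorm ℂ 0 (n - i) g + SchwartzMap.seminorm ℂ k (n - i) g)
      refine ⟨s, C, by positivity, fun f p => ?_⟩
      have h := norm_iteratedFDeriv_mul_le (𝕜 := ℝ)
        (f := fun p : E × F => f (ContinuousLinearMap.fst ℝ E F p))
        (g := fun p : E × F => g (ContinuousLinearMap.snd ℝ E F p)) (N := ((⊤ : ℕ∞) : WithTop ℕ∞))
        ((f.smooth ⊤).comp contDiff_fst) ((g.smooth ⊤).comp contDiff_snd) p (n := n)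
        (mod_cast le_top)
      refine (mul_le_mul_of_nonneg_left h (by positivity)).trans ?_
      rw [Finset.mul_sum, Finset.sum_mul]
      refine Finset.sum_le_sum fun i hi => ?_
      have h1 := iteratedFDeriv_comp_clm_le _ (ContinuousLinearMap.norm_fst_le ℝ E F) f i p
      have h2 := iteratedFDeriv_comp_clm_le _ (ContinuousLinearMap.norm_snd_le ℝ E F) g (n - i) p
      have hi' : i ≤ n := by simpa [Nat.lt_succ_iff] using hi
      -- The weight splits between the two factors; in either case one of them keeps the power k and
      -- the other needs none.
      have hp : ‖p‖ ^ k ≤ ‖p.1‖ ^ k + ‖p.2‖ ^ k := by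
        rcases max_choice ‖p.1‖ ‖p.2‖ with h | h <;> rw [Prod.norm_def, h] <;> simp
      have f0 := hle 0 (Nat.zero_le _) i hi' f p.1
      have fk := hle k le_rfl i hi' f p.1
      have g0 := SchwartzMap.le_seminorm ℂ 0 (n - i) g p.2
      have gk := SchwartzMap.le_seminorm ℂ k (n - i) g p.2
      rw [pow_zero, one_mul] at f0 g0
      change ‖p‖ ^ k * ((n.choose i : ℝ) * _ * _) ≤ _
      calc _ ≤ (‖p.1‖ ^ k + ‖p.2‖ ^ k) * ((n.choose i : ℝ) * ‖iteratedFDeriv ℝ i f p.1‖ *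
              ‖iteratedFDeriv ℝ (n - i) g p.2‖) := by gcongr <;> assumption
        _ = (n.choose i : ℝ) * ((‖p.1‖ ^ k * ‖iteratedFDeriv ℝ i f p.1‖) *
              ‖iteratedFDeriv ℝ (n - i) g p.2‖ + ‖iteratedFDeriv ℝ i f p.1‖ *
              (‖p.2‖ ^ k * ‖iteratedFDeriv ℝ (n - i) g p.2‖)) := by ring
        _ ≤ (n.choose i : ℝ) * (s.sup (schwartzSeminormFamily ℂ E ℂ) f *
              SchwartzMap.seminorm ℂ 0 (n - i) g + s.sup (schwartzSeminormFamily ℂ E ℂ) f *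
              SchwartzMap.seminorm ℂ k (n - i) g) := by gcongr
        _ = _ := by ring)

theorem tensorRight_apply (g : 𝓢(F, ℂ)) (f : 𝓢(E, ℂ)) (p : E × F) :
    tensorRight g f p = f p.1 * g p.2 := rfl

/-- The tensor product `(X, Y) ↦ f X * g Y` with a fixed Schwartz function `f`. -/
noncomputable def tensorLeft (f : 𝓢(E, ℂ)) : 𝓢(F, ℂ) →L[ℂ] 𝓢(E × F, ℂ) :=
  (compCLMOfContinuousLinearEquiv ℂ (ContinuousLinearEquiv.prodComm ℝ E F)).comp (tensorRight f)

theorem tensorLeft_apply (f : 𝓢(E, ℂ)) (g : 𝓢(F, ℂ)) (p : E × F) :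
    tensorLeft f g p = f p.1 * g p.2 := mul_comm _ _

end Tensor

/-! ### Fourier inversion -/

section FourierInversion

open scoped FourierTransform RealInnerProductSpace

theorem eI_two_pi_mul (t : ℝ) : eI (2 * Real.pi * t) = Complex.exp (↑(2 * Real.pi * t) * Complex.I) := by
  rw [eI, mul_comm]

/-- The factor (2π)^{-n} is the Jacobian of the dilation by 2π that turns e^{i⟨x,y⟩} into the kernel
e^{2πi⟨x,y⟩}. -/
theorem integral_eI_euclidean_inversion {n : ℕ} (g : 𝓢(EuclideanSpace ℝ (Fin n), ℂ))
    (z : EuclideanSpace ℝ (Fin n)) :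
    ((2 * Real.pi) ^ n : ℝ)⁻¹ • ∫ x, eI ⟪x, z⟫ * ∫ y, eI (-⟪x, y⟫) * g y = g z := by
  have h1 := Measure.integral_comp_smul (volume : Measure (EuclideanSpace ℝ (Fin n)))
    (fun x => eI ⟪x, z⟫ * ∫ y, eI (-⟪x, y⟫) * g y) (2 * Real.pi)
  rw [finrank_euclideanSpace_fin, abs_of_nonneg (by positivity)] at h1
  rw [← h1]
  have h2 : 𝓕⁻ (𝓕 g) z = g z := by rw [FourierTransform.fourierInv_fourier_eq]
  rw [fourierInv_coe, Real.fourierInv_eq', fourier_coe] at h2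
  rw [← h2]
  refine integral_congr_ae (.of_forall fun x => ?_)
  simp only [Real.fourier_eq', smul_eq_mul, real_inner_smul_left]
  rw [eI_two_pi_mul]
  congr 1
  refine integral_congr_ae (.of_forall fun y => ?_)
  simp only [real_inner_comm y x]
  rw [← mul_neg, eI_two_pi_mul]
  congr 4
  ring

variable {F F' : Type*} [NormedAddCommGroup F] [NormedSpace ℝ F] [FiniteDimensional ℝ F]
  [MeasurableSpace F] [BorelSpace F]
  [NormedAddCommGroup F'] [NormedSpace ℝ F'] [FiniteDimensional ℝ F']
  [MeasurableSpace F'] [BorelSpace F']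

/-- The linear isomorphism from Euclidean space given by a basis. -/
noncomputable def euclideanEquivOfBasis {n : ℕ} (b : Module.Basis (Fin n) ℝ F) :
    EuclideanSpace ℝ (Fin n) ≃L[ℝ] F :=
  ((EuclideanSpace.basisFun (Fin n) ℝ).toBasis.equiv b (Equiv.refl _)).toContinuousLinearEquiv

theorem euclideanEquivOfBasis_apply {n : ℕ} (b : Module.Basis (Fin n) ℝ F)
    (x : EuclideanSpace ℝ (Fin n)) : euclideanEquivOfBasis b x = ∑ i, x i • b i := by
  conv_lhs => rw [← (EuclideanSpace.basisFun (Fin n) ℝ).toBasis.sum_repr x, map_sum]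
  refine Finset.sum_congr rfl fun i _ => ?_
  rw [map_smul]
  congr 1
  exact Module.Basis.equiv_apply _ _ _ _

theorem map_euclideanEquivOfBasis {n : ℕ} (b : Module.Basis (Fin n) ℝ F) :
    (volume : Measure (EuclideanSpace ℝ (Fin n))).map (euclideanEquivOfBasis b) = b.addHaar := by
  rw [← (EuclideanSpace.basisFun (Fin n) ℝ).addHaar_eq_volume, Module.Basis.map_addHaar]
  congr 1
  ext i
  simp [euclideanEquivOfBasis]

/-- In coordinates with respect to dual bases the pairing is the Euclidean inner product, so only
the product of the two normalizations matters. -/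
theorem integral_eI_inversion_of_bases {n : ℕ} (b : Module.Basis (Fin n) ℝ F)
    (c : Module.Basis (Fin n) ℝ F') (B : F' →L[ℝ] F →L[ℝ] ℝ)
    (hB : ∀ i j, B (c i) (b j) = if i = j then 1 else 0) {r s : ℝ≥0∞}
    (hrs : r.toReal * s.toReal = ((2 * Real.pi) ^ n)⁻¹) (f : 𝓢(F, ℂ)) (Z : F) :
    ∫ ξ, eI (B ξ Z) * ∫ W, eI (-(B ξ W)) * f W ∂(r • b.addHaar) ∂(s • c.addHaar) = f Z := by
  have hI : ∀ x y, B (euclideanEquivOfBasis c x) (euclideanEquivOfBasis b y) = ⟪x, y⟫ := by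
    intro x y
    simp [euclideanEquivOfBasis_apply, hB, PiLp.inner_apply, mul_comm]
  have h := integral_eI_euclidean_inversion
    (compCLMOfContinuousLinearEquiv ℂ (euclideanEquivOfBasis b) f) ((euclideanEquivOfBasis b).symm Z)
  rw [← map_euclideanEquivOfBasis b, ← map_euclideanEquivOfBasis c]
  simp only [integral_smul_measure]
  have hc := (euclideanEquivOfBasis c).toHomeomorph.measurableEmbedding
  have hb := (euclideanEquivOfBasis b).toHomeomorph.measurableEmbedding
  simp only [ContinuousLinearEquiv.coe_toHomeomorph] at hb hc
  rw [hc.integral_map]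
  simp only [hb.integral_map, hI]
  have hZ : ∀ x, B (euclideanEquivOfBasis c x) Z = ⟪x, (euclideanEquivOfBasis b).symm Z⟫ := by
    intro x
    rw [← hI, ContinuousLinearEquiv.apply_symm_apply]
  simp only [hZ, mul_smul_comm, integral_smul]
  rw [← mul_smul, mul_comm, hrs]
  simpa using h

end FourierInversion

/-! ### Fourier inversion for the dual Haar measure -/

section DualHaar

variable {𝔤 : Type*} [NormedLieRing 𝔤] [NormedLieAlgebra 𝔤] [FiniteDimensional ℝ 𝔤]
  [MeasurableSpace 𝔤] [BorelSpace 𝔤] (μ : Measure 𝔤) [μ.IsAddHaarMeasure]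

theorem eq_smul_addHaar_finBasis :
    μ = μ (parallelepiped (Module.finBasis ℝ 𝔤)) • (Module.finBasis ℝ 𝔤).addHaar := by
  rw [Module.Basis.addHaar_def]
  exact Measure.addHaarMeasure_unique μ (Module.finBasis ℝ 𝔤).parallelepiped

/-- The basis of the topological dual that is dual to the standard basis. -/
noncomputable def finDualBasis (𝔤 : Type*) [NormedLieRing 𝔤] [NormedLieAlgebra 𝔤]
    [FiniteDimensional ℝ 𝔤] : Module.Basis (Fin (Module.finrank ℝ 𝔤)) ℝ (𝔤 →L[ℝ] ℝ) :=
  (Module.finBasis ℝ 𝔤).dualBasis.map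
    (LinearMap.toContinuousLinearMap : (𝔤 →ₗ[ℝ] ℝ) ≃ₗ[ℝ] (𝔤 →L[ℝ] ℝ))

theorem finDualBasis_apply (i j : Fin (Module.finrank ℝ 𝔤)) :
    finDualBasis 𝔤 i (Module.finBasis ℝ 𝔤 j) = if i = j then 1 else 0 := by
  simp [finDualBasis, Finsupp.single_apply, eq_comm]

theorem toReal_mul_toReal_dualHaar :
    (μ (parallelepiped (Module.finBasis ℝ 𝔤))).toReal *
      ((ENNReal.ofReal ((2 * Real.pi) ^ Module.finrank ℝ 𝔤) *
        μ (parallelepiped (Module.finBasis ℝ 𝔤)))⁻¹).toReal =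
      ((2 * Real.pi) ^ Module.finrank ℝ 𝔤)⁻¹ := by
  set b := Module.finBasis ℝ 𝔤
  have h0 : μ (parallelepiped b) ≠ 0 :=
    (Measure.measure_pos_of_nonempty_interior μ b.parallelepiped.interior_nonempty).ne'
  have h1 : μ (parallelepiped b) ≠ ∞ := b.parallelepiped.isCompact.measure_lt_top.ne
  have h2 : (μ (parallelepiped b)).toReal ≠ 0 := ENNReal.toReal_ne_zero.2 ⟨h0, h1⟩
  rw [ENNReal.toReal_inv, ENNReal.toReal_mul, ENNReal.toReal_ofReal (by positivity)]
  field_simp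

theorem integral_eI_inversion (f : 𝓢(𝔤, ℂ)) (Z : 𝔤) :
    ∫ ξ, eI (ξ Z) * ∫ W, eI (-(ξ W)) * f W ∂μ ∂(dualHaar μ) = f Z := by
  have h := integral_eI_inversion_of_bases (Module.finBasis ℝ 𝔤) (finDualBasis 𝔤)
    (ContinuousLinearMap.id ℝ (𝔤 →L[ℝ] ℝ)) finDualBasis_apply (toReal_mul_toReal_dualHaar μ) f Z
  rw [← eq_smul_addHaar_finBasis] at h
  exact h

theorem integral_eI_inversion_dual (f : 𝓢(𝔤 →L[ℝ] ℝ, ℂ)) (ξ : 𝔤 →L[ℝ] ℝ) :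
    ∫ W, eI (-(ξ W)) * ∫ η, eI (η W) * f η ∂(dualHaar μ) ∂μ = f ξ := by
  have h := integral_eI_inversion_of_bases (finDualBasis 𝔤) (Module.finBasis ℝ 𝔤)
    (ContinuousLinearMap.id ℝ (𝔤 →L[ℝ] ℝ)).flip
    (fun i j => by simp [finDualBasis_apply, eq_comm])
    ((mul_comm _ _).trans (toReal_mul_toReal_dualHaar μ)) f ξ
  rw [← eq_smul_addHaar_finBasis] at h
  -- The general formula carries the opposite signs in W; the substitution W ↦ -W exchanges them.
  rw [← h, ← integral_neg_eq_self]
  simp only [map_neg, neg_neg]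
  rfl

end DualHaar

/-! ### Operations on Schwartz functions and tempered distributions -/

section Operations

theorem eI_hasTemperateGrowth : eI.HasTemperateGrowth := by
  have h : ∀ n : ℕ, ContDiff ℝ n eI ∧ iteratedDeriv n eI = fun t => Complex.I ^ n * eI t := by
    intro n
    induction n with
    | zero => exact ⟨contDiff_zero.2 continuous_eI, by simp⟩
    | succ n ih =>
      have hd : deriv eI = fun t => Complex.I * eI t := funext fun t => (hasDerivAt_eI t).deriv
      refine ⟨?_, ?_⟩
      · rw [Nat.cast_succ, contDiff_succ_iff_deriv]
        refine ⟨fun t => (hasDerivAt_eI t).differentiableAt, fun h => absurd h (by simp), ?_⟩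
        rw [hd]
        exact contDiff_const.mul ih.1
      · funext t
        rw [iteratedDeriv_succ, ih.2]
        rw [((hasDerivAt_eI t).const_mul _).deriv]
        ring
  refine ⟨contDiff_infty.2 fun n => (h n).1, fun n => ⟨0, 1, fun t => ?_⟩⟩
  rw [norm_iteratedFDeriv_eq_norm_iteratedDeriv, (h n).2]
  simp [norm_eI]

variable {E E' : Type*} [NormedAddCommGroup E] [NormedSpace ℝ E] [NormedAddCommGroup E']
  [NormedSpace ℝ E']

theorem eI_clm_hasTemperateGrowth (ℓ : E →L[ℝ] ℝ) : (fun x => eI (ℓ x)).HasTemperateGrowth :=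
  eI_hasTemperateGrowth.comp ℓ.hasTemperateGrowth

/-- Composition with a map that has a left inverse, both of temperate growth. -/
noncomputable def temperateComp {g : E → E'} {g' : E' → E} (hg : g.HasTemperateGrowth)
    (hg' : g'.HasTemperateGrowth) (h : ∀ x, g' (g x) = x) : 𝓢(E', ℂ) →L[ℂ] 𝓢(E, ℂ) :=
  compCLM ℂ hg <| by
    -- Decay survives the composition because x = g'(g x) is bounded by a power of 1 + ‖g x‖.
    obtain ⟨k, C, hC⟩ := hg'.2 0
    refine ⟨k, C, fun x => ?_⟩
    simpa [h] using hC (g x)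

theorem temperateComp_apply {g : E → E'} {g' : E' → E} (hg : g.HasTemperateGrowth)
    (hg' : g'.HasTemperateGrowth) (h : ∀ x, g' (g x) = x) (f : 𝓢(E', ℂ)) (x : E) :
    temperateComp hg hg' h f x = f (g x) := rfl

theorem conjS_apply (f : 𝓢(E, ℂ)) (x : E) : conjS f x = conj (f x) := rfl

theorem conjS_conjS (f : 𝓢(E, ℂ)) : conjS (conjS f) = f :=
  SchwartzMap.ext fun x => by simp [conjS_apply]

/-- Complex conjugation as a continuous antilinear map. -/
noncomputable def conjCLM : 𝓢(E, ℂ) →SL[starRingEnd ℂ] 𝓢(E, ℂ) where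
  toFun := conjS
  map_add' f g := SchwartzMap.ext fun x => by simp [conjS_apply]
  map_smul' c f := SchwartzMap.ext fun x => by simp [conjS_apply]
  cont := (SchwartzMap.postcompCLM (Complex.conjCLE : ℂ →L[ℝ] ℂ)).continuous

/-- The restriction of a Schwartz function to a fibre of a product. -/
noncomputable def fibre (X : E) : 𝓢(E × E', ℂ) →L[ℂ] 𝓢(E', ℂ) :=
  compCLM ℂ (g := fun Y : E' => (X, Y)) (by
      have h1 : (fun _ : E' => ((X, 0) : E × E')).HasTemperateGrowth := .const _
      have h2 := h1.add (ContinuousLinearMap.inr ℝ E E').hasTemperateGrowth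
      convert h2 using 1
      ext Y <;> simp)
    ⟨1, 1, fun Y => by
      have := norm_snd_le ((X, Y) : E × E')
      simp only [pow_one, one_mul] at *
      linarith⟩

theorem fibre_apply (X : E) (f : 𝓢(E × E', ℂ)) (Y : E') : fibre X f Y = f (X, Y) := rfl

theorem pair_ext {T T' : 𝓢'(E, ℂ)} (h : ∀ f, pair T f = pair T' f) : T = T' := by
  refine DFunLike.ext _ _ fun f => ?_
  have h1 := h (conjS f)
  rwa [pair, pair, conjS_conjS] at h1

/-- The operator on tempered distributions dual to `L` under the sesquilinear pairing. -/
noncomputable def transposeD (L : 𝓢(E, ℂ) →L[ℂ] 𝓢(E', ℂ)) : 𝓢'(E', ℂ) →L[ℂ] 𝓢'(E, ℂ) :=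
  PointwiseConvergenceCLM.precomp ℂ (conjCLM.comp (L.comp conjCLM))

theorem pair_transposeD (L : 𝓢(E, ℂ) →L[ℂ] 𝓢(E', ℂ)) (T : 𝓢'(E', ℂ)) (f : 𝓢(E, ℂ)) :
    pair (transposeD L T) f = pair T (L f) := by
  change T (conjS (L (conjS (conjS f)))) = _
  rw [conjS_conjS]
  rfl

theorem exists_pair_eq_conj (J : 𝓢(E, ℂ) →SL[starRingEnd ℂ] 𝓢(E', ℂ)) (T : 𝓢'(E', ℂ)) :
    ∃ T' : 𝓢'(E, ℂ), ∀ f, pair T' f = conj (pair T (J f)) := by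
  refine ⟨ContinuousLinearMap.toPointwiseConvergenceCLM _ _ _ _
    (((starL ℂ : ℂ ≃L⋆[ℂ] ℂ) : ℂ →SL[starRingEnd ℂ] ℂ).comp
    ((T : 𝓢(E', ℂ) →L[ℂ] ℂ).comp (conjCLM.comp (J.comp conjCLM)))), fun f => ?_⟩
  change conj (T (conjS (J (conjS (conjS f))))) = _
  rw [conjS_conjS]
  rfl

variable [MeasurableSpace E] [BorelSpace E] [SecondCountableTopology E] (μ : Measure E)

theorem pair_distS [μ.HasTemperateGrowth] (f h : 𝓢(E, ℂ)) :
    pair (distS μ f) h = ∫ x, f x * conj (h x) ∂μ := by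
  refine (toTemperedDistributionCLM_apply_apply μ f (conjS h)).trans ?_
  simp only [conjS_apply, smul_eq_mul, mul_comm]

/-- The product of two Schwartz functions. -/
noncomputable def mulS (f g : 𝓢(E, ℂ)) : 𝓢(E, ℂ) := smulLeftCLM ℂ f g

theorem mulS_apply (f g : 𝓢(E, ℂ)) (x : E) : mulS f g x = f x * g x :=
  smulLeftCLM_apply_apply f.hasTemperateGrowth g x

theorem integrable_mul_conj [μ.HasTemperateGrowth] (f g : 𝓢(E, ℂ)) :
    Integrable (fun x => f x * conj (g x)) μ := by
  refine ((mulS f (conjS g)).integrable (μ := μ)).congr (.of_forall fun x => ?_)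
  exact mulS_apply _ _ _

/-- Testing against f - g makes its L² norm vanish; continuity and full support of the measure do
the rest. -/
theorem eq_of_integral_mul_conj_eq [FiniteDimensional ℝ E] [μ.IsAddHaarMeasure] {f g : 𝓢(E, ℂ)}
    (h : ∀ k : 𝓢(E, ℂ), ∫ x, k x * conj (f x) ∂μ = ∫ x, k x * conj (g x) ∂μ) : f = g := by
  have h1 : ∫ x, (f - g) x * conj ((f - g) x) ∂μ = 0 := by
    have h2 := h (f - g)
    rw [← sub_eq_zero, ← integral_sub (integrable_mul_conj μ _ _) (integrable_mul_conj μ _ _)] at h2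
    simpa [mul_sub] using h2
  have h2 : ∫ x, ‖(f - g) x‖ ^ 2 ∂μ = 0 := by
    simp only [Complex.mul_conj, Complex.normSq_eq_norm_sq] at h1
    rw [integral_complex_ofReal] at h1
    exact_mod_cast h1
  have hc : Continuous fun x => ‖(f - g) x‖ ^ 2 := by fun_prop
  have hi : Integrable (fun x => ‖(f - g) x‖ ^ 2) μ := by
    refine (integrable_mul_conj μ (f - g) (f - g)).norm.congr (.of_forall fun x => ?_)
    simp only [norm_mul, RCLike.norm_conj, sq]
  have h3 := (integral_eq_zero_iff_of_nonneg (fun x => by positivity) hi).1 h2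
  have h4 := (hc.ae_eq_iff_eq μ continuous_const).1 h3
  refine SchwartzMap.ext fun x => sub_eq_zero.1 ?_
  have h5 : ‖(f - g) x‖ ^ 2 = 0 := congrFun h4 x
  simpa using h5

theorem distS_injective [FiniteDimensional ℝ E] [μ.IsAddHaarMeasure] :
    Function.Injective (distS μ : 𝓢(E, ℂ) → 𝓢'(E, ℂ)) := by
  intro f g h
  refine eq_of_integral_mul_conj_eq μ fun k => ?_
  have h1 := congrArg (fun T => conj (pair T k)) h
  simp only [pair_distS, ← integral_conj] at h1
  simpa [mul_comm] using h1

theorem schwartzOf_distS [FiniteDimensional ℝ E] [μ.IsAddHaarMeasure] (f : 𝓢(E, ℂ)) :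
    schwartzOf μ (distS μ f) = f :=
  distS_injective μ (Classical.epsilon_spec (p := fun k => distS μ k = distS μ f) ⟨f, rfl⟩)

end Operations

-- From here on Dynkin's series plays no role: the group laws, temperate growth with continuity, and
-- invariance of the measure suffice.
attribute [local irreducible] bch

/-! ### Symbols and integral kernels -/

section Kernels

variable {𝔤 : Type*} [NormedLieRing 𝔤] [NormedLieAlgebra 𝔤] [FiniteDimensional ℝ 𝔤]
  [LieRing.IsNilpotent 𝔤]

theorem fst_hasTemperateGrowth {E F : Type*} [NormedAddCommGroup E] [NormedSpace ℝ E]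
    [NormedAddCommGroup F] [NormedSpace ℝ F] : (fun p : E × F => p.1).HasTemperateGrowth :=
  (ContinuousLinearMap.fst ℝ E F).hasTemperateGrowth

theorem snd_hasTemperateGrowth {E F : Type*} [NormedAddCommGroup E] [NormedSpace ℝ E]
    [NormedAddCommGroup F] [NormedSpace ℝ F] : (fun p : E × F => p.2).HasTemperateGrowth :=
  (ContinuousLinearMap.snd ℝ E F).hasTemperateGrowth

theorem Function.HasTemperateGrowth.prodMk {D E F : Type*} [NormedAddCommGroup D] [NormedSpace ℝ D]
    [NormedAddCommGroup E] [NormedSpace ℝ E] [NormedAddCommGroup F] [NormedSpace ℝ F]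
    {f : D → E} {g : D → F} (hf : f.HasTemperateGrowth) (hg : g.HasTemperateGrowth) :
    (fun d => (f d, g d)).HasTemperateGrowth := by
  have h := ((ContinuousLinearMap.inl ℝ E F).hasTemperateGrowth.comp hf).add
    ((ContinuousLinearMap.inr ℝ E F).hasTemperateGrowth.comp hg)
  have h2 : (ContinuousLinearMap.inl ℝ E F ∘ f + ContinuousLinearMap.inr ℝ E F ∘ g) =
      fun d => (f d, g d) := by
    funext d
    simp
  rwa [h2] at h

/-- The function `(X, Y) ↦ k(X, X • (-Y))`. -/
noncomputable def twistKernel : 𝓢(𝔤 × 𝔤, ℂ) →L[ℂ] 𝓢(𝔤 × 𝔤, ℂ) :=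
  temperateComp (g := fun p => (p.1, bch p.1 (-p.2))) (g' := fun p => (p.1, bch (-p.2) p.1))
    (fst_hasTemperateGrowth.prodMk
      (bch_hasTemperateGrowth fst_hasTemperateGrowth snd_hasTemperateGrowth.neg))
    (fst_hasTemperateGrowth.prodMk
      (bch_hasTemperateGrowth snd_hasTemperateGrowth.neg fst_hasTemperateGrowth))
    fun p => Prod.ext rfl (by simp [neg_bch_eq, bch_neg_cancel_right])

/-- The function `(X, W) ↦ k(X, (-W) • X)`. -/
noncomputable def untwistKernel : 𝓢(𝔤 × 𝔤, ℂ) →L[ℂ] 𝓢(𝔤 × 𝔤, ℂ) :=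
  temperateComp (g := fun p => (p.1, bch (-p.2) p.1)) (g' := fun p => (p.1, bch p.1 (-p.2)))
    (fst_hasTemperateGrowth.prodMk
      (bch_hasTemperateGrowth snd_hasTemperateGrowth.neg fst_hasTemperateGrowth))
    (fst_hasTemperateGrowth.prodMk
      (bch_hasTemperateGrowth fst_hasTemperateGrowth snd_hasTemperateGrowth.neg))
    fun p => Prod.ext rfl (by simp [neg_bch_eq, bch_neg_cancel])

theorem bch_neg_bch_neg (X Y : 𝔤) : bch (-bch X (-Y)) X = Y := by
  simp [neg_bch_eq, bch_neg_cancel_right]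

theorem bch_neg_bch_neg' (X W : 𝔤) : bch X (-bch (-W) X) = W := by
  simp [neg_bch_eq, bch_neg_cancel]

variable [MeasurableSpace 𝔤] [BorelSpace 𝔤] (μ : Measure 𝔤) [μ.IsAddHaarMeasure]

/-- The integral kernel `K(X, Y) = ∫ e^{i⟨X•(-Y)|ξ⟩} f(X, ξ) dξ` of the operator with symbol `f`. -/
noncomputable def kernelOf : 𝓢(PhaseSpace 𝔤, ℂ) →L[ℂ] 𝓢(𝔤 × 𝔤, ℂ) :=
  twistKernel.comp (partialFourier (dualHaar μ) (ContinuousLinearMap.id ℝ (𝔤 →L[ℝ] ℝ))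
    fun Z h => by
      by_contra hZ
      obtain ⟨ξ, -, h2⟩ := exists_dual_vector ℝ Z (norm_ne_zero_iff.2 hZ)
      have h3 := h ξ
      change ξ Z = 0 at h3
      rw [h3] at h2
      exact hZ (norm_eq_zero.1 (by exact_mod_cast h2.symm)))

theorem kernelOf_apply (f : 𝓢(PhaseSpace 𝔤, ℂ)) (X Y : 𝔤) :
    kernelOf μ f (X, Y) = ∫ ξ, eI (ξ (bch X (-Y))) * f (X, ξ) ∂(dualHaar μ) := by
  rw [kernelOf, ContinuousLinearMap.comp_apply, twistKernel, temperateComp_apply]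
  rw [partialFourier_apply]
  rfl

/-- The symbol of the operator with integral kernel `k`. -/
noncomputable def symbolOf : 𝓢(𝔤 × 𝔤, ℂ) →L[ℂ] 𝓢(PhaseSpace 𝔤, ℂ) :=
  (partialFourier μ (-(ContinuousLinearMap.id ℝ (𝔤 →L[ℝ] ℝ)).flip)
    fun ξ h => ContinuousLinearMap.ext fun W => by simpa using h W).comp untwistKernel

theorem symbolOf_apply (k : 𝓢(𝔤 × 𝔤, ℂ)) (X : 𝔤) (ξ : 𝔤 →L[ℝ] ℝ) :
    symbolOf μ k (X, ξ) = ∫ W, eI (-(ξ W)) * k (X, bch (-W) X) ∂μ := by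
  rw [symbolOf, ContinuousLinearMap.comp_apply, partialFourier_apply]
  rfl

/-- Fourier inversion in each fibre over X, in the coordinate W = X•(-Y), whose inverse is Y =
(-W)•X. -/
theorem kernelOf_symbolOf (k : 𝓢(𝔤 × 𝔤, ℂ)) : kernelOf μ (symbolOf μ k) = k := by
  refine SchwartzMap.ext fun ⟨X, Y⟩ => ?_
  simp only [kernelOf_apply, symbolOf_apply]
  refine (integral_eI_inversion μ (fibre X (untwistKernel k)) (bch X (-Y))).trans ?_
  change k (X, bch (-bch X (-Y)) X) = k (X, Y)
  rw [bch_neg_bch_neg]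

theorem symbolOf_kernelOf (f : 𝓢(PhaseSpace 𝔤, ℂ)) : symbolOf μ (kernelOf μ f) = f := by
  refine SchwartzMap.ext fun ⟨X, ξ⟩ => ?_
  simp only [kernelOf_apply, symbolOf_apply, bch_neg_bch_neg']
  exact integral_eI_inversion_dual μ (fibre X f) ξ

theorem integral_bch_neg_left (X : 𝔤) {E : Type*} [NormedAddCommGroup E] [NormedSpace ℝ E]
    (f : 𝔤 → E) : ∫ W, f (bch (-W) X) ∂μ = ∫ Y, f Y ∂μ := by
  rw [integral_neg_eq_self (fun W => f (bch W X)) μ, integral_bch_right]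

/-- The kernel and the symbol are related by a unitary transformation, fibrewise. -/
theorem integral_kernelOf_mul_conj_fibre (f : 𝓢(PhaseSpace 𝔤, ℂ)) (k : 𝓢(𝔤 × 𝔤, ℂ)) (X : 𝔤) :
    ∫ Y, kernelOf μ f (X, Y) * conj (k (X, Y)) ∂μ =
      ∫ ξ, f (X, ξ) * conj (symbolOf μ k (X, ξ)) ∂(dualHaar μ) := by
  rw [← integral_bch_neg_left μ X]
  simp only [kernelOf_apply, bch_neg_bch_neg', symbolOf_apply, ← integral_conj, map_mul, conj_eI,
    neg_neg, ← integral_mul_const, ← integral_const_mul]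
  rw [integral_integral_swap]
  · refine integral_congr_ae (.of_forall fun ξ => integral_congr_ae (.of_forall fun W => ?_))
    ring
  -- Fubini applies because, up to a phase, the integrand is a tensor product of Schwartz functions
  -- of W and ξ.
  · have h := (tensorLeft (conjS (fibre X (untwistKernel k))) (fibre X f)).integrable
      (μ := μ.prod (dualHaar μ))
    refine h.norm.mono' ?_ (.of_forall fun p => ?_)
    · refine Continuous.aestronglyMeasurable ?_
      refine ((continuous_eI.comp ?_).mul (f.continuous.comp (by fun_prop))).mul
        (Complex.continuous_conj.comp (k.continuous.comp ?_))
      · exact isBoundedBilinearMap_apply.continuous.comp (continuous_snd.prodMk continuous_fst)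
      · exact continuous_const.prodMk (continuous_bch continuous_fst.neg continuous_const)
    · simp only [Function.uncurry, norm_mul, norm_eI, one_mul, RCLike.norm_conj, tensorLeft_apply,
        conjS_apply, fibre_apply, mul_comm]
      rfl

theorem integral_kernelOf_mul_conj (f : 𝓢(PhaseSpace 𝔤, ℂ)) (k : 𝓢(𝔤 × 𝔤, ℂ)) :
    ∫ X, ∫ Y, kernelOf μ f (X, Y) * conj (k (X, Y)) ∂μ ∂μ =
      ∫ 𝒳, f 𝒳 * conj (symbolOf μ k 𝒳) ∂(phaseMeasure μ) := by
  rw [integral_prod _ (integrable_mul_conj (phaseMeasure μ) f (symbolOf μ k))]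
  simp only [integral_kernelOf_mul_conj_fibre]

theorem integral_mul_conj_kernelOf (k : 𝓢(𝔤 × 𝔤, ℂ)) (f : 𝓢(PhaseSpace 𝔤, ℂ)) :
    ∫ X, ∫ Y, k (X, Y) * conj (kernelOf μ f (X, Y)) ∂μ ∂μ =
      ∫ 𝒳, symbolOf μ k 𝒳 * conj (f 𝒳) ∂(phaseMeasure μ) := by
  have h := integral_kernelOf_mul_conj μ (symbolOf μ k) (kernelOf μ f)
  rwa [kernelOf_symbolOf, symbolOf_kernelOf] at h

/-! ### Composition and adjoints of kernels -/

/-- Composition with the operator with kernel `l` on the right. -/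
noncomputable def kernelCompRight (l : 𝓢(𝔤 × 𝔤, ℂ)) : 𝓢(𝔤 × 𝔤, ℂ) →L[ℂ] 𝓢(𝔤 × 𝔤, ℂ) :=
  (fibreIntegral (E := 𝔤 × 𝔤) μ).comp
    ((temperateComp (g := fun q : (𝔤 × 𝔤) × 𝔤 => ((q.1.1, q.2), (q.2, q.1.2)))
      (g' := fun r => ((r.1.1, r.2.2), r.1.2))
      (((fst_hasTemperateGrowth.comp fst_hasTemperateGrowth).prodMk snd_hasTemperateGrowth).prodMk
        (snd_hasTemperateGrowth.prodMk (snd_hasTemperateGrowth.comp fst_hasTemperateGrowth)))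
      (((fst_hasTemperateGrowth.comp fst_hasTemperateGrowth).prodMk
        (snd_hasTemperateGrowth.comp snd_hasTemperateGrowth)).prodMk
        (snd_hasTemperateGrowth.comp fst_hasTemperateGrowth)) fun _ => rfl).comp (tensorRight l))

theorem kernelCompRight_apply (l k : 𝓢(𝔤 × 𝔤, ℂ)) (X Y : 𝔤) :
    kernelCompRight μ l k (X, Y) = ∫ Z, k (X, Z) * l (Z, Y) ∂μ :=
  fibreIntegral_apply μ _ _

/-- The transposed kernel. -/
noncomputable def swapKernel : 𝓢(𝔤 × 𝔤, ℂ) →L[ℂ] 𝓢(𝔤 × 𝔤, ℂ) :=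
  compCLMOfContinuousLinearEquiv ℂ (ContinuousLinearEquiv.prodComm ℝ 𝔤 𝔤)

theorem swapKernel_apply (k : 𝓢(𝔤 × 𝔤, ℂ)) (X Y : 𝔤) : swapKernel k (X, Y) = k (Y, X) := rfl

/-- Composition with the operator with kernel `l` on the left. -/
noncomputable def kernelCompLeft (l : 𝓢(𝔤 × 𝔤, ℂ)) : 𝓢(𝔤 × 𝔤, ℂ) →L[ℂ] 𝓢(𝔤 × 𝔤, ℂ) :=
  swapKernel.comp ((kernelCompRight μ (swapKernel l)).comp swapKernel)

theorem kernelCompLeft_apply (l k : 𝓢(𝔤 × 𝔤, ℂ)) (X Y : 𝔤) :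
    kernelCompLeft μ l k (X, Y) = ∫ Z, l (X, Z) * k (Z, Y) ∂μ := by
  refine (kernelCompRight_apply μ (swapKernel l) (swapKernel k) Y X).trans ?_
  simp only [swapKernel_apply, mul_comm]

/-- The kernel of the adjoint operator. -/
noncomputable def adjointKernel : 𝓢(𝔤 × 𝔤, ℂ) →SL[starRingEnd ℂ] 𝓢(𝔤 × 𝔤, ℂ) :=
  conjCLM.comp swapKernel

theorem adjointKernel_apply (k : 𝓢(𝔤 × 𝔤, ℂ)) (X Y : 𝔤) :
    adjointKernel k (X, Y) = conj (k (Y, X)) := rfl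

theorem opFun_eq (f : 𝓢(PhaseSpace 𝔤, ℂ)) (u : 𝔤 → ℂ) (X : 𝔤) :
    opFun μ f u X = ∫ Y, kernelOf μ f (X, Y) * u Y ∂μ := by
  simp only [opFun, kernelOf_apply, integral_mul_const]

/-- The product f # g is the symbol of Op(f)Op(g). The phase in ζ matches because Z•(-((-Y)•X)) =
(Z•(-X))•Y. -/
theorem symbolOf_kernelCompRight (f g : 𝓢(PhaseSpace 𝔤, ℂ)) (𝒳 : PhaseSpace 𝔤) :
    symbolOf μ (kernelCompRight μ (kernelOf μ g) (kernelOf μ f)) 𝒳 = moyalFun μ f g 𝒳 := by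
  obtain ⟨X, ξ⟩ := 𝒳
  simp only [symbolOf_apply, kernelCompRight_apply, moyalFun]
  refine integral_congr_ae (.of_forall fun Y => ?_)
  simp only
  rw [← integral_const_mul]
  refine integral_congr_ae (.of_forall fun Z => ?_)
  simp only [kernelOf_apply]
  rw [← integral_mul_const, ← integral_const_mul]
  refine integral_congr_ae (.of_forall fun η => ?_)
  simp only
  rw [← integral_const_mul, ← integral_const_mul]
  refine integral_congr_ae (.of_forall fun ζ => ?_)
  have h : bch Z (-bch (-Y) X) = bch (bch Z (-X)) Y := by rw [neg_bch_eq, neg_neg, bch_assoc]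
  simp only [h]
  ring

/-- The involution corresponds to the adjoint operator; its phase simplifies because ((-Y)•X)•(-X) =
-Y. -/
theorem symbolOf_adjointKernel (f : 𝓢(PhaseSpace 𝔤, ℂ)) (𝒳 : PhaseSpace 𝔤) :
    symbolOf μ (adjointKernel (kernelOf μ f)) 𝒳 = invFun μ f 𝒳 := by
  obtain ⟨X, ξ⟩ := 𝒳
  simp only [symbolOf_apply, invFun, adjointKernel_apply, kernelOf_apply, ← integral_conj]
  refine integral_congr_ae (.of_forall fun Y => ?_)
  simp only
  rw [← integral_const_mul]
  refine integral_congr_ae (.of_forall fun η => ?_)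
  simp only [bch_cancel_right, map_mul, conj_eI, map_neg, neg_neg, sub_apply]
  rw [sub_eq_neg_add, eI_add]
  ring

end Kernels

/-! ### The symbol calculus in terms of kernels -/

section SymbolCalculus

variable {𝔤 : Type*} [NormedLieRing 𝔤] [NormedLieAlgebra 𝔤] [FiniteDimensional ℝ 𝔤]
  [LieRing.IsNilpotent 𝔤]

theorem eI_neg_bch_hasTemperateGrowth (𝒵 : PhaseSpace 𝔤) :
    (fun X => eI (-(𝒵.2 (bch 𝒵.1 X)))).HasTemperateGrowth :=
  (eI_clm_hasTemperateGrowth (-𝒵.2)).comp (bch_hasTemperateGrowth (.const 𝒵.1) .id')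

theorem continuous_eps (𝒵 : PhaseSpace 𝔤) : Continuous (eps 𝒵) :=
  (continuous_eI.comp (𝒵.2.continuous.comp continuous_fst)).mul (continuous_eI.comp
    (((ContinuousLinearMap.apply ℝ ℝ 𝒵.1).continuous.comp continuous_snd).neg))

/-- Left multiplication by the operator `u ↦ a • u(Z • ·)` on kernels. -/
noncomputable def weightedShiftLeft (a : 𝔤 → ℂ) (Z : 𝔤) : 𝓢(𝔤 × 𝔤, ℂ) →L[ℂ] 𝓢(𝔤 × 𝔤, ℂ) :=
  (smulLeftCLM ℂ fun p : 𝔤 × 𝔤 => a p.1).comp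
    (temperateComp (g := fun p => (bch Z p.1, p.2)) (g' := fun p => (bch (-Z) p.1, p.2))
      ((bch_hasTemperateGrowth (.const Z) fst_hasTemperateGrowth).prodMk snd_hasTemperateGrowth)
      ((bch_hasTemperateGrowth (.const (-Z)) fst_hasTemperateGrowth).prodMk snd_hasTemperateGrowth)
      fun p => Prod.ext (neg_bch_cancel Z p.1) rfl)

theorem weightedShiftLeft_apply {a : 𝔤 → ℂ} (ha : a.HasTemperateGrowth) (Z : 𝔤)
    (k : 𝓢(𝔤 × 𝔤, ℂ)) (X Y : 𝔤) :
    weightedShiftLeft a Z k (X, Y) = a X * k (bch Z X, Y) :=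
  smulLeftCLM_apply_apply (ha.comp fst_hasTemperateGrowth) _ _

/-- Right multiplication by the operator `u ↦ a • u(Z • ·)` on kernels. -/
noncomputable def weightedShiftRight (a : 𝔤 → ℂ) (Z : 𝔤) : 𝓢(𝔤 × 𝔤, ℂ) →L[ℂ] 𝓢(𝔤 × 𝔤, ℂ) :=
  (temperateComp (g := fun p => (p.1, bch (-Z) p.2)) (g' := fun p => (p.1, bch Z p.2))
      (fst_hasTemperateGrowth.prodMk (bch_hasTemperateGrowth (.const (-Z)) snd_hasTemperateGrowth))
      (fst_hasTemperateGrowth.prodMk (bch_hasTemperateGrowth (.const Z) snd_hasTemperateGrowth))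
      fun p => Prod.ext rfl (bch_neg_cancel Z p.2)).comp
    (smulLeftCLM ℂ fun p : 𝔤 × 𝔤 => a p.2)

theorem weightedShiftRight_apply {a : 𝔤 → ℂ} (ha : a.HasTemperateGrowth) (Z : 𝔤)
    (k : 𝓢(𝔤 × 𝔤, ℂ)) (X Y : 𝔤) :
    weightedShiftRight a Z k (X, Y) = a (bch (-Z) Y) * k (X, bch (-Z) Y) :=
  smulLeftCLM_apply_apply (ha.comp snd_hasTemperateGrowth) k (X, bch (-Z) Y)

/-- The two operators act on different variables. This gives the associativity of ε_𝒴 # F # ε_𝒵^#.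
-/
theorem weightedShift_comm {a b : 𝔤 → ℂ} (ha : a.HasTemperateGrowth) (hb : b.HasTemperateGrowth)
    (Z W : 𝔤) (k : 𝓢(𝔤 × 𝔤, ℂ)) :
    weightedShiftLeft a Z (weightedShiftRight b W k) =
      weightedShiftRight b W (weightedShiftLeft a Z k) := by
  refine SchwartzMap.ext fun ⟨X, Y⟩ => ?_
  simp only [weightedShiftLeft_apply ha, weightedShiftRight_apply hb]
  ring

variable [MeasurableSpace 𝔤] [BorelSpace 𝔤] (μ : Measure 𝔤) [μ.IsAddHaarMeasure]

theorem moyalS_apply (f g : 𝓢(PhaseSpace 𝔤, ℂ)) (𝒳 : PhaseSpace 𝔤) :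
    moyalS μ f g 𝒳 = moyalFun μ f g 𝒳 :=
  Classical.epsilon_spec (p := fun k : 𝓢(PhaseSpace 𝔤, ℂ) => ∀ 𝒳, k 𝒳 = moyalFun μ f g 𝒳)
    ⟨_, symbolOf_kernelCompRight μ f g⟩ 𝒳

theorem moyalS_eq_right (f g : 𝓢(PhaseSpace 𝔤, ℂ)) :
    moyalS μ f g = symbolOf μ (kernelCompRight μ (kernelOf μ g) (kernelOf μ f)) :=
  SchwartzMap.ext fun 𝒳 => by rw [moyalS_apply, symbolOf_kernelCompRight]

/-- The product is exhibited as a continuous operator in its second factor, as duality for g # F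
requires; the other form serves F # g. -/
theorem moyalS_eq_left (f g : 𝓢(PhaseSpace 𝔤, ℂ)) :
    moyalS μ f g = symbolOf μ (kernelCompLeft μ (kernelOf μ f) (kernelOf μ g)) := by
  rw [moyalS_eq_right]
  congr 1
  refine SchwartzMap.ext fun ⟨X, Y⟩ => ?_
  rw [kernelCompRight_apply, kernelCompLeft_apply]

theorem invS_apply (f : 𝓢(PhaseSpace 𝔤, ℂ)) (𝒳 : PhaseSpace 𝔤) : invS μ f 𝒳 = invFun μ f 𝒳 :=
  Classical.epsilon_spec (p := fun k : 𝓢(PhaseSpace 𝔤, ℂ) => ∀ 𝒳, k 𝒳 = invFun μ f 𝒳)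
    ⟨_, symbolOf_adjointKernel μ f⟩ 𝒳

theorem invS_eq (f : 𝓢(PhaseSpace 𝔤, ℂ)) :
    invS μ f = symbolOf μ (adjointKernel (kernelOf μ f)) :=
  SchwartzMap.ext fun 𝒳 => by rw [invS_apply, symbolOf_adjointKernel]

theorem kernelOf_invS (f : 𝓢(PhaseSpace 𝔤, ℂ)) (X Y : 𝔤) :
    kernelOf μ (invS μ f) (X, Y) = conj (kernelOf μ f (Y, X)) := by
  rw [invS_eq, kernelOf_symbolOf, adjointKernel_apply]

theorem kernelOf_moyalS (f g : 𝓢(PhaseSpace 𝔤, ℂ)) (X Y : 𝔤) :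
    kernelOf μ (moyalS μ f g) (X, Y) = ∫ Z, kernelOf μ f (X, Z) * kernelOf μ g (Z, Y) ∂μ := by
  rw [moyalS_eq_right, kernelOf_symbolOf, kernelCompRight_apply]

theorem pair_moyalDS (F : 𝓢'(PhaseSpace 𝔤, ℂ)) (g h : 𝓢(PhaseSpace 𝔤, ℂ)) :
    pair (moyalDS μ F g) h = pair F (moyalS μ h (invS μ g)) := by
  refine Classical.epsilon_spec (p := fun T : 𝓢'(PhaseSpace 𝔤, ℂ) =>
    ∀ h, pair T h = pair F (moyalS μ h (invS μ g))) ⟨transposeD ((symbolOf μ).comp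
      ((kernelCompRight μ (kernelOf μ (invS μ g))).comp (kernelOf μ))) F, fun h => ?_⟩ h
  rw [pair_transposeD, moyalS_eq_right]
  rfl

theorem pair_moyalSD (F : 𝓢'(PhaseSpace 𝔤, ℂ)) (g h : 𝓢(PhaseSpace 𝔤, ℂ)) :
    pair (moyalSD μ g F) h = pair F (moyalS μ (invS μ g) h) := by
  refine Classical.epsilon_spec (p := fun T : 𝓢'(PhaseSpace 𝔤, ℂ) =>
    ∀ h, pair T h = pair F (moyalS μ (invS μ g) h)) ⟨transposeD ((symbolOf μ).comp
      ((kernelCompLeft μ (kernelOf μ (invS μ g))).comp (kernelOf μ))) F, fun h => ?_⟩ h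
  rw [pair_transposeD, moyalS_eq_left]
  rfl

theorem pair_invD (F : 𝓢'(PhaseSpace 𝔤, ℂ)) (h : 𝓢(PhaseSpace 𝔤, ℂ)) :
    pair (invD μ F) h = conj (pair F (invS μ h)) := by
  obtain ⟨T, hT⟩ := exists_pair_eq_conj
    (((symbolOf μ).comp (adjointKernel.comp (kernelOf μ)) :
      𝓢(PhaseSpace 𝔤, ℂ) →SL[starRingEnd ℂ] 𝓢(PhaseSpace 𝔤, ℂ))) F
  refine Classical.epsilon_spec (p := fun T : 𝓢'(PhaseSpace 𝔤, ℂ) =>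
    ∀ h, pair T h = conj (pair F (invS μ h))) ⟨T, fun h => ?_⟩ h
  rw [hT, invS_eq]
  rfl

/-- `D` is the symbol of the operator `u ↦ a • u(Z • ·)`. -/
def IsWeightedShift (D : 𝓢'(PhaseSpace 𝔤, ℂ)) (a : 𝔤 → ℂ) (Z : 𝔤) : Prop :=
  ∀ h, pair D h = ∫ X, a X * conj (kernelOf μ h (X, bch Z X)) ∂μ

variable {μ} {D : 𝓢'(PhaseSpace 𝔤, ℂ)} {a : 𝔤 → ℂ} {Z : 𝔤}

/-- By invariance of the measure, the adjoint of u ↦ a·u(Z•·) translates by -Z, with the conjugate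
weight translated accordingly. -/
theorem IsWeightedShift.invD (hD : IsWeightedShift μ D a Z) :
    IsWeightedShift μ (invD μ D) (fun X => conj (a (bch (-Z) X))) (-Z) := fun h => by
  rw [pair_invD, hD, ← integral_conj, ← integral_bch_left μ (-Z)]
  simp only [kernelOf_invS, bch_neg_cancel, map_mul, Complex.conj_conj]

theorem IsWeightedShift.eq {D' : 𝓢'(PhaseSpace 𝔤, ℂ)} (hD : IsWeightedShift μ D a Z)
    (hD' : IsWeightedShift μ D' a Z) : D = D' := pair_ext fun h => by rw [hD, hD']

/-- On kernels, D # g is the shift composed with Op(g), which only relabels and reweights the first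
variable. The result is therefore a Schwartz function. -/
theorem IsWeightedShift.moyalDS_eq (hD : IsWeightedShift μ D a Z) (ha : a.HasTemperateGrowth)
    (g : 𝓢(PhaseSpace 𝔤, ℂ)) : moyalDS μ D g =
      distS (phaseMeasure μ) (symbolOf μ (weightedShiftLeft a Z (kernelOf μ g))) :=
  pair_ext fun h => by
    rw [pair_moyalDS, hD, pair_distS, ← integral_mul_conj_kernelOf]
    refine integral_congr_ae (.of_forall fun X => ?_)
    simp only [kernelOf_moyalS, kernelOf_invS, weightedShiftLeft_apply ha]
    rw [← integral_conj, ← integral_const_mul]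
    refine integral_congr_ae (.of_forall fun Y => ?_)
    simp only [map_mul, Complex.conj_conj]
    ring

theorem IsWeightedShift.moyalSD_eq (hD : IsWeightedShift μ D a Z) (ha : a.HasTemperateGrowth)
    (g : 𝓢(PhaseSpace 𝔤, ℂ)) : moyalSD μ g D =
      distS (phaseMeasure μ) (symbolOf μ (weightedShiftRight a Z (kernelOf μ g))) :=
  pair_ext fun h => by
    rw [pair_moyalSD, hD, pair_distS, ← integral_mul_conj_kernelOf]
    -- The shift acts on the second variable here, so it is made the outer one and then translated
    -- by Z.
    rw [integral_integral_swap (integrable_mul_conj (μ.prod μ)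
      (weightedShiftRight a Z (kernelOf μ g)) (kernelOf μ h))]
    conv_rhs => rw [← integral_bch_left μ Z]
    refine integral_congr_ae (.of_forall fun X => ?_)
    simp only [kernelOf_moyalS, kernelOf_invS, weightedShiftRight_apply ha, neg_bch_cancel]
    rw [← integral_conj, ← integral_const_mul]
    refine integral_congr_ae (.of_forall fun Y => ?_)
    simp only [map_mul, Complex.conj_conj]
    ring

theorem IsWeightedShift.mem_moyalAlgebra (hD : IsWeightedShift μ D a Z)
    (ha : a.HasTemperateGrowth) : D ∈ moyalAlgebra μ :=
  ⟨fun g => ⟨_, (hD.moyalDS_eq ha g).symm⟩, fun g => ⟨_, (hD.moyalSD_eq ha g).symm⟩⟩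

theorem IsWeightedShift.schwartzOf_moyalDS (hD : IsWeightedShift μ D a Z)
    (ha : a.HasTemperateGrowth) (h : 𝓢(PhaseSpace 𝔤, ℂ)) :
    schwartzOf (phaseMeasure μ) (moyalDS μ D h) =
      symbolOf μ (weightedShiftLeft a Z (kernelOf μ h)) := by
  rw [hD.moyalDS_eq ha, schwartzOf_distS]

theorem IsWeightedShift.schwartzOf_moyalSD (hD : IsWeightedShift μ D a Z)
    (ha : a.HasTemperateGrowth) (h : 𝓢(PhaseSpace 𝔤, ℂ)) :
    schwartzOf (phaseMeasure μ) (moyalSD μ h D) =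
      symbolOf μ (weightedShiftRight a Z (kernelOf μ h)) := by
  rw [hD.moyalSD_eq ha, schwartzOf_distS]

/-- Since h ↦ G^# # h is a continuous operator on Schwartz functions, G # F exists as its transpose
applied to F. -/
theorem pair_moyalMD_of_isWeightedShift {G : 𝓢'(PhaseSpace 𝔤, ℂ)}
    (hG : IsWeightedShift μ (invD μ G) a Z) (ha : a.HasTemperateGrowth)
    (F : 𝓢'(PhaseSpace 𝔤, ℂ)) (h : 𝓢(PhaseSpace 𝔤, ℂ)) :
    pair (moyalMD μ G F) h = pair F (schwartzOf (phaseMeasure μ) (moyalDS μ (invD μ G) h)) := by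
  refine Classical.epsilon_spec (p := fun T : 𝓢'(PhaseSpace 𝔤, ℂ) =>
    ∀ h, pair T h = pair F (schwartzOf (phaseMeasure μ) (moyalDS μ (invD μ G) h)))
    ⟨transposeD ((symbolOf μ).comp ((weightedShiftLeft a Z).comp (kernelOf μ))) F, fun h => ?_⟩ h
  rw [pair_transposeD, hG.schwartzOf_moyalDS ha]
  rfl

theorem pair_moyalDM_of_isWeightedShift {G : 𝓢'(PhaseSpace 𝔤, ℂ)}
    (hG : IsWeightedShift μ (invD μ G) a Z) (ha : a.HasTemperateGrowth)
    (F : 𝓢'(PhaseSpace 𝔤, ℂ)) (h : 𝓢(PhaseSpace 𝔤, ℂ)) :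
    pair (moyalDM μ F G) h = pair F (schwartzOf (phaseMeasure μ) (moyalSD μ h (invD μ G))) := by
  refine Classical.epsilon_spec (p := fun T : 𝓢'(PhaseSpace 𝔤, ℂ) =>
    ∀ h, pair T h = pair F (schwartzOf (phaseMeasure μ) (moyalSD μ h (invD μ G))))
    ⟨transposeD ((symbolOf μ).comp ((weightedShiftRight a Z).comp (kernelOf μ))) F, fun h => ?_⟩ h
  rw [pair_transposeD, hG.schwartzOf_moyalSD ha]
  rfl

variable (μ)

theorem exists_pair_eq_integral_eps (𝒵 : PhaseSpace 𝔤) : ∃ T : 𝓢'(PhaseSpace 𝔤, ℂ),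
    ∀ h, pair T h = ∫ 𝒳, eps 𝒵 𝒳 * conj (h 𝒳) ∂(phaseMeasure μ) := by
  set ℓ : PhaseSpace 𝔤 →L[ℝ] ℝ := 𝒵.2.comp (ContinuousLinearMap.fst ℝ 𝔤 (𝔤 →L[ℝ] ℝ)) -
    (ContinuousLinearMap.apply ℝ ℝ 𝒵.1).comp (ContinuousLinearMap.snd ℝ 𝔤 (𝔤 →L[ℝ] ℝ)) with hℓ
  have hg : (eps 𝒵).HasTemperateGrowth := by
    have h1 : eps 𝒵 = fun 𝒳 => eI (ℓ 𝒳) := by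
      funext 𝒳
      rw [eps, ← eI_add, hℓ]
      rfl
    rw [h1]
    exact eI_clm_hasTemperateGrowth ℓ
  refine ⟨ContinuousLinearMap.toPointwiseConvergenceCLM _ _ _ _
    ((integralCLM ℂ (phaseMeasure μ)).comp (smulLeftCLM ℂ (eps 𝒵))), fun h => ?_⟩
  change ∫ 𝒳, smulLeftCLM ℂ (eps 𝒵) (conjS h) 𝒳 ∂(phaseMeasure μ) = _
  simp only [smulLeftCLM_apply_apply hg, conjS_apply, smul_eq_mul]

theorem pair_epsD (𝒵 : PhaseSpace 𝔤) (h : 𝓢(PhaseSpace 𝔤, ℂ)) :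
    pair (epsD μ 𝒵) h = ∫ 𝒳, eps 𝒵 𝒳 * conj (h 𝒳) ∂(phaseMeasure μ) :=
  Classical.epsilon_spec (p := fun T : 𝓢'(PhaseSpace 𝔤, ℂ) =>
    ∀ h, pair T h = ∫ 𝒳, eps 𝒵 𝒳 * conj (h 𝒳) ∂(phaseMeasure μ))
    (exists_pair_eq_integral_eps μ 𝒵) h

/-- The integral over ξ of e^{-i⟨Z|ξ⟩} conj h(X,ξ) is the conjugate kernel of h at the point Y with
X•(-Y) = Z. Thus ε_𝒵 is the symbol of E(𝒵). -/
theorem isWeightedShift_epsD (𝒵 : PhaseSpace 𝔤) :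
    IsWeightedShift μ (epsD μ 𝒵) (fun X => eI (𝒵.2 X)) (-𝒵.1) := fun h => by
  rw [pair_epsD, integral_prod]
  · refine integral_congr_ae (.of_forall fun X => ?_)
    simp only [eps, kernelOf_apply, mul_assoc, ← integral_conj, bch_neg_bch_neg']
    rw [integral_const_mul]
    simp only [map_mul, conj_eI]
  · refine (h.integrable (μ := phaseMeasure μ)).norm.mono' ?_ (.of_forall fun 𝒳 => ?_)
    · exact ((continuous_eps 𝒵).mul
        (Complex.continuous_conj.comp h.continuous)).aestronglyMeasurable
    · simp [eps, norm_eI]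

theorem isWeightedShift_invD_epsD (𝒵 : PhaseSpace 𝔤) :
    IsWeightedShift μ (invD μ (epsD μ 𝒵)) (fun X => eI (-(𝒵.2 (bch 𝒵.1 X)))) 𝒵.1 := by
  simpa only [neg_neg, conj_eI] using (isWeightedShift_epsD μ 𝒵).invD

theorem invD_invD_epsD (𝒵 : PhaseSpace 𝔤) : invD μ (invD μ (epsD μ 𝒵)) = epsD μ 𝒵 := by
  refine IsWeightedShift.eq ?_ (isWeightedShift_epsD μ 𝒵)
  simpa only [bch_neg_cancel, conj_eI, neg_neg] using (isWeightedShift_invD_epsD μ 𝒵).invD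

end SymbolCalculus

/-! ### The Weyl system -/

section Weyl

variable {𝔤 : Type*} [NormedLieRing 𝔤] [NormedLieAlgebra 𝔤] [FiniteDimensional ℝ 𝔤]
  [LieRing.IsNilpotent 𝔤]

theorem exists_weylAdjS (𝒵 : PhaseSpace 𝔤) : ∃ S : 𝓢(𝔤, ℂ) →L[ℂ] 𝓢(𝔤, ℂ),
    ∀ (u : 𝓢(𝔤, ℂ)) (X : 𝔤), S u X = weylAdjFun 𝒵 u X :=
  ⟨(smulLeftCLM ℂ fun X => eI (-(𝒵.2 (bch 𝒵.1 X)))).comp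
    (temperateComp (g := fun X => bch 𝒵.1 X) (g' := fun X => bch (-𝒵.1) X)
      (bch_hasTemperateGrowth (.const _) .id') (bch_hasTemperateGrowth (.const _) .id')
      (neg_bch_cancel 𝒵.1)), fun _ _ =>
    smulLeftCLM_apply_apply (eI_neg_bch_hasTemperateGrowth 𝒵) _ _⟩

theorem weylAdjS_apply (𝒵 : PhaseSpace 𝔤) (u : 𝓢(𝔤, ℂ)) (X : 𝔤) :
    weylAdjS 𝒵 u X = weylAdjFun 𝒵 u X :=
  Classical.epsilon_spec (p := fun S : 𝓢(𝔤, ℂ) →L[ℂ] 𝓢(𝔤, ℂ) =>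
    ∀ (u : 𝓢(𝔤, ℂ)) (X : 𝔤), S u X = weylAdjFun 𝒵 u X) (exists_weylAdjS 𝒵) u X

theorem pair_weylD (𝒵 : PhaseSpace 𝔤) (Φ : 𝓢'(𝔤, ℂ)) (v : 𝓢(𝔤, ℂ)) :
    pair (weylD 𝒵 Φ) v = pair Φ (weylAdjS 𝒵 v) :=
  Classical.epsilon_spec (p := fun S : 𝓢'(𝔤, ℂ) →L[ℂ] 𝓢'(𝔤, ℂ) =>
    ∀ (Φ : 𝓢'(𝔤, ℂ)) (v : 𝓢(𝔤, ℂ)), pair (S Φ) v = pair Φ (weylAdjS 𝒵 v))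
    ⟨transposeD (weylAdjS 𝒵), pair_transposeD _⟩ Φ v

theorem weylFun_weylAdjFun (𝒵 : PhaseSpace 𝔤) (u : 𝔤 → ℂ) :
    weylFun 𝒵 (weylAdjFun 𝒵 u) = u := by
  funext X
  simp only [weylFun, weylAdjFun, bch_neg_cancel]
  rw [← mul_assoc, eI_mul_eI_neg, one_mul]

variable [MeasurableSpace 𝔤] [BorelSpace 𝔤] (μ : Measure 𝔤) [μ.IsAddHaarMeasure]

theorem quasiMeasurePreserving_bch (Z : 𝔤) :
    Measure.QuasiMeasurePreserving (fun X => bch Z X) μ μ :=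
  (measurePreserving_leftTranslation μ Z).quasiMeasurePreserving

theorem eLpNorm_weightedShift {a : 𝔤 → ℂ} (ha : ∀ X, ‖a X‖ = 1) (Z : 𝔤) {u : 𝔤 → ℂ}
    (hu : AEStronglyMeasurable u μ) :
    eLpNorm (fun X => a X * u (bch Z X)) 2 μ = eLpNorm u 2 μ := by
  rw [← eLpNorm_comp_measurePreserving hu (measurePreserving_leftTranslation μ Z)]
  refine eLpNorm_congr_norm_ae (.of_forall fun X => ?_)
  rw [norm_mul, ha, one_mul]
  rfl

theorem memLp_weightedShift {a : 𝔤 → ℂ} (hc : Continuous a) (ha : ∀ X, ‖a X‖ = 1) (Z : 𝔤)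
    {u : 𝔤 → ℂ} (hu : MemLp u 2 μ) : MemLp (fun X => a X * u (bch Z X)) 2 μ :=
  ⟨hc.aestronglyMeasurable.mul
    (hu.1.comp_quasiMeasurePreserving (quasiMeasurePreserving_bch μ Z)), by
    rw [eLpNorm_weightedShift μ ha Z hu.1]
    exact hu.2⟩

theorem memLp_weylFun (𝒵 : PhaseSpace 𝔤) {u : 𝔤 → ℂ} (hu : MemLp u 2 μ) :
    MemLp (weylFun 𝒵 u) 2 μ :=
  memLp_weightedShift μ (continuous_eI.comp 𝒵.2.continuous) (fun _ => norm_eI _) _ hu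

theorem memLp_weylAdjFun (𝒵 : PhaseSpace 𝔤) {u : 𝔤 → ℂ} (hu : MemLp u 2 μ) :
    MemLp (weylAdjFun 𝒵 u) 2 μ :=
  memLp_weightedShift μ (eI_neg_bch_hasTemperateGrowth 𝒵).1.continuous (fun _ => norm_eI _) _ hu

theorem weylFun_congr_ae (𝒵 : PhaseSpace 𝔤) {u v : 𝔤 → ℂ} (h : u =ᵐ[μ] v) :
    weylFun 𝒵 u =ᵐ[μ] weylFun 𝒵 v := by
  filter_upwards [(quasiMeasurePreserving_bch μ (-𝒵.1)).ae h] with X hX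
  rw [weylFun, weylFun, hX]

/-- The Weyl operator as a linear isometry. -/
noncomputable def weylIsometry (𝒵 : PhaseSpace 𝔤) : Lp ℂ 2 μ →ₗᵢ[ℂ] Lp ℂ 2 μ where
  toFun u := (memLp_weylFun μ 𝒵 (Lp.memLp u)).toLp _
  map_add' u v := by
    rw [← MemLp.toLp_add]
    refine MemLp.toLp_congr _ _ ((weylFun_congr_ae μ 𝒵 (Lp.coeFn_add u v)).trans ?_)
    exact .of_forall fun X => mul_add _ _ _
  map_smul' c u := by
    rw [RingHom.id_apply, ← MemLp.toLp_const_smul]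
    refine MemLp.toLp_congr _ _ ((weylFun_congr_ae μ 𝒵 (Lp.coeFn_smul c u)).trans ?_)
    exact .of_forall fun X => mul_left_comm _ _ _
  norm_map' u := by
    refine (Lp.norm_toLp _ (memLp_weylFun μ 𝒵 (Lp.memLp u))).trans ?_
    rw [Lp.norm_def]
    congr 1
    exact eLpNorm_weightedShift μ (fun _ => norm_eI _) _ (Lp.aestronglyMeasurable u)

theorem weylIsometry_ae (𝒵 : PhaseSpace 𝔤) (u : Lp ℂ 2 μ) :
    (weylIsometry μ 𝒵 u : 𝔤 → ℂ) =ᵐ[μ] weylFun 𝒵 u :=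
  MemLp.coeFn_toLp (memLp_weylFun μ 𝒵 (Lp.memLp u))

theorem weylL2_ae (𝒵 : PhaseSpace 𝔤) (u : Lp ℂ 2 μ) :
    (weylL2 μ 𝒵 u : 𝔤 → ℂ) =ᵐ[μ] weylFun 𝒵 u :=
  Classical.epsilon_spec (p := fun S : Lp ℂ 2 μ →L[ℂ] Lp ℂ 2 μ =>
    ∀ u : Lp ℂ 2 μ, (S u : 𝔤 → ℂ) =ᵐ[μ] weylFun 𝒵 u)
    ⟨(weylIsometry μ 𝒵).toContinuousLinearMap, weylIsometry_ae μ 𝒵⟩ u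

theorem weylL2_toLp_weylAdjFun (𝒵 : PhaseSpace 𝔤) {u : 𝔤 → ℂ} (hu : MemLp u 2 μ) :
    weylL2 μ 𝒵 ((memLp_weylAdjFun μ 𝒵 hu).toLp _) = hu.toLp _ := by
  refine Lp.ext ((weylL2_ae μ 𝒵 _).trans ?_)
  refine (weylFun_congr_ae μ 𝒵 (MemLp.coeFn_toLp _)).trans ?_
  rw [weylFun_weylAdjFun]
  exact (MemLp.coeFn_toLp hu).symm

theorem weylL2_eq_weylIsometry (𝒵 : PhaseSpace 𝔤) (u : Lp ℂ 2 μ) :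
    weylL2 μ 𝒵 u = weylIsometry μ 𝒵 u :=
  Lp.ext ((weylL2_ae μ 𝒵 u).trans (weylIsometry_ae μ 𝒵 u).symm)

theorem adjoint_weylL2_mul_self (𝒵 : PhaseSpace 𝔤) :
    (ContinuousLinearMap.adjoint (weylL2 μ 𝒵)).comp (weylL2 μ 𝒵) = 1 :=
  (ContinuousLinearMap.norm_map_iff_adjoint_comp_self _).1 fun u => by
    rw [weylL2_eq_weylIsometry, LinearIsometry.norm_map]

/-- As E(𝒵) is isometric, its adjoint is a left inverse; every vector is E(𝒵) applied to the
explicit candidate, so the adjoint returns that candidate. -/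
theorem adjoint_weylL2_toLp (𝒵 : PhaseSpace 𝔤) {u : 𝔤 → ℂ} (hu : MemLp u 2 μ) :
    ContinuousLinearMap.adjoint (weylL2 μ 𝒵) (hu.toLp _) = (memLp_weylAdjFun μ 𝒵 hu).toLp _ := by
  rw [← weylL2_toLp_weylAdjFun μ 𝒵 hu]
  exact congrArg (fun T : Lp ℂ 2 μ →L[ℂ] Lp ℂ 2 μ => T _) (adjoint_weylL2_mul_self μ 𝒵)

theorem weylL2_unitary (𝒵 : PhaseSpace 𝔤) :
    weylL2 μ 𝒵 ∈ unitary (Lp ℂ 2 μ →L[ℂ] Lp ℂ 2 μ) := by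
  refine ⟨adjoint_weylL2_mul_self μ 𝒵, ContinuousLinearMap.ext fun u => ?_⟩
  change weylL2 μ 𝒵 (ContinuousLinearMap.adjoint (weylL2 μ 𝒵) u) = u
  rw [← Lp.toLp_coeFn u (Lp.memLp u), adjoint_weylL2_toLp, weylL2_toLp_weylAdjFun]

theorem adjoint_weylL2_toLp_schwartz (𝒵 : PhaseSpace 𝔤) (u : 𝓢(𝔤, ℂ)) :
    ContinuousLinearMap.adjoint (weylL2 μ 𝒵) (u.toLp 2 μ) = (weylAdjS 𝒵 u).toLp 2 μ := by
  refine (adjoint_weylL2_toLp μ 𝒵 (u.memLp 2 μ)).trans (MemLp.toLp_congr _ _ ?_)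
  exact .of_forall fun X => (weylAdjS_apply 𝒵 u X).symm

end Weyl

/-! ### Quantization and phase-space shifts -/

section Quantization

variable {𝔤 : Type*} [NormedLieRing 𝔤] [NormedLieAlgebra 𝔤] [FiniteDimensional ℝ 𝔤]
  [LieRing.IsNilpotent 𝔤] [MeasurableSpace 𝔤] [BorelSpace 𝔤] (μ : Measure 𝔤) [μ.IsAddHaarMeasure]

/-- The matrix coefficient ⟨Op(f)u, v⟩ pairs the kernel of f with the rank-one kernel v(X) conj
u(Y). This provides the Wigner transform. -/
theorem integral_opFun_mul_conj (u v : 𝓢(𝔤, ℂ)) (f : 𝓢(PhaseSpace 𝔤, ℂ)) :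
    ∫ X, opFun μ f u X * conj (v X) ∂μ =
      ∫ 𝒳, f 𝒳 * conj (symbolOf μ (tensorRight (conjS u) v) 𝒳) ∂(phaseMeasure μ) := by
  rw [← integral_kernelOf_mul_conj]
  refine integral_congr_ae (.of_forall fun X => ?_)
  simp only [opFun_eq]
  rw [← integral_mul_const]
  refine integral_congr_ae (.of_forall fun Y => ?_)
  simp only [tensorRight_apply, conjS_apply, map_mul, Complex.conj_conj]
  ring

theorem wigner_spec (u v : 𝓢(𝔤, ℂ)) (f : 𝓢(PhaseSpace 𝔤, ℂ)) :
    ∫ X, opFun μ f u X * conj (v X) ∂μ = ∫ 𝒳, f 𝒳 * conj (wigner μ u v 𝒳) ∂(phaseMeasure μ) :=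
  Classical.epsilon_spec (p := fun w : 𝓢(PhaseSpace 𝔤, ℂ) => ∀ f : 𝓢(PhaseSpace 𝔤, ℂ),
    ∫ X, opFun μ f u X * conj (v X) ∂μ = ∫ 𝒳, f 𝒳 * conj (w 𝒳) ∂(phaseMeasure μ))
    ⟨_, integral_opFun_mul_conj μ u v⟩ f

theorem wigner_eq (u v : 𝓢(𝔤, ℂ)) :
    wigner μ u v = symbolOf μ (tensorRight (conjS u) v) :=
  eq_of_integral_mul_conj_eq (phaseMeasure μ) fun f => by
    rw [← wigner_spec, integral_opFun_mul_conj]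

theorem exists_op (F : 𝓢'(PhaseSpace 𝔤, ℂ)) : ∃ A : 𝓢(𝔤, ℂ) →L[ℂ] 𝓢'(𝔤, ℂ),
    ∀ u v : 𝓢(𝔤, ℂ), pair (A u) v = pair F (wigner μ u v) := by
  -- S is the distributional kernel of Op(F), a functional on Schwartz functions of two variables.
  set S : 𝓢(𝔤 × 𝔤, ℂ) →L[ℂ] ℂ := (F : 𝓢(PhaseSpace 𝔤, ℂ) →L[ℂ] ℂ).comp
    (conjCLM.comp ((symbolOf μ).comp conjCLM)) with hS
  -- Continuity in u for fixed w suffices in the topology of pointwise convergence; it is visible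
  -- when the tensor product is read as a function of its other factor.
  have hT : ∀ u w : 𝓢(𝔤, ℂ), S (tensorRight u w) = S (tensorLeft w u) := fun u w =>
    congrArg S (SchwartzMap.ext fun p => (tensorLeft_apply w u p).symm)
  refine ⟨{ toFun := fun u => ContinuousLinearMap.toPointwiseConvergenceCLM _ _ _ _
              (S.comp (tensorRight u))
            map_add' := fun u v => DFunLike.ext _ _ fun w => ?_
            map_smul' := fun c u => DFunLike.ext _ _ fun w => ?_
            cont := PointwiseConvergenceCLM.continuous_of_continuous_eval fun w => ?_ },
    fun u v => ?_⟩
  · change S (tensorRight (u + v) w) = S (tensorRight u w) + S (tensorRight v w)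
    simp only [hT, map_add]
  · change S (tensorRight (c • u) w) = c • S (tensorRight u w)
    simp only [hT, map_smul]
  · refine (S.comp (tensorLeft w)).continuous.congr fun u => ?_
    exact (hT u w).symm
  · rw [wigner_eq]
    change F (conjS (symbolOf μ (conjS (tensorRight u (conjS v))))) = F (conjS _)
    congr 3
    refine SchwartzMap.ext fun p => ?_
    simp [conjS_apply, tensorRight_apply]

theorem pair_op (F : 𝓢'(PhaseSpace 𝔤, ℂ)) (u v : 𝓢(𝔤, ℂ)) :
    pair (op μ F u) v = pair F (wigner μ u v) :=
  Classical.epsilon_spec (p := fun A : 𝓢(𝔤, ℂ) →L[ℂ] 𝓢'(𝔤, ℂ) =>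
    ∀ u v : 𝓢(𝔤, ℂ), pair (A u) v = pair F (wigner μ u v)) (exists_op μ F) u v

theorem pair_moyalMD_epsD (𝒴 : PhaseSpace 𝔤) (F : 𝓢'(PhaseSpace 𝔤, ℂ)) (h : 𝓢(PhaseSpace 𝔤, ℂ)) :
    pair (moyalMD μ (epsD μ 𝒴) F) h = pair F (symbolOf μ
      (weightedShiftLeft (fun X => eI (-(𝒴.2 (bch 𝒴.1 X)))) 𝒴.1 (kernelOf μ h))) := by
  rw [pair_moyalMD_of_isWeightedShift (isWeightedShift_invD_epsD μ 𝒴)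
    (eI_neg_bch_hasTemperateGrowth 𝒴), (isWeightedShift_invD_epsD μ 𝒴).schwartzOf_moyalDS
    (eI_neg_bch_hasTemperateGrowth 𝒴)]

theorem isWeightedShift_invD_invD_epsD (𝒵 : PhaseSpace 𝔤) :
    IsWeightedShift μ (invD μ (invD μ (epsD μ 𝒵))) (fun X => eI (𝒵.2 X)) (-𝒵.1) := by
  rw [invD_invD_epsD]
  exact isWeightedShift_epsD μ 𝒵

theorem pair_moyalDM_invD_epsD (𝒵 : PhaseSpace 𝔤) (F : 𝓢'(PhaseSpace 𝔤, ℂ))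
    (h : 𝓢(PhaseSpace 𝔤, ℂ)) :
    pair (moyalDM μ F (invD μ (epsD μ 𝒵))) h = pair F (symbolOf μ
      (weightedShiftRight (fun X => eI (𝒵.2 X)) (-𝒵.1) (kernelOf μ h))) := by
  rw [pair_moyalDM_of_isWeightedShift (isWeightedShift_invD_invD_epsD μ 𝒵)
    (eI_clm_hasTemperateGrowth 𝒵.2), (isWeightedShift_invD_invD_epsD μ 𝒵).schwartzOf_moyalSD
    (eI_clm_hasTemperateGrowth 𝒵.2)]

/-- Transposition moves both factors to the test side, where the kernel of h is composed with E(𝒴)*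
on the left and E(𝒵) on the right. -/
theorem pair_theta (𝒴 𝒵 : PhaseSpace 𝔤) (F : 𝓢'(PhaseSpace 𝔤, ℂ)) (h : 𝓢(PhaseSpace 𝔤, ℂ)) :
    pair (theta μ 𝒴 𝒵 F) h = pair F (symbolOf μ
      (weightedShiftLeft (fun X => eI (-(𝒴.2 (bch 𝒴.1 X)))) 𝒴.1
        (weightedShiftRight (fun X => eI (𝒵.2 X)) (-𝒵.1) (kernelOf μ h)))) := by
  rw [theta, pair_moyalDM_invD_epsD, pair_moyalMD_epsD, kernelOf_symbolOf]

theorem moyal_assoc_epsD (𝒴 𝒵 : PhaseSpace 𝔤) (F : 𝓢'(PhaseSpace 𝔤, ℂ)) :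
    moyalDM μ (moyalMD μ (epsD μ 𝒴) F) (invD μ (epsD μ 𝒵)) =
      moyalMD μ (epsD μ 𝒴) (moyalDM μ F (invD μ (epsD μ 𝒵))) :=
  pair_ext fun h => by
    rw [pair_moyalDM_invD_epsD, pair_moyalMD_epsD, pair_moyalMD_epsD, pair_moyalDM_invD_epsD,
      kernelOf_symbolOf, kernelOf_symbolOf, weightedShift_comm
        (eI_neg_bch_hasTemperateGrowth 𝒴) (eI_clm_hasTemperateGrowth 𝒵.2)]

/-- On the rank-one kernel of W_{u,v} these two compositions apply E(𝒴)* to v and E(𝒵)* to u, which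
yields another Wigner transform. -/
theorem pair_op_theta (𝒴 𝒵 : PhaseSpace 𝔤) (F : 𝓢'(PhaseSpace 𝔤, ℂ)) (u v : 𝓢(𝔤, ℂ)) :
    pair (op μ (theta μ 𝒴 𝒵 F) u) v = pair (op μ F (weylAdjS 𝒵 u)) (weylAdjS 𝒴 v) := by
  rw [pair_op, pair_op, pair_theta, wigner_eq, wigner_eq, kernelOf_symbolOf]
  congr 2
  refine SchwartzMap.ext fun ⟨X, Y⟩ => ?_
  rw [weightedShiftLeft_apply (eI_neg_bch_hasTemperateGrowth 𝒴),
    weightedShiftRight_apply (eI_clm_hasTemperateGrowth 𝒵.2)]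
  simp only [tensorRight_apply, conjS_apply, weylAdjS_apply, weylAdjFun, map_mul, conj_eI, neg_neg]
  ring

theorem wellDefined : WellDefined μ where
  weylAdjS_apply := weylAdjS_apply
  pair_weylD := pair_weylD
  weylL2_ae := weylL2_ae μ
  weylL2_unitary := weylL2_unitary μ
  wigner_spec := wigner_spec μ
  pair_op := pair_op μ
  moyalS_apply := moyalS_apply μ
  invS_apply := invS_apply μ
  pair_moyalDS := pair_moyalDS μ
  pair_moyalSD := pair_moyalSD μ
  pair_invD := pair_invD μ
  pair_epsD := pair_epsD μ
  epsD_mem 𝒵 := (isWeightedShift_epsD μ 𝒵).mem_moyalAlgebra (eI_clm_hasTemperateGrowth 𝒵.2)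
  invD_epsD_mem 𝒵 :=
    (isWeightedShift_invD_epsD μ 𝒵).mem_moyalAlgebra (eI_neg_bch_hasTemperateGrowth 𝒵)
  invD_invD_epsD := invD_invD_epsD μ
  pair_moyalMD 𝒴 := pair_moyalMD_of_isWeightedShift (isWeightedShift_invD_epsD μ 𝒴)
    (eI_neg_bch_hasTemperateGrowth 𝒴)
  pair_moyalDM 𝒵 := pair_moyalDM_of_isWeightedShift (isWeightedShift_invD_invD_epsD μ 𝒵)
    (eI_clm_hasTemperateGrowth 𝒵.2)
  assoc := moyal_assoc_epsD μ

theorem thetaD_op (𝒴 𝒵 : PhaseSpace 𝔤) (F : 𝓢'(PhaseSpace 𝔤, ℂ)) :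
    ThetaD 𝒴 𝒵 (op μ F) = op μ (theta μ 𝒴 𝒵 F) := by
  refine ContinuousLinearMap.ext fun u => pair_ext fun v => ?_
  rw [pair_op_theta]
  exact pair_weylD 𝒴 _ v

theorem OpExtendsTo.theta {F : 𝓢'(PhaseSpace 𝔤, ℂ)} {T : Lp ℂ 2 μ →L[ℂ] Lp ℂ 2 μ}
    (h : OpExtendsTo μ F T) (𝒴 𝒵 : PhaseSpace 𝔤) :
    OpExtendsTo μ (theta μ 𝒴 𝒵 F) (ThetaB μ 𝒴 𝒵 T) := fun u v => by
  rw [pair_op_theta, h, ← adjoint_weylL2_toLp_schwartz, ← adjoint_weylL2_toLp_schwartz,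
    ContinuousLinearMap.adjoint_inner_left]
  rfl

end Quantization

/-- Conjugation with the Weyl system corresponds to the phase-space shift of symbols, at the level
of operators from `𝓢(𝔤)` to `𝓢'(𝔤)` and of bounded operators on `L²(𝔤)`, and the symbol
`C*`-algebra is invariant under these shifts. -/
theorem proposition5p2 {𝔤 : Type*} [NormedLieRing 𝔤] [NormedLieAlgebra 𝔤] [FiniteDimensional ℝ 𝔤]
    [LieRing.IsNilpotent 𝔤] [MeasurableSpace 𝔤] [BorelSpace 𝔤]
    (μ : Measure 𝔤) [μ.IsAddHaarMeasure] :
    WellDefined μ ∧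
    ∀ 𝒴 𝒵 : PhaseSpace 𝔤,
      (∀ F : 𝓢'(PhaseSpace 𝔤, ℂ), ThetaD 𝒴 𝒵 (op μ F) = op μ (theta μ 𝒴 𝒵 F)) ∧
      (∀ (F : 𝓢'(PhaseSpace 𝔤, ℂ)) (T : Lp ℂ 2 μ →L[ℂ] Lp ℂ 2 μ),
        OpExtendsTo μ F T → OpExtendsTo μ (theta μ 𝒴 𝒵 F) (ThetaB μ 𝒴 𝒵 T)) ∧
      (∀ F ∈ symbolAlgebra μ, theta μ 𝒴 𝒵 F ∈ symbolAlgebra μ) :=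
  ⟨wellDefined μ, fun 𝒴 𝒵 => ⟨thetaD_op μ 𝒴 𝒵, fun _ _ h => h.theta μ 𝒴 𝒵,
    fun _ ⟨_, hT⟩ => ⟨_, hT.theta μ 𝒴 𝒵⟩⟩⟩
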